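/- Let $\nu>0$ be a constant. Let $b,\eta\in C^\infty(\mathbb R^2)$ be real functions with $0<b_i\le b(x)\le b_s$ for constants $b_i,b_s$, and $\eta>0$ bounded; assume moreover that $\nabla b$ is bounded or that $\inf_{\mathbb R^2}\eta>0$. Consider on $\mathbb R^2\times[0,\infty)$ the viscous shallow water equations $$\partial_t u+u\cdot\nabla u+\eta u+\nabla p=\frac{\nu}{b}\,\nabla\cdot\big[b\,S(u)\big]+f,\qquad \nabla\cdot(bu)=0,\qquad u(\cdot,0)=u_0,$$ where $S(u)=\nabla u+(\nabla u)^T-I\,\nabla\cdot u$. Write $(v,w)_b=\int_{\mathbb R^2} b\,v\cdot w\,dx$ (and $\int b\,v:w$ for matrices), $H=\{v\in L^2(\mathbb R^2)^2:\nabla\cdot(bv)=0\}$ and $V=\{v\in H^1(\mathbb R^2)^2:\nabla\cdot(bv)=0\}$. A weak solution is a function $u$ that belongs to $C_w([0,T],H)\cap L^2(0,T;V)$ for every $T>0$ (where $C_w$ means bounded in $H$, with $t\mapsto(u(t),w)_b$ continuous for every $w\in H$) and satisfies $$(u(t),\phi(t))_b+\int_0^t\Big\{-(u,\partial_t\phi)_b+\tfrac{\nu}{2}\,(S(u),S(\phi))_b+(\eta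 u,\phi)_b+(u\cdot\nabla u,\phi)_b\Big\}\,d\tau=\int_0^t(\phi,f)_b\,d\tau+(u_0,\phi(0))_b$$ for all $t\ge0$ and all smooth vector fields $\phi\in C([0,\infty),V)\cap C^1([0,\infty),H)$. Suppose that $u_0\in L^1(\mathbb R^2)^2\cap L^2(\mathbb R^2)^2$, that $f(t)=\partial_1g_1(t)+\partial_2g_2(t)$ in the sense of distributions for a.e. $t\ge 0$, with vector fields $g_1,g_2\in L^\infty([0,\infty),L^1(\mathbb R^2)^2)$, and that $\|f(t)\|_2\le\kappa(e+t)^{-2}$ for a.e. $t\ge0$, with a constant $\kappa$. Then there is a constant $C$, depending only on $\nu,f,b,\eta$ and $u_0$, such that every weak solution $u$ satisfies $$\|u(t)\|_2\le C\,\big(\log(e+t)\big)^{-1/2}\qquad\text{for all }t\ge0 .$$ -/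

import Mathlib

open MeasureTheory Filter Topology Set
open scoped ContDiff ENNReal

namespace ShallowWater

/-- The plane `ℝ²` with its Euclidean norm. -/
abbrev Plane : Type := EuclideanSpace ℝ (Fin 2)

/-- The partial derivative `∂ⱼ θ` of a scalar function. -/
noncomputable def partialDeriv (θ : Plane → ℝ) (j : Fin 2) (x : Plane) : ℝ :=
  fderiv ℝ θ x (EuclideanSpace.single j 1)

/-- The classical gradient of a vector field: the entry `(i, j)` is `∂ⱼ vᵢ`. -/
noncomputable def grad (v : Plane → Plane) (i j : Fin 2) (x : Plane) : ℝ :=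
  partialDeriv (fun y => v y i) j x

/-- `G` is the weak (distributional) gradient of the vector field `v`, with `G i j = ∂ⱼ vᵢ`. -/
def HasWeakGradient (v : Plane → Plane) (G : Fin 2 → Fin 2 → Plane → ℝ) : Prop :=
  LocallyIntegrable v ∧ (∀ i j, LocallyIntegrable (G i j)) ∧
    ∀ θ : Plane → ℝ, ContDiff ℝ ∞ θ → HasCompactSupport θ → ∀ i j,
      ∫ x, v x i * partialDeriv θ j x = - ∫ x, G i j x * θ x

/-- `∇ · (b v) = 0` in the sense of distributions. -/
def WeightedDivFree (b : Plane → ℝ) (v : Plane → Plane) : Prop :=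
  ∀ θ : Plane → ℝ, ContDiff ℝ ∞ θ → HasCompactSupport θ →
    ∫ x, b x * ∑ i, v x i * partialDeriv θ i x = 0

/-- The space `H` of the fields `v ∈ L²(ℝ²)` with `∇ · (b v) = 0`.  The weight `b` is bounded above
and below by positive constants, so the weighted and the unweighted `L²` spaces coincide. -/
def MemH (b : Plane → ℝ) (v : Plane → Plane) : Prop :=
  MemLp v 2 volume ∧ WeightedDivFree b v

/-- The weighted scalar product `(v, w)_b = ∫ b v · w`. -/
noncomputable def innerB (b : Plane → ℝ) (v w : Plane → Plane) : ℝ :=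
  ∫ x, b x * ∑ i, v x i * w x i

/-- The matrix `G + Gᵀ - I tr G` attached to a gradient `G`, that is,
`∇u + (∇u)ᵀ - I ∇ · u` for `G = ∇u`. -/
noncomputable def stress (G : Fin 2 → Fin 2 → Plane → ℝ) (i j : Fin 2) (x : Plane) : ℝ :=
  G i j x + G j i x - if i = j then ∑ k, G k k x else 0

/-- The scalar product `∫ b S(G) : S(K)`, where `S(G) = G + Gᵀ - I tr G`. -/
noncomputable def stressForm (b : Plane → ℝ) (G K : Fin 2 → Fin 2 → Plane → ℝ) : ℝ :=
  ∫ x, b x * ∑ i, ∑ j, stress G i j x * stress K i j x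

/-- The convective term `(v · ∇u, w)_b`, where `G` is the gradient of `u`. -/
noncomputable def convection (b : Plane → ℝ) (v : Plane → Plane)
    (G : Fin 2 → Fin 2 → Plane → ℝ) (w : Plane → Plane) : ℝ :=
  ∫ x, b x * ∑ i, ∑ j, v x j * G i j x * w x i

/-- The time derivative `∂ₜ φ`. -/
noncomputable def timeDeriv (φ : ℝ → Plane → Plane) (t : ℝ) (x : Plane) : Plane :=
  deriv (fun s => φ s x) t

/-- The test fields: smooth vector fields in `C([0,∞), V) ∩ C¹([0,∞), H)`, where
`V = {v ∈ H¹(ℝ²) : ∇ · (b v) = 0}`.  A smooth field is of class `C¹` with values in `L²` if and only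
if it and its pointwise time derivative are continuous with values in `L²`. -/
structure IsTestField (b : Plane → ℝ) (φ : ℝ → Plane → Plane) : Prop where
  smooth : ContDiff ℝ ∞ (fun p : ℝ × Plane => φ p.1 p.2)
  memH : ∀ t, 0 ≤ t → MemH b (φ t)
  grad_memLp : ∀ t, 0 ≤ t → ∀ i j, MemLp (grad (φ t) i j) 2 volume
  timeDeriv_memH : ∀ t, 0 ≤ t → MemH b (timeDeriv φ t)
  continuous_L2 : ∀ t, 0 ≤ t →
    Tendsto (fun s => eLpNorm (φ s - φ t) 2 volume) (𝓝[Ici 0] t) (𝓝 0)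
  continuous_grad : ∀ t, 0 ≤ t → ∀ i j,
    Tendsto (fun s => eLpNorm (grad (φ s) i j - grad (φ t) i j) 2 volume) (𝓝[Ici 0] t) (𝓝 0)
  continuous_timeDeriv : ∀ t, 0 ≤ t →
    Tendsto (fun s => eLpNorm (timeDeriv φ s - timeDeriv φ t) 2 volume) (𝓝[Ici 0] t) (𝓝 0)

/-- `u`, with weak spatial gradient `Du`, is a weak solution of
`∂ₜ u + u · ∇u + ∇p + η u = (ν / b) ∇ · [b (∇u + (∇u)ᵀ - I ∇ · u)] + f`, `∇ · (b u) = 0`,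
`u(0) = u₀` on `ℝ² × [0, ∞)`: for every `T > 0` it lies in `C_w([0,T], H) ∩ L²(0,T; V)`, and it
satisfies the integral identity for all test fields.  The viscous term carries the factor `ν / 2`,
because `S(∇u) : ∇φ = S(∇u) : S(∇φ) / 2` for the symmetric trace-free matrix `S(∇u)`. -/
structure IsWeakSolutionWith (ν : ℝ) (b η : Plane → ℝ) (f : ℝ → Plane → Plane)
    (u₀ : Plane → Plane) (u : ℝ → Plane → Plane)
    (Du : ℝ → Fin 2 → Fin 2 → Plane → ℝ) : Prop where
  memH : ∀ t, 0 ≤ t → MemH b (u t)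
  bounded : ∀ T, 0 < T → ∃ M : ℝ, ∀ t ∈ Icc 0 T, eLpNorm (u t) 2 volume ≤ ENNReal.ofReal M
  weaklyContinuous : ∀ w, MemH b w → ContinuousOn (fun t => innerB b (u t) w) (Ici 0)
  memLp : ∀ T, 0 < T →
    MemLp (fun p : ℝ × Plane => u p.1 p.2) 2 ((volume.restrict (Icc 0 T)).prod volume)
  hasWeakGradient : ∀ᵐ t ∂(volume.restrict (Ici (0 : ℝ))), HasWeakGradient (u t) (Du t)
  grad_memLp : ∀ T, 0 < T → ∀ i j,
    MemLp (fun p : ℝ × Plane => Du p.1 i j p.2) 2 ((volume.restrict (Icc 0 T)).prod volume)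
  identity : ∀ φ, IsTestField b φ → ∀ t, 0 ≤ t →
    innerB b (u t) (φ t) +
      ∫ τ in (0 : ℝ)..t,
        (- innerB b (u τ) (timeDeriv φ τ) + ν / 2 * stressForm b (Du τ) (grad (φ τ)) +
          innerB b (fun x => η x • u τ x) (φ τ) + convection b (u τ) (Du τ) (φ τ)) =
    (∫ τ in (0 : ℝ)..t, innerB b (φ τ) (f τ)) + innerB b u₀ (φ 0)

/-- `u` is a weak solution of the viscous shallow water equations on the plane. -/
def IsWeakSolution (ν : ℝ) (b η : Plane → ℝ) (f : ℝ → Plane → Plane)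
    (u₀ : Plane → Plane) (u : ℝ → Plane → Plane) : Prop :=
  ∃ Du : ℝ → Fin 2 → Fin 2 → Plane → ℝ, IsWeakSolutionWith ν b η f u₀ u Du

/-- `F = ∂₁ G₁ + ∂₂ G₂` in the sense of distributions, for vector fields `F`, `G₁`, `G₂`. -/
def IsFirstDerivOf (F : Plane → Plane) (G : Fin 2 → Plane → Plane) : Prop :=
  ∀ θ : Plane → ℝ, ContDiff ℝ ∞ θ → HasCompactSupport θ → ∀ i,
    ∫ x, F x i * θ x = - ∑ j, ∫ x, G j x i * partialDeriv θ j x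

end ShallowWater

/-!
# Logarithmic decay for the viscous shallow water equations

Let `E(t) = (u(t), u(t))_b` and let `D(t) = ∫ η |u(t)|² + |∇u(t)|²` be the dissipation.  The proof
has two parts: an energy identity for weak solutions, and a second, averaged estimate of the energy
which leads to a recursive inequality.

**Energy identity.**  Smooth fields are dense in `V` (`exists_smooth_divFree_approx`).  By the weak
formulation with time-independent test fields, and by density, for almost every `s` and every `t`

`(u(t), u(s))_b = (u₀, u(s))_b + ∫₀ᵗ ⟨N(τ), U(s)⟩ dτ`,

where `U(s)` collects the components of `u(s)` and of `∇u(s)`, and `N(τ)` the damping, viscous,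
convective and forcing terms (`Curves.pairing`).  By Ladyzhenskaya's inequality
(`exists_ladyzhenskaya`), `N` and `U` are square integrable curves in a Hilbert space; this is
special to dimension two.  The symmetry of the left-hand side then gives `E' = 2 ⟨N, U⟩`, by a limit
of Steklov averages (`energy_identity`).  The convective term drops out of `⟨N, U⟩`
(`transport_antisymm`), and Korn's inequality (`le_stressForm`) bounds the viscous term from below:
`∫ |S(u)|² ≥ 2 ∫ |∇u|²` because the determinant of `∇u` has integral zero.  As the force decays like
`(e + t)⁻²`, the function `Φ(t) = E(t) + C / (e + t)` satisfies `Φ(t) + c ∫ₛᵗ D ≤ Φ(s)`.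

**The second estimate.**  For `t = s` the displayed identity, with the convective term integrated by
parts and Ladyzhenskaya's inequality, gives

`E(s) ≤ (u₀, u(s))_b + C √D(s) ∫₀ˢ √D(τ) dτ + ∫₀ˢ |(u(s), f(τ))_b| dτ`.

The first term is at most a multiple of `D(s)^(1/4)`, since `√|u₀|` is in `L²` and in `L⁴`
(`exists_innerB_initial_le`).  If `∇b` is bounded, the last term is treated in the same way up to a
small error, by a mollification of `b u(s)` and `f = ∂₁g₁ + ∂₂g₂` (`exists_abs_innerB_force_le`).
If instead `η` is bounded below, `E(s)` is at most a multiple of `D(s)`, and none of this is needed.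

**Recursion.**  Averaging over `s ∈ [T, 2T]`, splitting `∫₀ˢ √D` at `σ ≤ T` and bounding `∫ D` by
differences of `Φ` (`recursion_step`), one obtains, for `T ≥ 1`,

`Φ(2T) ≤ A (Φ(σ) - Φ(2T)) + B (√(σ / T) + T^(-1/20))`.

So `Φ(2T)` is at most a fixed fraction of `Φ(σ)`, up to an error.  With `σ = T^r` for an exponent
`r` slightly less than one, this yields `Φ(t) ≤ C / log (e + t)` (`exists_log_decay`).
-/

set_option linter.unusedSectionVars false

namespace ShallowWater

/-! ### Averages of translates -/

section Averages

variable {Ω E X : Type*} [MeasurableSpace Ω] {κ : Measure Ω}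
  [NormedAddCommGroup E] [MeasurableSpace E] [BorelSpace E] [SecondCountableTopology E]
  {μ : Measure E} [SFinite μ]
  [NormedAddCommGroup X] [NormedSpace ℝ X]

lemma lintegral_sq_le (κ : Measure Ω) {h : Ω → ℝ≥0∞} (hh : AEMeasurable h κ) :
    (∫⁻ z, h z ∂κ) ^ 2 ≤ κ univ * ∫⁻ z, h z ^ 2 ∂κ := by
  have := ENNReal.lintegral_mul_le_Lp_mul_Lq κ (p := 2) (q := 2)
    (Real.HolderConjugate.two_two) (f := fun _ => 1) (g := h) aemeasurable_const hh
  simp only [Pi.mul_apply, one_mul, ENNReal.one_rpow, lintegral_const] at this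
  calc (∫⁻ z, h z ∂κ) ^ 2 ≤ (κ univ ^ (1 / 2 : ℝ) * (∫⁻ z, h z ^ (2:ℝ) ∂κ) ^ (1 / 2 : ℝ)) ^ 2 := by
        gcongr
    _ = _ := by
        rw [mul_pow, ← ENNReal.rpow_natCast, ← ENNReal.rpow_natCast, ← ENNReal.rpow_mul,
          ← ENNReal.rpow_mul]
        norm_num

lemma eLpNorm_two_sq {α : Type*} [MeasurableSpace α] (m : Measure α) (f : α → X) :
    eLpNorm f 2 m ^ 2 = ∫⁻ x, ‖f x‖ₑ ^ 2 ∂m := by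
  rw [eLpNorm_eq_lintegral_rpow_enorm_toReal (by norm_num) (by norm_num),
    ← ENNReal.rpow_natCast, ← ENNReal.rpow_mul]
  norm_num

/-- **Minkowski's integral inequality** in `L²`, for integrands with uniformly bounded norm. -/
lemma eLpNorm_integral_le [IsFiniteMeasure κ] {H : E → Ω → X}
    (hH : AEStronglyMeasurable (fun p : E × Ω => H p.1 p.2) (μ.prod κ)) {B : ℝ≥0∞}
    (hB : ∀ᵐ z ∂κ, eLpNorm (fun x => H x z) 2 μ ≤ B) :
    eLpNorm (fun x => ∫ z, H x z ∂κ) 2 μ ≤ κ univ * B := by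
  have hm : AEMeasurable (fun p : E × Ω => ‖H p.1 p.2‖ₑ) (μ.prod κ) := hH.enorm
  have h1 : ∫⁻ x, ‖∫ z, H x z ∂κ‖ₑ ^ 2 ∂μ ≤ κ univ * ∫⁻ x, ∫⁻ z, ‖H x z‖ₑ ^ 2 ∂κ ∂μ := by
    rw [← lintegral_const_mul' _ _ (measure_ne_top _ _)]
    apply lintegral_mono_ae
    filter_upwards [hH.prodMk_left] with x hx
    calc ‖∫ z, H x z ∂κ‖ₑ ^ 2 ≤ (∫⁻ z, ‖H x z‖ₑ ∂κ) ^ 2 := by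
          gcongr; exact enorm_integral_le_lintegral_enorm _
      _ ≤ _ := lintegral_sq_le κ hx.enorm
  have h2 : ∫⁻ x, ∫⁻ z, ‖H x z‖ₑ ^ 2 ∂κ ∂μ = ∫⁻ z, ∫⁻ x, ‖H x z‖ₑ ^ 2 ∂μ ∂κ :=
    lintegral_lintegral_swap (hm.pow_const 2)
  have h3 : ∫⁻ z, ∫⁻ x, ‖H x z‖ₑ ^ 2 ∂μ ∂κ ≤ B ^ 2 * κ univ := by
    rw [← lintegral_const]
    apply lintegral_mono_ae
    filter_upwards [hB] with z hz
    rw [← eLpNorm_two_sq]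
    gcongr
  have h4 : eLpNorm (fun x => ∫ z, H x z ∂κ) 2 μ ^ 2 ≤ (κ univ * B) ^ 2 := by
    rw [eLpNorm_two_sq]
    calc _ ≤ _ := h1
      _ ≤ κ univ * (B ^ 2 * κ univ) := by rw [h2]; gcongr
      _ = _ := by ring
  exact le_of_not_gt fun h => h4.not_gt (ENNReal.pow_right_strictMono two_ne_zero h)

variable [μ.IsAddRightInvariant]

lemma quasiMeasurePreserving_shift [SFinite κ] {s : Ω → E} (hs : Measurable s) :
    Measure.QuasiMeasurePreserving (fun p : E × Ω => p.1 + s p.2) (μ.prod κ) μ := by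
  have hm : Measurable (fun p : E × Ω => p.1 + s p.2) := by fun_prop
  refine ⟨hm, Measure.AbsolutelyContinuous.mk fun A hA h0 => ?_⟩
  rw [Measure.map_apply hm hA, Measure.prod_apply_symm (hm hA)]
  have : ∀ z, μ ((fun x => (x, z)) ⁻¹' ((fun p : E × Ω => p.1 + s p.2) ⁻¹' A)) = 0 := by
    intro z
    have := (measurePreserving_add_right μ (s z)).measure_preimage hA.nullMeasurableSet
    rw [← h0, ← this]; rfl
  simp [this]

lemma aestronglyMeasurable_shift [SFinite κ] {s : Ω → E} (hs : Measurable s) {f : E → X}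
    (hf : AEStronglyMeasurable f μ) :
    AEStronglyMeasurable (fun p : E × Ω => f (p.1 + s p.2)) (μ.prod κ) :=
  hf.comp_quasiMeasurePreserving (quasiMeasurePreserving_shift hs)

lemma eLpNorm_shift {f : E → X} (hf : AEStronglyMeasurable f μ) (y : E) (p : ℝ≥0∞) :
    eLpNorm (fun x => f (x + y)) p μ = eLpNorm f p μ :=
  eLpNorm_comp_measurePreserving hf (measurePreserving_add_right μ y)

/-- The weighted average `∫ c(z) f(x + s(z)) dκ(z)` of translates of `f`. -/
noncomputable def shiftAvg (κ : Measure Ω) (s : Ω → E) (c : Ω → ℝ) (f : E → X) (x : E) : X :=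
  ∫ z, c z • f (x + s z) ∂κ

variable [IsFiniteMeasure κ] {s : Ω → E} {c : Ω → ℝ}

lemma shiftAvg_aesm_integrand (hs : Measurable s) (hc : Measurable c) {f : E → X}
    (hf : AEStronglyMeasurable f μ) :
    AEStronglyMeasurable (fun p : E × Ω => c p.2 • f (p.1 + s p.2)) (μ.prod κ) :=
  (hc.comp measurable_snd).aestronglyMeasurable.smul (aestronglyMeasurable_shift hs hf)

lemma eLpNorm_shiftAvg_le (hs : Measurable s) (hc : Measurable c) {C : ℝ}
    (hC : ∀ z, |c z| ≤ C) {f : E → X} (hf : AEStronglyMeasurable f μ) :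
    eLpNorm (shiftAvg κ s c f) 2 μ ≤ κ univ * (ENNReal.ofReal C * eLpNorm f 2 μ) := by
  refine eLpNorm_integral_le (shiftAvg_aesm_integrand hs hc hf) (Eventually.of_forall fun z => ?_)
  have : (fun x => c z • f (x + s z)) = c z • fun x => f (x + s z) := rfl
  rw [this, eLpNorm_const_smul, eLpNorm_shift hf]
  gcongr
  rw [← ofReal_norm]
  exact ENNReal.ofReal_le_ofReal (hC z)

lemma memLp_shiftAvg (hs : Measurable s) (hc : Measurable c) {C : ℝ}
    (hC : ∀ z, |c z| ≤ C) {f : E → X} (hf : MemLp f 2 μ) :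
    MemLp (shiftAvg κ s c f) 2 μ := by
  refine ⟨(shiftAvg_aesm_integrand hs hc hf.1).integral_prod_right', ?_⟩
  refine (eLpNorm_shiftAvg_le hs hc hC hf.1).trans_lt ?_
  exact ENNReal.mul_lt_top (measure_lt_top _ _) (ENNReal.mul_lt_top ENNReal.ofReal_lt_top hf.2)

/-- For an `L²` function almost every fibre of the averaging integrand is integrable. -/
lemma integrable_shiftAvg_integrand (hs : Measurable s) (hc : Measurable c) {C : ℝ}
    (hC : ∀ z, |c z| ≤ C) {f : E → X} (hf : MemLp f 2 μ) :
    ∀ᵐ x ∂μ, Integrable (fun z => c z • f (x + s z)) κ := by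
  have hm := shiftAvg_aesm_integrand (κ := κ) hs hc hf.1
  have h1 : ∫⁻ x, ∫⁻ z, ‖c z • f (x + s z)‖ₑ ^ 2 ∂κ ∂μ ≠ ⊤ := by
    rw [lintegral_lintegral_swap (hm.enorm.pow_const 2)]
    have : ∀ z, ∫⁻ x, ‖c z • f (x + s z)‖ₑ ^ 2 ∂μ ≤ (ENNReal.ofReal C * eLpNorm f 2 μ) ^ 2 := by
      intro z
      rw [← eLpNorm_two_sq]
      have : (fun x => c z • f (x + s z)) = c z • fun x => f (x + s z) := rfl
      rw [this, eLpNorm_const_smul, eLpNorm_shift hf.1]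
      gcongr
      rw [← ofReal_norm]
      exact ENNReal.ofReal_le_ofReal (hC z)
    refine ((lintegral_mono this).trans_lt ?_).ne
    rw [lintegral_const]
    exact ENNReal.mul_lt_top (ENNReal.pow_lt_top (ENNReal.mul_lt_top ENNReal.ofReal_lt_top hf.2))
      (measure_lt_top _ _)
  have h2 := ae_lt_top' ((hm.enorm.pow_const 2).lintegral_prod_right') h1
  filter_upwards [h2, hm.prodMk_left] with x hx hx2
  have : MemLp (fun z => c z • f (x + s z)) 2 κ := by
    refine ⟨hx2, ?_⟩
    have h3 : eLpNorm (fun z => c z • f (x + s z)) 2 κ ^ 2 < ⊤ := by rw [eLpNorm_two_sq]; exact hx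
    by_contra h
    rw [not_lt, top_le_iff] at h
    rw [h] at h3
    simp at h3
  exact this.integrable (by norm_num)

/-- Translations act continuously on `L²`. -/
lemma tendsto_eLpNorm_shift_sub [LocallyCompactSpace E] [IsLocallyFiniteMeasure μ]
    [μ.InnerRegularCompactLTTop] {f : E → X} (hf : MemLp f 2 μ) :
    Tendsto (fun y => eLpNorm (fun x => f (x + y) - f x) 2 μ) (𝓝 0) (𝓝 0) := by
  let F := hf.toLp f
  have hg : Continuous (fun y : E => (⟨fun x => x + y, by fun_prop⟩ : C(E, E))) := by
    apply ContinuousMap.continuous_of_continuous_uncurry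
    simp only [Function.uncurry_def, ContinuousMap.coe_mk]
    fun_prop
  have hc := Continuous.compMeasurePreservingLp (p := 2) (μ := μ) (ν := μ)
    (f := fun _ : E => F) continuous_const hg
    (fun y => measurePreserving_add_right μ y) (by norm_num)
  have h0 := hc.tendsto 0
  rw [tendsto_iff_edist_tendsto_0] at h0
  refine h0.congr fun y => ?_
  rw [Lp.edist_def]
  apply eLpNorm_congr_ae
  have e1 := Lp.coeFn_compMeasurePreserving F (measurePreserving_add_right μ y)
  have e2 := Lp.coeFn_compMeasurePreserving F (measurePreserving_add_right μ 0)
  have e3 := hf.coeFn_toLp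
  have e4 := (measurePreserving_add_right μ y).quasiMeasurePreserving.ae_eq_comp hf.coeFn_toLp
  filter_upwards [e1, e2, e3, e4] with x h1 h2 h3 h4
  simp only [Function.comp_apply] at h1 h2 h4
  simp only [Pi.sub_apply, ContinuousMap.coe_mk, F] at *
  rw [h1, h2]
  simp only [add_zero]
  rw [h4, h3]

/-- Averages over small translations with total weight one differ little from the function. -/
lemma eLpNorm_shiftAvg_sub_le [CompleteSpace X] (hs : Measurable s) (hc : Measurable c) {C : ℝ}
    (hC : ∀ z, |c z| ≤ C) (hc1 : ∫ z, c z ∂κ = 1) {f : E → X} (hf : MemLp f 2 μ) {B : ℝ≥0∞}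
    (hB : ∀ᵐ z ∂κ, eLpNorm (fun x => f (x + s z) - f x) 2 μ ≤ B) :
    eLpNorm (fun x => shiftAvg κ s c f x - f x) 2 μ ≤ κ univ * (ENNReal.ofReal C * B) := by
  have hci : Integrable c κ := by
    exact Integrable.of_bound hc.aestronglyMeasurable C (Eventually.of_forall hC)
  have e : (fun x => shiftAvg κ s c f x - f x) =ᵐ[μ]
      fun x => ∫ z, c z • (f (x + s z) - f x) ∂κ := by
    filter_upwards [integrable_shiftAvg_integrand (κ := κ) hs hc hC hf] with x hx
    simp only [smul_sub]
    rw [integral_sub hx (hci.smul_const _), integral_smul_const, hc1, one_smul]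
    rfl
  rw [eLpNorm_congr_ae e]
  refine eLpNorm_integral_le (κ := κ) (H := fun x z => c z • (f (x + s z) - f x)) ?_ ?_
  · exact (hc.comp measurable_snd).aestronglyMeasurable.smul
      ((aestronglyMeasurable_shift hs hf.1).sub hf.1.comp_fst)
  · filter_upwards [hB] with z hz
    have : (fun x => c z • (f (x + s z) - f x)) = c z • fun x => (f (x + s z) - f x) := rfl
    rw [this, eLpNorm_const_smul]
    gcongr
    · rw [← ofReal_norm]
      exact ENNReal.ofReal_le_ofReal (hC z)

/-- The adjoint of an average of translates. -/
lemma integral_shiftAvg_mul (hs : Measurable s) (hc : Measurable c) {C : ℝ}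
    (hC : ∀ z, |c z| ≤ C) {f θ : E → ℝ} (hf : MemLp f 2 μ) (hθ : MemLp θ 2 μ) :
    Integrable (fun z => ∫ x, c z * (f x * θ (x - s z)) ∂μ) κ ∧
    ∫ x, shiftAvg κ s c f x * θ x ∂μ = ∫ z, ∫ x, c z * (f x * θ (x - s z)) ∂μ ∂κ := by
  have hC0 : ∀ z, ENNReal.ofReal |c z| ≤ ENNReal.ofReal C := fun z =>
    ENNReal.ofReal_le_ofReal (hC z)
  have hm : AEStronglyMeasurable (fun p : E × Ω => c p.2 * f (p.1 + s p.2) * θ p.1) (μ.prod κ) :=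
    (shiftAvg_aesm_integrand hs hc hf.1).mul hθ.1.comp_fst
  have hint : Integrable (fun p : E × Ω => c p.2 * f (p.1 + s p.2) * θ p.1) (μ.prod κ) := by
    refine ⟨hm, ?_⟩
    rw [hasFiniteIntegral_iff_enorm, lintegral_prod_symm _ hm.enorm]
    have : ∀ z, ∫⁻ x, ‖c z * f (x + s z) * θ x‖ₑ ∂μ ≤
        ENNReal.ofReal C * (eLpNorm f 2 μ * eLpNorm θ 2 μ) := by
      intro z
      calc ∫⁻ x, ‖c z * f (x + s z) * θ x‖ₑ ∂μ
          ≤ ∫⁻ x, ENNReal.ofReal C * ‖f (x + s z) * θ x‖ₑ ∂μ := by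
            apply lintegral_mono
            intro x
            simp only
            rw [mul_assoc, enorm_mul]
            gcongr
            rw [← ofReal_norm]
            exact hC0 z
        _ = ENNReal.ofReal C * ∫⁻ x, ‖f (x + s z) * θ x‖ₑ ∂μ :=
            lintegral_const_mul' _ _ ENNReal.ofReal_ne_top
        _ ≤ _ := by
            gcongr
            rw [← eLpNorm_one_eq_lintegral_enorm, ← eLpNorm_shift hf.1 (s z) 2]
            have := eLpNorm_smul_le_mul_eLpNorm (p := 2) (q := 2) (r := 1) (μ := μ) hθ.1
              (f := θ) (φ := fun x => f (x + s z))
              (hf.1.comp_measurePreserving (measurePreserving_add_right μ (s z)))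
            exact this
    refine (lintegral_mono this).trans_lt ?_
    rw [lintegral_const]
    exact ENNReal.mul_lt_top (ENNReal.mul_lt_top ENNReal.ofReal_lt_top
      (ENNReal.mul_lt_top hf.2 hθ.2)) (measure_lt_top _ _)
  have e : ∀ z, ∫ x, c z * f (x + s z) * θ x ∂μ = ∫ x, c z * (f x * θ (x - s z)) ∂μ := by
    intro z
    rw [← integral_add_right_eq_self (fun x => c z * (f x * θ (x - s z))) (s z)]
    congr 1; ext x; rw [add_sub_cancel_right]; ring
  refine ⟨?_, ?_⟩
  · have := hint.integral_prod_right
    simp only [e] at this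
    exact this
  · have := integral_integral_swap (f := fun x z => c z * f (x + s z) * θ x) hint
    simp only [e] at this
    rw [← this]
    congr 1; ext x
    rw [shiftAvg, ← integral_mul_const]
    rfl

end Averages

/-! ### Weak gradients of scalar functions -/

section PartialDeriv

variable {v w θ χ : Plane → ℝ}

lemma contDiff_partialDeriv (hθ : ContDiff ℝ ∞ θ) (j : Fin 2) :
    ContDiff ℝ ∞ (partialDeriv θ j) := by
  unfold partialDeriv
  exact (hθ.fderiv_right (m := ∞) (by simp)).clm_apply contDiff_const

lemma hasCompactSupport_partialDeriv (hθ : HasCompactSupport θ) (j : Fin 2) :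
    HasCompactSupport (partialDeriv θ j) :=
  hθ.fderiv_apply ℝ _

lemma partialDeriv_mul {x : Plane} (hθ : DifferentiableAt ℝ θ x) (hχ : DifferentiableAt ℝ χ x)
    (j : Fin 2) :
    partialDeriv (fun y => θ y * χ y) j x =
      θ x * partialDeriv χ j x + χ x * partialDeriv θ j x := by
  unfold partialDeriv
  rw [fderiv_fun_mul hθ hχ]
  simp

lemma partialDeriv_comp_add (θ : Plane → ℝ) (j : Fin 2) (a x : Plane) :
    partialDeriv (fun y => θ (y + a)) j x = partialDeriv θ j (x + a) := by
  unfold partialDeriv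
  rw [fderiv_comp_add_right]

lemma partialDeriv_comm (hθ : ContDiff ℝ ∞ θ) (i j : Fin 2) (x : Plane) :
    partialDeriv (partialDeriv θ i) j x = partialDeriv (partialDeriv θ j) i x := by
  have hd : DifferentiableAt ℝ (fderiv ℝ θ) x :=
    ((hθ.fderiv_right (m := ∞) (by simp)).differentiable (by simp)) x
  have key : ∀ k l : Fin 2, partialDeriv (partialDeriv θ k) l x =
      fderiv ℝ (fderiv ℝ θ) x (EuclideanSpace.single l 1) (EuclideanSpace.single k 1) := by
    intro k l
    unfold partialDeriv
    rw [fderiv_clm_apply hd (differentiableAt_const _)]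
    simp
  rw [key, key]
  exact (hθ.contDiffAt.isSymmSndFDerivAt
    (by simpa using WithTop.coe_le_coe.2 (le_top : (2 : ℕ∞) ≤ ⊤))) _ _

lemma fderiv_apply_eq_sum (θ : Plane → ℝ) (x y : Plane) :
    fderiv ℝ θ x y = ∑ j, y j * partialDeriv θ j x := by
  have : y = ∑ j, y j • EuclideanSpace.single j (1 : ℝ) := by
    ext k
    fin_cases k <;> simp
  conv_lhs => rw [this]
  simp [partialDeriv]

lemma memLp_of_test (hθ : ContDiff ℝ ∞ θ) (hc : HasCompactSupport θ) (p : ℝ≥0∞) :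
    MemLp θ p volume :=
  hθ.continuous.memLp_of_hasCompactSupport hc

lemma integrable_mul_test {f : Plane → ℝ} (hf : LocallyIntegrable f) (hθ : Continuous θ)
    (hc : HasCompactSupport θ) : Integrable (fun x => f x * θ x) := by
  simpa [mul_comm] using hf.integrable_smul_left_of_hasCompactSupport hθ hc

lemma locallyIntegrable_of_memLp {f : Plane → ℝ} (hf : MemLp f 2 volume) :
    LocallyIntegrable f :=
  hf.locallyIntegrable (by norm_num)

lemma integrable_mul_L2 {α : Type*} [MeasurableSpace α] {m : Measure α} {f g : α → ℝ}
    (hf : MemLp f 2 m) (hg : MemLp g 2 m) : Integrable (fun x => f x * g x) m :=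
  hf.integrable_mul hg

end PartialDeriv

/-- `G j` is the weak partial derivative `∂ⱼ v` of the scalar function `v`. -/
structure IsWeakGrad (v : Plane → ℝ) (G : Fin 2 → Plane → ℝ) : Prop where
  locInt : LocallyIntegrable v
  grad_locInt : ∀ j, LocallyIntegrable (G j)
  integral_eq : ∀ θ : Plane → ℝ, ContDiff ℝ ∞ θ → HasCompactSupport θ → ∀ j,
    ∫ x, v x * partialDeriv θ j x = - ∫ x, G j x * θ x

lemma locallyIntegrable_mul_continuous {f χ : Plane → ℝ} (hf : LocallyIntegrable f)
    (hχ : Continuous χ) : LocallyIntegrable (fun x => χ x * f x) := by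
  rw [← locallyIntegrableOn_univ] at hf ⊢
  exact hf.continuousOn_mul hχ.continuousOn isOpen_univ.isLocallyClosed

namespace IsWeakGrad

variable {v w : Plane → ℝ} {G K : Fin 2 → Plane → ℝ}

lemma of_contDiff (hv : ContDiff ℝ ∞ v) : IsWeakGrad v (partialDeriv v) where
  locInt := hv.continuous.locallyIntegrable
  grad_locInt j := (contDiff_partialDeriv hv j).continuous.locallyIntegrable
  integral_eq θ hθ hc j := by
    have hd := contDiff_partialDeriv hv j
    refine integral_mul_fderiv_eq_neg_fderiv_mul_of_integrable
      (integrable_mul_test hd.continuous.locallyIntegrable hθ.continuous hc)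
      (integrable_mul_test hv.continuous.locallyIntegrable
        (contDiff_partialDeriv hθ j).continuous (hasCompactSupport_partialDeriv hc j))
      (integrable_mul_test hv.continuous.locallyIntegrable hθ.continuous hc)
      (fun x _ => hv.differentiable (by simp) x) (fun x _ => hθ.differentiable (by simp) x)

lemma congr (h : IsWeakGrad v G) (hv : v =ᵐ[volume] w) (hG : ∀ j, G j =ᵐ[volume] K j) :
    IsWeakGrad w K where
  locInt := h.locInt.congr hv
  grad_locInt j := (h.grad_locInt j).congr (hG j)
  integral_eq θ hθ hc j := by
    have e1 : ∫ x, w x * partialDeriv θ j x = ∫ x, v x * partialDeriv θ j x :=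
      integral_congr_ae (by filter_upwards [hv] with x hx; rw [hx])
    have e2 : ∫ x, K j x * θ x = ∫ x, G j x * θ x :=
      integral_congr_ae (by filter_upwards [hG j] with x hx; rw [hx])
    rw [e1, e2, h.integral_eq θ hθ hc j]

lemma add (h : IsWeakGrad v G) (k : IsWeakGrad w K) :
    IsWeakGrad (fun x => v x + w x) (fun j x => G j x + K j x) where
  locInt := h.locInt.add k.locInt
  grad_locInt j := (h.grad_locInt j).add (k.grad_locInt j)
  integral_eq θ hθ hc j := by
    have c1 := (contDiff_partialDeriv hθ j).continuous
    have c2 := hasCompactSupport_partialDeriv hc j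
    simp only [add_mul]
    rw [integral_add (integrable_mul_test h.locInt c1 c2) (integrable_mul_test k.locInt c1 c2),
      integral_add (integrable_mul_test (h.grad_locInt j) hθ.continuous hc)
        (integrable_mul_test (k.grad_locInt j) hθ.continuous hc),
      h.integral_eq θ hθ hc j, k.integral_eq θ hθ hc j]
    ring

lemma const_mul (h : IsWeakGrad v G) (a : ℝ) :
    IsWeakGrad (fun x => a * v x) (fun j x => a * G j x) where
  locInt := h.locInt.smul a
  grad_locInt j := (h.grad_locInt j).smul a
  integral_eq θ hθ hc j := by
    simp only [mul_assoc]
    rw [integral_const_mul, integral_const_mul, h.integral_eq θ hθ hc j]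
    ring

lemma sub (h : IsWeakGrad v G) (k : IsWeakGrad w K) :
    IsWeakGrad (fun x => v x - w x) (fun j x => G j x - K j x) := by
  have := h.add (k.const_mul (-1))
  refine this.congr (Eventually.of_forall fun x => ?_)
    (fun j => Eventually.of_forall fun x => ?_) <;> ring

/-- The product rule with a smooth factor. -/
lemma mul_smooth (h : IsWeakGrad v G) {χ : Plane → ℝ} (hχ : ContDiff ℝ ∞ χ) :
    IsWeakGrad (fun x => χ x * v x) (fun j x => χ x * G j x + partialDeriv χ j x * v x) where
  locInt := locallyIntegrable_mul_continuous h.locInt hχ.continuous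
  grad_locInt j := (locallyIntegrable_mul_continuous (h.grad_locInt j) hχ.continuous).add
    (locallyIntegrable_mul_continuous h.locInt (contDiff_partialDeriv hχ j).continuous)
  integral_eq θ hθ hc j := by
    have hm : ContDiff ℝ ∞ (fun x => χ x * θ x) := hχ.mul hθ
    have hmc : HasCompactSupport (fun x => χ x * θ x) := hc.mul_left
    have key := h.integral_eq _ hm hmc j
    have e : ∀ x, v x * partialDeriv (fun x => χ x * θ x) j x =
        χ x * v x * partialDeriv θ j x + partialDeriv χ j x * v x * θ x := by
      intro x
      rw [partialDeriv_mul (hχ.differentiable (by simp) x) (hθ.differentiable (by simp) x)]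
      ring
    simp only [e] at key
    have i1 : Integrable (fun x => χ x * v x * partialDeriv θ j x) :=
      integrable_mul_test (locallyIntegrable_mul_continuous h.locInt hχ.continuous)
        (contDiff_partialDeriv hθ j).continuous (hasCompactSupport_partialDeriv hc j)
    have i2 : Integrable (fun x => partialDeriv χ j x * v x * θ x) :=
      integrable_mul_test (locallyIntegrable_mul_continuous h.locInt
        (contDiff_partialDeriv hχ j).continuous) hθ.continuous hc
    have i3 : Integrable (fun x => χ x * G j x * θ x) :=
      integrable_mul_test (locallyIntegrable_mul_continuous (h.grad_locInt j) hχ.continuous)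
        hθ.continuous hc
    rw [integral_add i1 i2] at key
    simp only [add_mul]
    rw [integral_add i3 i2, neg_add]
    have : ∫ x, G j x * (χ x * θ x) = ∫ x, χ x * G j x * θ x := by
      congr 1; ext x; ring
    rw [this] at key
    linarith

lemma unique (h : IsWeakGrad v G) (k : IsWeakGrad v K) (j : Fin 2) : G j =ᵐ[volume] K j := by
  refine ae_eq_of_integral_contDiff_smul_eq (h.grad_locInt j) (k.grad_locInt j) ?_
  intro θ hθ hc
  have h1 := h.integral_eq θ hθ hc j
  have h2 := k.integral_eq θ hθ hc j
  simp only [smul_eq_mul, mul_comm (θ _)]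
  linarith

end IsWeakGrad

lemma hasWeakGradient_iff {v : Plane → Plane} {G : Fin 2 → Fin 2 → Plane → ℝ}
    (hv : LocallyIntegrable v) :
    HasWeakGradient v G ↔ ∀ i, IsWeakGrad (fun x => v x i) (G i) := by
  constructor
  · rintro ⟨h1, h2, h3⟩ i
    refine ⟨?_, h2 i, fun θ hθ hc j => h3 θ hθ hc i j⟩
    intro x
    obtain ⟨U, hU, hi⟩ := h1 x
    exact ⟨U, hU, (EuclideanSpace.proj (𝕜 := ℝ) i).integrable_comp hi⟩
  · intro h
    exact ⟨hv, fun i j => (h i).grad_locInt j, fun θ hθ hc i j => (h i).integral_eq θ hθ hc j⟩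

/-- The scalar function `v` lies in `H¹`, with weak gradient `G`. -/
structure IsH1 (v : Plane → ℝ) (G : Fin 2 → Plane → ℝ) : Prop where
  memLp : MemLp v 2 volume
  grad_memLp : ∀ j, MemLp (G j) 2 volume
  weak : IsWeakGrad v G

lemma tendsto_integral_mul_of_tendsto_L2 {α : Type*} {l : Filter α} {f : α → Plane → ℝ}
    {f₀ θ : Plane → ℝ} (hf : ∀ n, MemLp (f n) 2 volume) (hf₀ : MemLp f₀ 2 volume)
    (hθ : MemLp θ 2 volume)
    (h : Tendsto (fun n => eLpNorm (fun x => f n x - f₀ x) 2 volume) l (𝓝 0)) :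
    Tendsto (fun n => ∫ x, f n x * θ x) l (𝓝 (∫ x, f₀ x * θ x)) := by
  have hi : ∀ g : Plane → ℝ, MemLp g 2 volume → Integrable (fun x => g x * θ x) :=
    fun g hg => hg.integrable_mul hθ
  refine tendsto_integral_of_L1 _ (hi _ hf₀).1 (Eventually.of_forall fun n => hi _ (hf n)) ?_
  have h2 : Tendsto (fun n => eLpNorm (fun x => f n x - f₀ x) 2 volume * eLpNorm θ 2 volume) l
      (𝓝 0) := by
    have := ENNReal.Tendsto.mul_const h (Or.inr hθ.2.ne)
    simpa using this
  refine tendsto_of_tendsto_of_tendsto_of_le_of_le tendsto_const_nhds h2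
    (fun _ => zero_le) fun n => ?_
  simp only
  rw [← eLpNorm_one_eq_lintegral_enorm]
  have := eLpNorm_smul_le_mul_eLpNorm (p := 2) (q := 2) (r := 1) (μ := volume) hθ.1
    (f := θ) (φ := fun x => f n x - f₀ x) ((hf n).1.sub hf₀.1)
  refine le_trans (le_of_eq ?_) this
  congr 1; ext x; simp [sub_mul]

/-! ### Mollification -/

/-- A smooth kernel of integral one, supported in the closed unit ball. -/
noncomputable def kernel : Plane → ℝ :=
  (⟨1 / 2, 1, by norm_num, by norm_num⟩ : ContDiffBump (0 : Plane)).normed volume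

lemma contDiff_kernel : ContDiff ℝ ∞ kernel := ContDiffBump.contDiff_normed _

lemma hasCompactSupport_kernel : HasCompactSupport kernel :=
  ContDiffBump.hasCompactSupport_normed _

lemma kernel_eq_zero {y : Plane} (hy : y ∉ Metric.closedBall (0 : Plane) 1) : kernel y = 0 := by
  have := ContDiffBump.tsupport_normed_eq
    (⟨1 / 2, 1, by norm_num, by norm_num⟩ : ContDiffBump (0 : Plane)) (μ := volume)
  by_contra h
  exact hy (this ▸ subset_tsupport _ h)

/-- Lebesgue measure on the closed unit disc. -/
noncomputable abbrev disc : Measure Plane := volume.restrict (Metric.closedBall 0 1)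

instance : IsFiniteMeasure disc := ⟨by
  simp⟩

lemma integral_kernel : ∫ y, kernel y ∂disc = 1 := by
  rw [setIntegral_eq_integral_of_forall_compl_eq_zero fun y hy => kernel_eq_zero hy]
  exact ContDiffBump.integral_normed _

lemma exists_bound_of_hasCompactSupport {θ : Plane → ℝ} (h : Continuous θ)
    (hc : HasCompactSupport θ) : ∃ C, 0 ≤ C ∧ ∀ y, |θ y| ≤ C := by
  obtain ⟨C, hC⟩ := hc.exists_bound_of_continuous h
  exact ⟨C, (norm_nonneg _).trans (hC 0), hC⟩

/-- The mollification of `v` at scale `ε`. -/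
noncomputable def moll (ε : ℝ) (v : Plane → ℝ) : Plane → ℝ :=
  shiftAvg disc (fun y => -(ε • y)) kernel v

/-- The average `∫₀¹ ∫ ρ(y) yⱼ v(x - t ε y) dy dt`, which occurs when `v - ρ_ε * v` is written
as an integral of derivatives of `v` along segments. -/
noncomputable def lineMoll (ε : ℝ) (j : Fin 2) (v : Plane → ℝ) : Plane → ℝ :=
  shiftAvg (disc.prod (volume.restrict (Icc (0 : ℝ) 1))) (fun p => -((p.2 * ε) • p.1))
    (fun p => kernel p.1 * p.1 j) v

lemma exists_kernel_bound : ∃ C, 0 ≤ C ∧ ∀ y, |kernel y| ≤ C :=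
  exists_bound_of_hasCompactSupport contDiff_kernel.continuous hasCompactSupport_kernel

lemma exists_kernel_coord_bound (j : Fin 2) : ∃ C, 0 ≤ C ∧ ∀ y : Plane, |kernel y * y j| ≤ C :=
  exists_bound_of_hasCompactSupport (contDiff_kernel.continuous.mul (by fun_prop))
    hasCompactSupport_kernel.mul_right

lemma measurable_kernel : Measurable kernel := contDiff_kernel.continuous.measurable

lemma measurable_kernel_coord (j : Fin 2) :
    Measurable (fun p : Plane × ℝ => kernel p.1 * p.1 j) := by
  have : Measurable (fun y : Plane => y j) := by fun_prop
  exact (measurable_kernel.comp measurable_fst).mul (this.comp measurable_fst)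

lemma measurable_moll_shift (ε : ℝ) : Measurable (fun y : Plane => -(ε • y)) := by fun_prop

lemma measurable_lineMoll_shift (ε : ℝ) :
    Measurable (fun p : Plane × ℝ => -((p.2 * ε) • p.1)) := by fun_prop

lemma memLp_moll {v : Plane → ℝ} (hv : MemLp v 2 volume) (ε : ℝ) : MemLp (moll ε v) 2 volume := by
  obtain ⟨C, -, hC⟩ := exists_kernel_bound
  exact memLp_shiftAvg (measurable_moll_shift ε) measurable_kernel hC hv

lemma memLp_lineMoll {v : Plane → ℝ} (hv : MemLp v 2 volume) (ε : ℝ) (j : Fin 2) :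
    MemLp (lineMoll ε j v) 2 volume := by
  obtain ⟨C, -, hC⟩ := exists_kernel_coord_bound j
  exact memLp_shiftAvg (measurable_lineMoll_shift ε) (measurable_kernel_coord j)
    (fun p => hC p.1) hv

lemma exists_eLpNorm_lineMoll_le : ∃ C : ℝ, 0 ≤ C ∧ ∀ (ε : ℝ) (j : Fin 2) (v : Plane → ℝ),
    MemLp v 2 volume →
      eLpNorm (lineMoll ε j v) 2 volume ≤ ENNReal.ofReal C * eLpNorm v 2 volume := by
  choose C h0 hC using exists_kernel_coord_bound
  set κ : Measure (Plane × ℝ) := disc.prod (volume.restrict (Icc (0 : ℝ) 1))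
  refine ⟨κ.real univ * (C 0 + C 1), mul_nonneg measureReal_nonneg (add_nonneg (h0 0) (h0 1)),
    fun ε j v hv => ?_⟩
  have hj : ∀ y : Plane, |kernel y * y j| ≤ C 0 + C 1 := by
    intro y
    have := h0 0
    have := h0 1
    fin_cases j
    · exact (hC 0 y).trans (by linarith)
    · exact (hC 1 y).trans (by linarith)
  have := eLpNorm_shiftAvg_le (κ := κ) (measurable_lineMoll_shift ε) (measurable_kernel_coord j)
    (fun p => hj p.1) hv.1
  refine this.trans (le_of_eq ?_)
  rw [ENNReal.ofReal_mul measureReal_nonneg, ofReal_measureReal, mul_assoc]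

/-- Mollifications of an `L²` function converge to it. -/
lemma tendsto_moll {v : Plane → ℝ} (hv : MemLp v 2 volume) :
    Tendsto (fun ε => eLpNorm (fun x => moll ε v x - v x) 2 volume) (𝓝 0) (𝓝 0) := by
  obtain ⟨C, -, hC⟩ := exists_kernel_bound
  rw [ENNReal.tendsto_nhds_zero]
  intro a ha
  set K : ℝ≥0∞ := disc univ * ENNReal.ofReal C with hK
  have hKt : K ≠ ⊤ := ENNReal.mul_ne_top (measure_ne_top _ _) ENNReal.ofReal_ne_top
  obtain ⟨B, hB0, hB⟩ : ∃ B : ℝ≥0∞, 0 < B ∧ K * B ≤ a := by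
    by_cases h : K = 0
    · exact ⟨1, one_pos, by simp [h]⟩
    · by_cases hat : a = ⊤
      · exact ⟨1, one_pos, by simp [hat]⟩
      · exact ⟨a / K, ENNReal.div_pos ha.ne' hKt, ENNReal.mul_div_le⟩
  have h1 := (ENNReal.tendsto_nhds_zero.1 (tendsto_eLpNorm_shift_sub hv)) B hB0
  obtain ⟨r, hr, hrB⟩ := Metric.eventually_nhds_iff.1 h1
  filter_upwards [Metric.ball_mem_nhds (0 : ℝ) hr] with ε hε
  refine (eLpNorm_shiftAvg_sub_le (κ := disc) (measurable_moll_shift ε) measurable_kernel hC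
    integral_kernel hv (B := B) ?_).trans (by rw [← mul_assoc]; exact hB)
  filter_upwards [ae_restrict_mem Metric.isClosed_closedBall.measurableSet] with y hy
  apply hrB
  simp only [dist_zero_right, norm_neg, norm_smul]
  have h2 : ‖y‖ ≤ 1 := by simpa using hy
  have h3 : ‖ε‖ < r := by simpa using hε
  nlinarith [norm_nonneg ε, norm_nonneg y]

lemma integral_moll_mul {v θ : Plane → ℝ} (hv : MemLp v 2 volume) (hθ : MemLp θ 2 volume) (ε : ℝ) :
    Integrable (fun y => kernel y * ∫ x, v x * θ (x + ε • y)) disc ∧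
    ∫ x, moll ε v x * θ x = ∫ y, kernel y * (∫ x, v x * θ (x + ε • y)) ∂disc := by
  obtain ⟨C, -, hC⟩ := exists_kernel_bound
  have := integral_shiftAvg_mul (κ := disc) (measurable_moll_shift ε) measurable_kernel hC hv hθ
  simpa only [sub_neg_eq_add, integral_const_mul, moll, lineMoll] using this

lemma integral_lineMoll_mul {v θ : Plane → ℝ} (hv : MemLp v 2 volume) (hθ : MemLp θ 2 volume)
    (ε : ℝ) (j : Fin 2) :
    Integrable (fun p : Plane × ℝ => kernel p.1 * p.1 j * ∫ x, v x * θ (x + (p.2 * ε) • p.1))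
      (disc.prod (volume.restrict (Icc (0 : ℝ) 1))) ∧
    ∫ x, lineMoll ε j v x * θ x =
      ∫ p : Plane × ℝ, kernel p.1 * p.1 j * (∫ x, v x * θ (x + (p.2 * ε) • p.1))
        ∂(disc.prod (volume.restrict (Icc (0 : ℝ) 1))) := by
  obtain ⟨C, -, hC⟩ := exists_kernel_coord_bound j
  have := integral_shiftAvg_mul (κ := disc.prod (volume.restrict (Icc (0 : ℝ) 1)))
    (measurable_lineMoll_shift ε) (measurable_kernel_coord j) (fun p => hC p.1) hv hθ
  simpa only [sub_neg_eq_add, integral_const_mul, moll, lineMoll] using this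

lemma IsWeakGrad.integral_shift {v : Plane → ℝ} {G : Fin 2 → Plane → ℝ} (h : IsWeakGrad v G)
    {θ : Plane → ℝ} (hθ : ContDiff ℝ ∞ θ) (hc : HasCompactSupport θ) (j : Fin 2) (a : Plane) :
    ∫ x, v x * partialDeriv θ j (x + a) = - ∫ x, G j x * θ (x + a) := by
  have := h.integral_eq (fun x => θ (x + a)) (hθ.comp (contDiff_id.add contDiff_const))
    (hc.comp_homeomorph (Homeomorph.addRight a)) j
  simpa only [partialDeriv_comp_add] using this

lemma IsH1.mollify {v : Plane → ℝ} {G : Fin 2 → Plane → ℝ} (h : IsH1 v G) (ε : ℝ) :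
    IsH1 (moll ε v) (fun j => moll ε (G j)) := by
  refine ⟨memLp_moll h.memLp ε, fun j => memLp_moll (h.grad_memLp j) ε,
    locallyIntegrable_of_memLp (memLp_moll h.memLp ε),
    fun j => locallyIntegrable_of_memLp (memLp_moll (h.grad_memLp j) ε), fun θ hθ hc j => ?_⟩
  rw [(integral_moll_mul h.memLp (memLp_of_test (contDiff_partialDeriv hθ j)
      (hasCompactSupport_partialDeriv hc j) 2) ε).2,
    (integral_moll_mul (h.grad_memLp j) (memLp_of_test hθ hc 2) ε).2, ← integral_neg]
  congr 1; ext y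
  rw [h.weak.integral_shift hθ hc]
  ring

/-- The fundamental theorem of calculus along a segment, paired with an `L²` function. -/
lemma integral_mul_shift_sub {v θ : Plane → ℝ} (hv : MemLp v 2 volume) (hθ : ContDiff ℝ ∞ θ)
    (hc : HasCompactSupport θ) (z : Plane) :
    ∫ x, v x * (θ (x + z) - θ x) =
      ∫ t in Icc (0 : ℝ) 1, ∑ j, z j * ∫ x, v x * partialDeriv θ j (x + t • z) := by
  have hd : ∀ j, MemLp (partialDeriv θ j) 2 volume := fun j =>
    memLp_of_test (contDiff_partialDeriv hθ j) (hasCompactSupport_partialDeriv hc j) 2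
  have hs : Measurable (fun t : ℝ => t • z) := by fun_prop
  have hc1 : ∀ j, Measurable (fun _ : ℝ => z j) := fun j => measurable_const
  have key : ∀ j, Integrable (fun t => z j * ∫ x, v x * partialDeriv θ j (x + t • z))
        (volume.restrict (Icc (0 : ℝ) 1)) ∧
      ∫ x, shiftAvg (volume.restrict (Icc (0 : ℝ) 1)) (fun t : ℝ => t • z) (fun _ => z j)
        (partialDeriv θ j) x * v x =
      ∫ t in Icc (0 : ℝ) 1, z j * ∫ x, v x * partialDeriv θ j (x + t • z) := by
    intro j
    have := integral_shiftAvg_mul (κ := volume.restrict (Icc (0 : ℝ) 1)) hs (hc1 j)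
      (C := |z j|) (fun _ => le_rfl) (hd j) hv
    have e : ∀ t : ℝ, ∫ x, z j * (partialDeriv θ j x * v (x - t • z)) =
        z j * ∫ x, v x * partialDeriv θ j (x + t • z) := by
      intro t
      rw [integral_const_mul,
        ← integral_add_right_eq_self (fun x => partialDeriv θ j x * v (x - t • z)) (t • z)]
      congr 2; ext x; rw [add_sub_cancel_right, mul_comm]
    simpa only [e] using this
  rw [integral_finsetSum _ fun j _ => (key j).1, ← Finset.sum_congr rfl fun j _ => (key j).2,
    ← integral_finsetSum]
  · congr 1; ext x
    rw [← Finset.sum_mul, mul_comm]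
    congr 1
    have hderiv : ∀ t : ℝ, HasDerivAt (fun t : ℝ => θ (x + t • z))
        (∑ j, z j * partialDeriv θ j (x + t • z)) t := by
      intro t
      have h1 : HasDerivAt (fun t : ℝ => x + t • z) z t := by
        simpa using ((hasDerivAt_id t).smul_const z).const_add x
      have h2 := ((hθ.differentiable (by simp)) (x + t • z)).hasFDerivAt
      have := h2.comp_hasDerivAt t h1
      rwa [fderiv_apply_eq_sum] at this
    have hcont : ∀ j, Continuous (fun t : ℝ => z j * partialDeriv θ j (x + t • z)) := fun j =>
      continuous_const.mul ((contDiff_partialDeriv hθ j).continuous.comp (by fun_prop))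
    have ftc := intervalIntegral.integral_eq_sub_of_hasDerivAt (a := 0) (b := 1)
      (fun t _ => hderiv t)
      ((continuous_finsetSum _ fun j _ => hcont j).intervalIntegrable _ _)
    rw [intervalIntegral.integral_of_le zero_le_one, ← integral_Icc_eq_integral_Ioc,
      integral_finsetSum _ fun j _ => (hcont j).integrableOn_Icc] at ftc
    simp only [one_smul, zero_smul, add_zero] at ftc
    rw [← ftc]
    rfl
  · intro j _
    exact (memLp_shiftAvg hs (hc1 j) (C := |z j|) (fun _ => le_rfl) (hd j)).integrable_mul hv

/-- In weak form, `ρ_ε * v - v = - ε ∑ⱼ ∂ⱼ (lineMoll ε j v)`. -/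
lemma integral_moll_sub_mul {v θ : Plane → ℝ} (hv : MemLp v 2 volume) (hθ : ContDiff ℝ ∞ θ)
    (hc : HasCompactSupport θ) (ε : ℝ) :
    ∫ x, (moll ε v x - v x) * θ x = ε * ∑ j, ∫ x, lineMoll ε j v x * partialDeriv θ j x := by
  have hd : ∀ j, MemLp (partialDeriv θ j) 2 volume := fun j =>
    memLp_of_test (contDiff_partialDeriv hθ j) (hasCompactSupport_partialDeriv hc j) 2
  have hθ2 := memLp_of_test hθ hc 2
  obtain ⟨m1, m2⟩ := integral_moll_mul hv hθ2 ε
  have hk : Integrable kernel disc :=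
    (contDiff_kernel.continuous.integrable_of_hasCompactSupport hasCompactSupport_kernel).restrict
  have hsh : ∀ a : Plane, Integrable (fun x => v x * θ (x + a)) := fun a =>
    hv.integrable_mul (hθ2.comp_measurePreserving (measurePreserving_add_right volume a))
  have e1 : ∫ x, (moll ε v x - v x) * θ x =
      ∫ y, kernel y * (∫ x, v x * (θ (x + ε • y) - θ x)) ∂disc := by
    simp only [sub_mul, mul_sub]
    rw [integral_sub (integrable_mul_L2 (memLp_moll hv ε) hθ2) (integrable_mul_L2 hv hθ2), m2]
    have : ∀ y : Plane, kernel y * ∫ x, (v x * θ (x + ε • y) - v x * θ x) =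
        (kernel y * ∫ x, v x * θ (x + ε • y)) - kernel y * ∫ x, v x * θ x := by
      intro y
      rw [integral_sub (hsh _) (integrable_mul_L2 hv hθ2), mul_sub]
    simp only [this]
    rw [integral_sub m1 (hk.mul_const _), integral_mul_const, integral_kernel, one_mul]
  rw [e1]
  have e2 : ∀ j, ∫ x, lineMoll ε j v x * partialDeriv θ j x =
      ∫ y, (∫ t in Icc (0 : ℝ) 1,
        kernel y * y j * ∫ x, v x * partialDeriv θ j (x + (t * ε) • y)) ∂disc := by
    intro j
    obtain ⟨l1, l2⟩ := integral_lineMoll_mul hv (hd j) ε j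
    rw [l2, integral_prod _ l1]
  have e3 : ∀ j, Integrable (fun y => ∫ t in Icc (0 : ℝ) 1,
        kernel y * y j * ∫ x, v x * partialDeriv θ j (x + (t * ε) • y)) disc := fun j =>
    (integral_lineMoll_mul hv (hd j) ε j).1.integral_prod_left
  have e4 : ∀ j, ∀ᵐ y ∂disc, Integrable (fun t =>
        kernel y * y j * ∫ x, v x * partialDeriv θ j (x + (t * ε) • y))
        (volume.restrict (Icc (0 : ℝ) 1)) := fun j =>
    (integral_lineMoll_mul hv (hd j) ε j).1.prod_right_ae
  simp only [e2]
  rw [← integral_finsetSum _ fun j _ => e3 j, ← integral_const_mul]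
  apply integral_congr_ae
  filter_upwards [e4 0, e4 1] with y h0 h1
  rw [integral_mul_shift_sub hv hθ hc, ← integral_const_mul, ← integral_finsetSum,
    ← integral_const_mul]
  · congr 1; ext t
    simp only [Fin.sum_univ_two, PiLp.smul_apply, smul_eq_mul, smul_smul]
    ring
  · intro j _
    fin_cases j
    · exact h0
    · exact h1

/-- For an `H¹` function the error of mollification is `O(ε)` in `L²`. -/
lemma exists_eLpNorm_moll_sub_le : ∃ C : ℝ, 0 ≤ C ∧ ∀ (ε : ℝ) (v : Plane → ℝ)
    (G : Fin 2 → Plane → ℝ), 0 ≤ ε → IsH1 v G →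
    eLpNorm (fun x => moll ε v x - v x) 2 volume ≤
      ENNReal.ofReal (C * ε) * (eLpNorm (G 0) 2 volume + eLpNorm (G 1) 2 volume) := by
  obtain ⟨C, hC0, hC⟩ := exists_eLpNorm_lineMoll_le
  refine ⟨C, hC0, fun ε v G hε h => ?_⟩
  have hL : ∀ j, MemLp (lineMoll ε j (G j)) 2 volume := fun j =>
    memLp_lineMoll (h.grad_memLp j) ε j
  have e : (fun x => moll ε v x - v x) =ᵐ[volume]
      (-ε) • (lineMoll ε 0 (G 0) + lineMoll ε 1 (G 1)) := by
    refine ae_eq_of_integral_contDiff_smul_eq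
      (locallyIntegrable_of_memLp ((memLp_moll h.memLp ε).sub h.memLp))
      (locallyIntegrable_of_memLp (((hL 0).add (hL 1)).const_smul _)) fun θ hθ hc => ?_
    simp only [smul_eq_mul, mul_comm (θ _)]
    rw [integral_moll_sub_mul h.memLp hθ hc]
    have e2 : ∀ j, ∫ x, lineMoll ε j v x * partialDeriv θ j x =
        - ∫ x, lineMoll ε j (G j) x * θ x := by
      intro j
      rw [(integral_lineMoll_mul h.memLp (memLp_of_test (contDiff_partialDeriv hθ j)
        (hasCompactSupport_partialDeriv hc j) 2) ε j).2,
        (integral_lineMoll_mul (h.grad_memLp j) (memLp_of_test hθ hc 2) ε j).2, ← integral_neg]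
      congr 1; ext p
      rw [h.weak.integral_shift hθ hc]
      ring
    simp only [e2, Pi.smul_apply, Pi.add_apply, smul_eq_mul, mul_assoc, add_mul, Fin.sum_univ_two]
    rw [integral_const_mul, integral_add (integrable_mul_L2 (hL 0) (memLp_of_test hθ hc 2))
      (integrable_mul_L2 (hL 1) (memLp_of_test hθ hc 2))]
    ring
  rw [eLpNorm_congr_ae e, eLpNorm_const_smul, mul_comm C, ENNReal.ofReal_mul hε, mul_assoc]
  have : ‖-ε‖ₑ = ENNReal.ofReal ε := by rw [← ofReal_norm, norm_neg, Real.norm_of_nonneg hε]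
  rw [this, mul_add]
  gcongr
  exact (eLpNorm_add_le (hL 0).1 (hL 1).1 (by norm_num)).trans
    (add_le_add (hC _ _ _ (h.grad_memLp 0)) (hC _ _ _ (h.grad_memLp 1)))

/-- A divergence-free `L²` field differs from its mollification by the rotated gradient of an
`L²` function.  The stream function is explicit, `ψ = ε (lineMoll ε 1 w₀ - lineMoll ε 0 w₁)`; a
stream function of the field itself need not be in `L²`. -/
lemma exists_stream {w : Fin 2 → Plane → ℝ} (hw : ∀ i, MemLp (w i) 2 volume)
    (hdiv : ∀ θ : Plane → ℝ, ContDiff ℝ ∞ θ → HasCompactSupport θ →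
      ∫ x, w 0 x * partialDeriv θ 0 x + w 1 x * partialDeriv θ 1 x = 0) (ε : ℝ) :
    ∃ ψ : Plane → ℝ, IsH1 ψ
      ![fun x => moll ε (w 1) x - w 1 x, fun x => w 0 x - moll ε (w 0) x] := by
  have hL : ∀ i j, MemLp (lineMoll ε j (w i)) 2 volume := fun i j => memLp_lineMoll (hw i) ε j
  have hM : ∀ i, MemLp (fun x => moll ε (w i) x - w i x) 2 volume := fun i =>
    (memLp_moll (hw i) ε).sub (hw i)
  have hM' : ∀ i, MemLp (fun x => w i x - moll ε (w i) x) 2 volume := fun i =>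
    (hw i).sub (memLp_moll (hw i) ε)
  have hψ : MemLp (fun x => ε * (lineMoll ε 1 (w 0) x - lineMoll ε 0 (w 1) x)) 2 volume :=
    ((hL 0 1).sub (hL 1 0)).const_mul ε
  refine ⟨_, hψ, ?_, locallyIntegrable_of_memLp hψ, ?_, fun θ hθ hc => ?_⟩
  · intro j; fin_cases j
    · exact hM 1
    · exact hM' 0
  · intro j; fin_cases j
    · exact locallyIntegrable_of_memLp (hM 1)
    · exact locallyIntegrable_of_memLp (hM' 0)
  have hd : ∀ j, MemLp (partialDeriv θ j) 2 volume := fun j =>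
    memLp_of_test (contDiff_partialDeriv hθ j) (hasCompactSupport_partialDeriv hc j) 2
  have hdiv' : ∀ a : Plane, (∫ x, w 0 x * partialDeriv θ 0 (x + a)) =
      - ∫ x, w 1 x * partialDeriv θ 1 (x + a) := by
    intro a
    have := hdiv (fun x => θ (x + a)) (hθ.comp (contDiff_id.add contDiff_const))
      (hc.comp_homeomorph (Homeomorph.addRight a))
    simp only [partialDeriv_comp_add] at this
    have hsh : ∀ i, Integrable (fun x => w i x * partialDeriv θ i (x + a)) := fun i =>
      (hw i).integrable_mul ((hd i).comp_measurePreserving (measurePreserving_add_right volume a))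
    rw [integral_add (hsh 0) (hsh 1)] at this
    linarith
  have key : ∀ j, ∫ x, lineMoll ε j (w 0) x * partialDeriv θ 0 x =
      - ∫ x, lineMoll ε j (w 1) x * partialDeriv θ 1 x := by
    intro j
    rw [(integral_lineMoll_mul (hw 0) (hd 0) ε j).2, (integral_lineMoll_mul (hw 1) (hd 1) ε j).2,
      ← integral_neg]
    congr 1; ext p
    rw [hdiv']
    ring
  have hi : ∀ i j k, Integrable (fun x => lineMoll ε j (w i) x * partialDeriv θ k x) :=
    fun i j k => (hL i j).integrable_mul (hd k)
  have base : ∀ k, ∫ x, ε * (lineMoll ε 1 (w 0) x - lineMoll ε 0 (w 1) x) * partialDeriv θ k x =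
      ε * (∫ x, lineMoll ε 1 (w 0) x * partialDeriv θ k x) -
      ε * ∫ x, lineMoll ε 0 (w 1) x * partialDeriv θ k x := by
    intro k
    simp only [mul_assoc, sub_mul]
    rw [integral_const_mul, integral_sub (hi 0 1 k) (hi 1 0 k)]
    ring
  have c0 := integral_moll_sub_mul (hw 0) hθ hc ε
  have c1 := integral_moll_sub_mul (hw 1) hθ hc ε
  simp only [Fin.sum_univ_two] at c0 c1
  intro j; fin_cases j
  · simp only [Fin.zero_eta, Matrix.cons_val_zero]
    rw [base, c1, key]
    ring
  · simp only [Fin.mk_one, Matrix.cons_val_one, Matrix.cons_val_fin_one]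
    have : ∫ x, (w 0 x - moll ε (w 0) x) * θ x = - ∫ x, (moll ε (w 0) x - w 0 x) * θ x := by
      rw [← integral_neg]; congr 1; ext x; ring
    rw [base, this, c0, key]
    ring

lemma moll_eq_convolution {ε : ℝ} (hε : 0 < ε) (v : Plane → ℝ) :
    moll ε v = convolution (fun z => (ε ^ 2)⁻¹ * kernel (ε⁻¹ • z)) v
      (ContinuousLinearMap.lsmul ℝ ℝ) volume := by
  ext x
  have h1 : moll ε v x = ∫ y, kernel y * v (x - ε • y) := by
    rw [moll, shiftAvg, setIntegral_eq_integral_of_forall_compl_eq_zero]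
    · simp [sub_eq_add_neg]
    · intro y hy; rw [kernel_eq_zero hy, zero_smul]
  have h2 := Measure.integral_comp_smul_of_nonneg volume
    (fun z : Plane => kernel (ε⁻¹ • z) * v (x - z)) ε (hR := hε.le)
  simp only [smul_smul, inv_mul_cancel₀ hε.ne', one_smul] at h2
  rw [h1, h2, convolution_def]
  simp only [ContinuousLinearMap.lsmul_apply, smul_eq_mul, mul_assoc]
  rw [integral_const_mul]
  simp

lemma contDiff_scaled_kernel (ε : ℝ) :
    ContDiff ℝ ∞ (fun z : Plane => (ε ^ 2)⁻¹ * kernel (ε⁻¹ • z)) :=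
  contDiff_const.mul (contDiff_kernel.comp (contDiff_const_smul _))

lemma hasCompactSupport_scaled_kernel {ε : ℝ} (hε : 0 < ε) :
    HasCompactSupport (fun z : Plane => (ε ^ 2)⁻¹ * kernel (ε⁻¹ • z)) :=
  (hasCompactSupport_kernel.comp_smul (inv_ne_zero hε.ne')).mul_left

lemma contDiff_moll {ε : ℝ} (hε : 0 < ε) {v : Plane → ℝ} (hv : LocallyIntegrable v) :
    ContDiff ℝ ∞ (moll ε v) := by
  rw [moll_eq_convolution hε]
  exact (hasCompactSupport_scaled_kernel hε).contDiff_convolution_left _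
    (contDiff_scaled_kernel ε) hv

/-- The mollification vanishes where the function vanishes on a ball of radius `ε`. -/
lemma moll_eq_zero {ε : ℝ} (hε : 0 ≤ ε) {v : Plane → ℝ} {x : Plane}
    (h : ∀ z, dist z x ≤ ε → v z = 0) : moll ε v x = 0 := by
  rw [moll, shiftAvg]
  rw [setIntegral_congr_fun (g := fun _ => (0 : ℝ)) Metric.isClosed_closedBall.measurableSet]
  · simp
  · intro y hy
    have hy1 : ‖y‖ ≤ 1 := by simpa using hy
    simp only [smul_eq_mul]
    rw [h, mul_zero]
    rw [dist_eq_norm]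
    simp only [add_sub_cancel_left, norm_neg, norm_smul, Real.norm_of_nonneg hε]
    nlinarith

lemma hasCompactSupport_moll {ε : ℝ} (hε : 0 ≤ ε) {v : Plane → ℝ} (hv : HasCompactSupport v) :
    HasCompactSupport (moll ε v) := by
  obtain ⟨R, hR⟩ := hv.isCompact.isBounded.subset_closedBall 0
  refine HasCompactSupport.intro (isCompact_closedBall (0 : Plane) (R + ε)) fun x hx => ?_
  refine moll_eq_zero hε fun z hz => ?_
  by_contra h
  have := hR (subset_tsupport _ h)
  simp only [Metric.mem_closedBall, dist_zero_right, not_le] at this hx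
  have h2 : ‖x‖ ≤ ‖z‖ + dist z x := by
    rw [dist_comm, dist_eq_norm]
    calc ‖x‖ = ‖z + (x - z)‖ := by congr 1; abel
      _ ≤ _ := norm_add_le _ _
  linarith

/-! ### Approximation of `H¹` functions by test functions -/

lemma memLp_bounded_mul {α : Type*} [MeasurableSpace α] {m : Measure α} {f g : α → ℝ} {C : ℝ}
    {p : ℝ≥0∞} (hg : AEStronglyMeasurable g m) (hC : ∀ x, |g x| ≤ C) (hf : MemLp f p m) :
    MemLp (fun x => g x * f x) p m := by
  refine (hf.const_mul C).mono (hg.mul hf.1) (Eventually.of_forall fun x => ?_)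
  rw [norm_mul, norm_mul]
  exact mul_le_mul_of_nonneg_right ((hC x).trans (le_abs_self C)) (norm_nonneg _)

/-- Dominated convergence for multipliers of an `L²` function. -/
lemma tendsto_eLpNorm_bounded_mul {h : ℕ → Plane → ℝ} {v : Plane → ℝ}
    (hm : ∀ n, Continuous (h n)) {C : ℝ} (hC : ∀ n x, |h n x| ≤ C)
    (h0 : ∀ x, Tendsto (fun n => h n x) atTop (𝓝 0)) (hv : MemLp v 2 volume) :
    Tendsto (fun n => eLpNorm (fun x => h n x * v x) 2 volume) atTop (𝓝 0) := by
  have key : Tendsto (fun n => ∫⁻ x, ‖h n x * v x‖ₑ ^ 2) atTop (𝓝 (∫⁻ _ : Plane, 0)) := by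
    refine tendsto_lintegral_of_dominated_convergence'
      (fun x => ENNReal.ofReal C ^ 2 * ‖v x‖ₑ ^ 2)
      (fun n => ((hm n).aestronglyMeasurable.mul hv.1).enorm.pow_const 2)
      (fun n => Eventually.of_forall fun x => ?_) ?_ (Eventually.of_forall fun x => ?_)
    · simp only
      rw [enorm_mul, mul_pow]
      gcongr
      rw [← ofReal_norm]
      exact ENNReal.ofReal_le_ofReal (hC n x)
    · rw [lintegral_const_mul' _ _ (by simp), ← eLpNorm_two_sq]
      exact ENNReal.mul_ne_top (by simp) (ENNReal.pow_ne_top hv.2.ne)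
    · have : Tendsto (fun n => h n x * v x) atTop (𝓝 (0 * v x)) := (h0 x).mul_const _
      have h2 := (ENNReal.continuous_pow 2).tendsto _ |>.comp this.enorm
      simpa [Function.comp_def] using h2
  simp only [lintegral_zero, ← eLpNorm_two_sq] at key
  have := key.ennrpow_const (1 / 2 : ℝ)
  simp only [← ENNReal.rpow_natCast, ← ENNReal.rpow_mul] at this
  norm_num at this
  exact this

/-- Test functions are dense in `H¹`. -/
lemma IsH1.exists_approx {v : Plane → ℝ} {G : Fin 2 → Plane → ℝ} (h : IsH1 v G) :
    ∃ θ : ℕ → Plane → ℝ, (∀ n, ContDiff ℝ ∞ (θ n)) ∧ (∀ n, HasCompactSupport (θ n)) ∧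
      Tendsto (fun n => eLpNorm (fun x => θ n x - v x) 2 volume) atTop (𝓝 0) ∧
      ∀ j, Tendsto (fun n => eLpNorm (fun x => partialDeriv (θ n) j x - G j x) 2 volume)
        atTop (𝓝 0) := by
  let χ : ContDiffBump (0 : Plane) := ⟨1, 2, by norm_num, by norm_num⟩
  let a : ℕ → ℝ := fun n => 1 / (n + 1)
  have ha : ∀ n, 0 < a n := fun n => by positivity
  have ha0 : Tendsto a atTop (𝓝 0) := tendsto_one_div_add_atTop_nhds_zero_nat
  let X : ℕ → Plane → ℝ := fun n x => χ (a n • x)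
  have hX : ∀ n, ContDiff ℝ ∞ (X n) := fun n => χ.contDiff.comp (contDiff_const_smul _)
  have hXc : ∀ n, HasCompactSupport (X n) := fun n => χ.hasCompactSupport.comp_smul (ha n).ne'
  have hdX : ∀ n j x, partialDeriv (X n) j x = a n * partialDeriv χ j (a n • x) := by
    intro n j x
    have : fderiv ℝ (X n) x = a n • fderiv ℝ χ (a n • x) := by
      simpa [X] using fderiv_comp_smul (f := χ) (x := x) (a n)
    rw [partialDeriv, this]
    simp [partialDeriv]
  obtain ⟨C, hC0, hC⟩ : ∃ C, 0 ≤ C ∧ ∀ j x, |partialDeriv χ j x| ≤ C := by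
    have hb := fun j => exists_bound_of_hasCompactSupport
      (contDiff_partialDeriv χ.contDiff j).continuous
      (hasCompactSupport_partialDeriv χ.hasCompactSupport j)
    choose c hc0 hc using hb
    refine ⟨c 0 + c 1, add_nonneg (hc0 0) (hc0 1), fun j x => ?_⟩
    have := hc0 0
    have := hc0 1
    fin_cases j
    · exact (hc 0 x).trans (by linarith)
    · exact (hc 1 x).trans (by linarith)
  have hXH : ∀ n, IsH1 (fun x => X n x * v x)
      (fun j x => X n x * G j x + partialDeriv (X n) j x * v x) := by
    intro n
    have hb : ∀ {f g : Plane → ℝ}, Continuous g → HasCompactSupport g → MemLp f 2 volume →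
        MemLp (fun x => g x * f x) 2 volume := by
      intro f g hg hgc hf
      obtain ⟨D, -, hD⟩ := exists_bound_of_hasCompactSupport hg hgc
      exact memLp_bounded_mul hg.aestronglyMeasurable hD hf
    exact ⟨hb (hX n).continuous (hXc n) h.memLp, fun j =>
      (hb (hX n).continuous (hXc n) (h.grad_memLp j)).add
      (hb (contDiff_partialDeriv (hX n) j).continuous (hasCompactSupport_partialDeriv (hXc n) j)
        h.memLp), h.weak.mul_smooth (hX n)⟩
  have hX1 : ∀ {f : Plane → ℝ}, MemLp f 2 volume →
      Tendsto (fun n => eLpNorm (fun x => (X n x - 1) * f x) 2 volume) atTop (𝓝 0) := by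
    intro f hf
    refine tendsto_eLpNorm_bounded_mul (fun n => (hX n).continuous.sub continuous_const)
      (C := 1) (fun n x => ?_) (fun x => ?_) hf
    · have h0 := χ.nonneg (x := a n • x)
      have h1 := χ.le_one (x := a n • x)
      rw [abs_le]; constructor <;> simp only [X] <;> linarith
    · have h1 : Tendsto (fun n => X n x) atTop (𝓝 (χ 0)) := by
        refine (χ.continuous.tendsto 0).comp ?_
        simpa using ha0.smul_const x
      have h2 : χ (0 : Plane) = 1 := χ.one_of_mem_closedBall (by simp [χ])
      rw [h2] at h1
      simpa using h1.sub_const 1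
  have hX2 : ∀ j, Tendsto (fun n => eLpNorm (fun x => partialDeriv (X n) j x * v x) 2 volume)
      atTop (𝓝 0) := by
    intro j
    refine tendsto_eLpNorm_bounded_mul (fun n => (contDiff_partialDeriv (hX n) j).continuous)
      (C := C) (fun n x => ?_) (fun x => ?_) h.memLp
    · rw [hdX, abs_mul, abs_of_pos (ha n)]
      have : a n ≤ 1 := by
        simp only [a]; rw [div_le_one (by positivity)]; linarith [Nat.cast_nonneg (α := ℝ) n]
      nlinarith [hC j (a n • x), abs_nonneg (partialDeriv χ j (a n • x)), ha n]
    · simp only [hdX]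
      refine squeeze_zero_norm (a := fun n => a n * C) (fun n => ?_)
        (by simpa using ha0.mul_const C)
      rw [norm_mul, Real.norm_of_nonneg (ha n).le]
      exact mul_le_mul_of_nonneg_left (hC j _) (ha n).le
  -- For each cutoff the mollification scale is taken small.
  have hmol : ∀ n, ∃ ε, 0 < ε ∧
      eLpNorm (fun x => moll ε (fun x => X n x * v x) x - X n x * v x) 2 volume
        ≤ ENNReal.ofReal (a n) ∧
      ∀ j, eLpNorm (fun x => moll ε (fun x => X n x * G j x + partialDeriv (X n) j x * v x) x -
        (X n x * G j x + partialDeriv (X n) j x * v x)) 2 volume ≤ ENNReal.ofReal (a n) := by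
    intro n
    have hp : 0 < ENNReal.ofReal (a n) := ENNReal.ofReal_pos.2 (ha n)
    have t0 := ENNReal.tendsto_nhds_zero.1 (tendsto_moll (hXH n).memLp) _ hp
    have t1 := fun j => ENNReal.tendsto_nhds_zero.1 (tendsto_moll ((hXH n).grad_memLp j)) _ hp
    have := (t0.and (eventually_all.2 t1)).filter_mono (nhdsWithin_le_nhds (s := Ioi 0))
    obtain ⟨ε, hε, hε0⟩ := (this.and self_mem_nhdsWithin).exists
    exact ⟨ε, hε0, hε.1, hε.2⟩
  choose ε hε hε1 hε2 using hmol
  have haE : Tendsto (fun n => ENNReal.ofReal (a n)) atTop (𝓝 0) := by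
    simpa using ENNReal.tendsto_ofReal ha0
  have hsm : ∀ n, ContDiff ℝ ∞ (moll (ε n) (fun x => X n x * v x)) := fun n =>
    contDiff_moll (hε n) (hXH n).weak.locInt
  refine ⟨fun n => moll (ε n) (fun x => X n x * v x), hsm,
    fun n => hasCompactSupport_moll (hε n).le (hXc n).mul_right, ?_, fun j => ?_⟩
  · refine tendsto_of_tendsto_of_tendsto_of_le_of_le tendsto_const_nhds
      (by simpa using haE.add (hX1 h.memLp)) (fun _ => zero_le) fun n => ?_
    have e : (fun x => moll (ε n) (fun x => X n x * v x) x - v x) =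
        (fun x => moll (ε n) (fun x => X n x * v x) x - X n x * v x) +
        (fun x => (X n x - 1) * v x) := by ext x; simp only [Pi.add_apply]; ring
    simp only
    rw [e]
    refine (eLpNorm_add_le ((memLp_moll (hXH n).memLp _).sub (hXH n).memLp).1
      (((hX n).continuous.sub continuous_const).aestronglyMeasurable.mul h.memLp.1)
      (by norm_num)).trans ?_
    exact add_le_add (hε1 n) le_rfl
  · refine tendsto_of_tendsto_of_tendsto_of_le_of_le tendsto_const_nhds
      (by simpa using (haE.add (hX1 (h.grad_memLp j))).add (hX2 j)) (fun _ => zero_le) fun n => ?_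
    have hw := (IsWeakGrad.of_contDiff (hsm n)).unique ((hXH n).mollify (ε n)).weak j
    have e : (fun x => partialDeriv (moll (ε n) (fun x => X n x * v x)) j x - G j x) =ᵐ[volume]
        ((fun x => moll (ε n) (fun x => X n x * G j x + partialDeriv (X n) j x * v x) x -
        (X n x * G j x + partialDeriv (X n) j x * v x)) +
        (fun x => (X n x - 1) * G j x)) + fun x => partialDeriv (X n) j x * v x := by
      filter_upwards [hw] with x hx
      rw [hx]
      simp only [Pi.add_apply]
      ring
    simp only
    rw [eLpNorm_congr_ae e]
    have m1 := ((memLp_moll ((hXH n).grad_memLp j) (ε n)).sub ((hXH n).grad_memLp j)).1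
    have m2 := (((hX n).continuous.sub (continuous_const (y := (1:ℝ)))).aestronglyMeasurable
      (μ := volume)).mul (h.grad_memLp j).1
    have m3 := ((contDiff_partialDeriv (hX n) j).continuous.aestronglyMeasurable
      (μ := volume)).mul h.memLp.1
    refine (eLpNorm_add_le (m1.add m2) m3 (by norm_num)).trans ?_
    refine add_le_add ?_ le_rfl
    refine (eLpNorm_add_le m1 m2 (by norm_num)).trans ?_
    exact add_le_add (hε2 n j) le_rfl

/-! ### Ladyzhenskaya's inequality -/

lemma eLpNorm_sq {v : Plane → ℝ} :
    eLpNorm (fun x => v x ^ 2) 2 volume = eLpNorm v 4 volume ^ 2 := by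
  have := eLpNorm_norm_rpow (p := 2) v (q := 2) (μ := volume) (by norm_num)
  have e : (2 : ℝ≥0∞) * ENNReal.ofReal 2 = 4 := by norm_num
  rw [e] at this
  rw [← ENNReal.rpow_natCast]
  rw [show ((2 : ℕ) : ℝ) = 2 by norm_num, ← this]
  congr 1; ext x; simp

/-- Ladyzhenskaya's inequality for test functions: the Sobolev inequality
`‖φ‖₂ ≤ C ‖∇φ‖₁` of the plane, applied to `φ = θ²`. -/
lemma exists_ladyzhenskaya_test : ∃ C : ℝ, 0 ≤ C ∧ ∀ θ : Plane → ℝ, ContDiff ℝ ∞ θ →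
    HasCompactSupport θ → eLpNorm θ 4 volume ^ 2 ≤ ENNReal.ofReal C * (eLpNorm θ 2 volume *
      (eLpNorm (partialDeriv θ 0) 2 volume + eLpNorm (partialDeriv θ 1) 2 volume)) := by
  set K := eLpNormLESNormFDerivOneConst (volume : Measure Plane) 2
  refine ⟨K * 2, by positivity, fun θ hθ hc => ?_⟩
  have hp : NNReal.HolderConjugate (Module.finrank ℝ Plane) 2 := by
    rw [finrank_euclideanSpace, Fintype.card_fin]
    rw [NNReal.holderConjugate_iff]
    norm_num
  have h1 := eLpNorm_le_eLpNorm_fderiv_one (volume : Measure Plane) (u := fun x => θ x ^ 2)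
    ((hθ.pow 2).of_le (by norm_cast)) (hc.comp_left (g := fun s => s ^ 2) (by simp)) hp
  have h2 : eLpNorm (fderiv ℝ (fun x => θ x ^ 2)) 1 volume ≤
      2 * (eLpNorm θ 2 volume * (eLpNorm (partialDeriv θ 0) 2 volume +
        eLpNorm (partialDeriv θ 1) 2 volume)) := by
    have hb : ∀ x, ‖fderiv ℝ (fun x => θ x ^ 2) x‖ ≤
        2 * ‖θ x * (|partialDeriv θ 0 x| + |partialDeriv θ 1 x|)‖ := by
      intro x
      have : fderiv ℝ (fun x => θ x ^ 2) x = (2 * θ x) • fderiv ℝ θ x := by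
        have := fderiv_fun_pow (𝕜 := ℝ) (x := x) (f := θ) 2 (hθ.differentiable (by simp) x)
        simpa using this
      rw [this, norm_smul, norm_mul, norm_mul, Real.norm_of_nonneg (by positivity :
        0 ≤ |partialDeriv θ 0 x| + |partialDeriv θ 1 x|), mul_assoc]
      simp only [Real.norm_ofNat]
      gcongr
      refine ContinuousLinearMap.opNorm_le_bound _ (by positivity) fun y => ?_
      rw [fderiv_apply_eq_sum, Fin.sum_univ_two]
      have e0 : |y 0| ≤ ‖y‖ := PiLp.norm_apply_le y 0
      have e1 : |y 1| ≤ ‖y‖ := PiLp.norm_apply_le y 1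
      refine (abs_add_le _ _).trans ?_
      rw [abs_mul, abs_mul]
      nlinarith [abs_nonneg (partialDeriv θ 0 x), abs_nonneg (partialDeriv θ 1 x)]
    have hd : ∀ j, MemLp (partialDeriv θ j) 2 volume := fun j =>
      memLp_of_test (contDiff_partialDeriv hθ j) (hasCompactSupport_partialDeriv hc j) 2
    have hd1 : ∀ j, AEStronglyMeasurable (fun x => |partialDeriv θ j x|) volume := fun j =>
      (hd j).1.norm
    refine (eLpNorm_mono_real
      (g := fun x => 2 * ‖θ x * (|partialDeriv θ 0 x| + |partialDeriv θ 1 x|)‖) hb).trans ?_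
    have : (fun x => 2 * ‖θ x * (|partialDeriv θ 0 x| + |partialDeriv θ 1 x|)‖) =
      (2 : ℝ) • fun x => ‖θ x * (|partialDeriv θ 0 x| + |partialDeriv θ 1 x|)‖ := rfl
    rw [this, eLpNorm_const_smul, eLpNorm_norm]
    have e2 : ‖(2 : ℝ)‖ₑ = 2 := by rw [← ofReal_norm]; norm_num
    rw [e2]
    gcongr
    have h3 := eLpNorm_smul_le_mul_eLpNorm (p := 2) (q := 2) (r := 1) (μ := volume)
      (f := fun x => |partialDeriv θ 0 x| + |partialDeriv θ 1 x|) (φ := θ)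
      ((hd1 0).add (hd1 1)) hθ.continuous.aestronglyMeasurable
    refine h3.trans ?_
    gcongr
    refine (eLpNorm_add_le (hd1 0) (hd1 1) (by norm_num)).trans (le_of_eq ?_)
    rw [← eLpNorm_norm (partialDeriv θ 0), ← eLpNorm_norm (partialDeriv θ 1)]
    rfl
  rw [← eLpNorm_sq, ENNReal.ofReal_mul (by positivity), mul_assoc]
  refine h1.trans ?_
  rw [ENNReal.ofReal_coe_nnreal]
  have : ENNReal.ofReal 2 = 2 := by norm_num
  rw [this]
  gcongr
  exact le_rfl

/-- **Ladyzhenskaya's inequality** `‖v‖₄² ≤ C ‖v‖₂ ‖∇v‖₂` in the plane. -/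
lemma exists_ladyzhenskaya : ∃ C : ℝ, 0 ≤ C ∧ ∀ (v : Plane → ℝ) (G : Fin 2 → Plane → ℝ), IsH1 v G →
    eLpNorm v 4 volume ^ 2 ≤ ENNReal.ofReal C * (eLpNorm v 2 volume *
      (eLpNorm (G 0) 2 volume + eLpNorm (G 1) 2 volume)) := by
  obtain ⟨C, hC0, hC⟩ := exists_ladyzhenskaya_test
  refine ⟨C, hC0, fun v G h => ?_⟩
  obtain ⟨θ, hθ, hc, t0, t1⟩ := h.exists_approx
  have hm := tendstoInMeasure_of_tendsto_eLpNorm (p := 2) (by norm_num)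
    (fun n => (hθ n).continuous.aestronglyMeasurable) h.memLp.1 t0
  have lim : ∀ {f : ℕ → Plane → ℝ} {g : Plane → ℝ}, (∀ n, MemLp (f n) 2 volume) →
      MemLp g 2 volume → Tendsto (fun n => eLpNorm (fun x => f n x - g x) 2 volume) atTop (𝓝 0) →
      Tendsto (fun n => eLpNorm (f n) 2 volume) atTop (𝓝 (eLpNorm g 2 volume)) := by
    intro f g hf hg ht
    have hsub : Tendsto (fun n => eLpNorm g 2 volume + eLpNorm (fun x => f n x - g x) 2 volume)
        atTop (𝓝 (eLpNorm g 2 volume)) := by simpa using ht.const_add (eLpNorm g 2 volume)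
    have hsub' : Tendsto (fun n => eLpNorm g 2 volume - eLpNorm (fun x => f n x - g x) 2 volume)
        atTop (𝓝 (eLpNorm g 2 volume)) := by
      simpa using ENNReal.Tendsto.sub tendsto_const_nhds ht (Or.inl hg.2.ne)
    refine tendsto_of_tendsto_of_tendsto_of_le_of_le hsub' hsub (fun n => ?_) (fun n => ?_)
    · simp only
      rw [tsub_le_iff_right]
      have := eLpNorm_sub_le (p := 2) (hf n).1 ((hf n).1.sub hg.1) (by norm_num)
      simpa [Pi.sub_def] using this
    · have := eLpNorm_add_le (p := 2) hg.1 ((hf n).1.sub hg.1) (by norm_num)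
      rw [add_sub_cancel] at this
      exact this
  have l0 := lim (fun n => memLp_of_test (hθ n) (hc n) 2) h.memLp t0
  have l1 := fun j => lim (fun n => memLp_of_test (contDiff_partialDeriv (hθ n) j)
    (hasCompactSupport_partialDeriv (hc n) j) 2) (h.grad_memLp j) (t1 j)
  have lR : Tendsto (fun n => ENNReal.ofReal C * (eLpNorm (θ n) 2 volume *
      (eLpNorm (partialDeriv (θ n) 0) 2 volume + eLpNorm (partialDeriv (θ n) 1) 2 volume))) atTop
      (𝓝 (ENNReal.ofReal C * (eLpNorm v 2 volume *
      (eLpNorm (G 0) 2 volume + eLpNorm (G 1) 2 volume)))) := by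
    refine ENNReal.Tendsto.const_mul (ENNReal.Tendsto.mul l0 (Or.inr ?_) ((l1 0).add (l1 1))
      (Or.inr h.memLp.2.ne)) (Or.inr ENNReal.ofReal_ne_top)
    exact ENNReal.add_ne_top.2 ⟨(h.grad_memLp 0).2.ne, (h.grad_memLp 1).2.ne⟩
  refine ENNReal.le_of_forall_pos_le_add fun e he hfin => ?_
  have lev := lR.eventually (ENNReal.Icc_mem_nhds hfin.ne (ENNReal.coe_pos.2 he).ne')
  set A := ENNReal.ofReal C * (eLpNorm v 2 volume *
      (eLpNorm (G 0) 2 volume + eLpNorm (G 1) 2 volume)) + e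
  have hb : ∀ᶠ n in atTop, eLpNorm (θ n) 4 volume ≤ A ^ (1 / 2 : ℝ) := by
    filter_upwards [lev] with n hn
    have h2 := (hC _ (hθ n) (hc n)).trans hn.2
    calc eLpNorm (θ n) 4 volume = (eLpNorm (θ n) 4 volume ^ 2) ^ (1 / 2 : ℝ) := by
          rw [← ENNReal.rpow_natCast, ← ENNReal.rpow_mul]; norm_num
      _ ≤ _ := by gcongr
  have hl := eLpNorm_le_of_tendstoInMeasure hb hm
    (fun n => (hθ n).continuous.aestronglyMeasurable)
  calc eLpNorm v 4 volume ^ 2 ≤ (A ^ (1 / 2 : ℝ)) ^ 2 := by gcongr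
    _ = A := by rw [← ENNReal.rpow_natCast, ← ENNReal.rpow_mul]; norm_num

/-! ### Hölder estimates, Korn's identity and the convective term -/

lemma holderTriple_four : ENNReal.HolderTriple 4 4 2 := ⟨by
  have h4 : (4 : ℝ≥0∞) = 2 * 2 := by norm_num
  rw [h4, ENNReal.mul_inv (by simp) (by simp), ← two_mul, ← mul_assoc,
    ENNReal.mul_inv_cancel (by simp) (by simp), one_mul]⟩

/-- The `L²` norm of a scalar function on the plane, as a real number. -/
noncomputable def l2 (f : Plane → ℝ) : ℝ := (eLpNorm f 2 volume).toReal

/-- The `L⁴` norm of a scalar function on the plane, as a real number. -/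
noncomputable def l4 (f : Plane → ℝ) : ℝ := (eLpNorm f 4 volume).toReal

lemma l2_nonneg (f : Plane → ℝ) : 0 ≤ l2 f := ENNReal.toReal_nonneg

lemma l4_nonneg (f : Plane → ℝ) : 0 ≤ l4 f := ENNReal.toReal_nonneg

lemma l2_sq {f : Plane → ℝ} (hf : MemLp f 2 volume) : l2 f ^ 2 = ∫ x, f x ^ 2 := by
  rw [l2, ← ENNReal.toReal_pow, eLpNorm_two_sq (X := ℝ), integral_eq_lintegral_of_nonneg_ae
    (f := fun x => f x ^ 2) (Eventually.of_forall fun x => sq_nonneg (f x)) (hf.1.pow 2)]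
  congr 1
  apply lintegral_congr
  intro x
  rw [← ofReal_norm, ← ENNReal.ofReal_pow (norm_nonneg _), Real.norm_eq_abs, sq_abs]

lemma abs_integral_mul_le {f g : Plane → ℝ} (hf : MemLp f 2 volume) (hg : MemLp g 2 volume) :
    |∫ x, f x * g x| ≤ l2 f * l2 g := by
  have h := eLpNorm_smul_le_mul_eLpNorm (p := 2) (q := 2) (r := 1) (μ := (volume : Measure Plane))
    (f := g) (φ := f) hg.1 hf.1
  rw [l2, l2, ← ENNReal.toReal_mul]
  refine (norm_integral_le_lintegral_norm (fun x => f x * g x)).trans ?_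
  apply ENNReal.toReal_mono (ENNReal.mul_ne_top hf.2.ne hg.2.ne)
  refine le_trans (le_of_eq ?_) h
  rw [eLpNorm_one_eq_lintegral_enorm]
  apply lintegral_congr
  intro x
  rw [ofReal_norm]
  rfl

lemma memLp_mul_four {f g : Plane → ℝ} (hf : MemLp f 4 volume) (hg : MemLp g 4 volume) :
    MemLp (fun x => f x * g x) 2 volume :=
  hg.mul (hpqr := holderTriple_four) hf

lemma eLpNorm_mul_four_le {f g : Plane → ℝ} (hf : MemLp f 4 volume) (hg : MemLp g 4 volume) :
    eLpNorm (fun x => f x * g x) 2 volume ≤ eLpNorm f 4 volume * eLpNorm g 4 volume := by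
  have := eLpNorm_smul_le_mul_eLpNorm (p := 4) (q := 4) (r := 2) (μ := volume)
    (hpqr := holderTriple_four) (f := g) (φ := f) hg.1 hf.1
  exact this

lemma l2_mul_four_le {f g : Plane → ℝ} (hf : MemLp f 4 volume) (hg : MemLp g 4 volume) :
    l2 (fun x => f x * g x) ≤ l4 f * l4 g := by
  rw [l2, l4, l4, ← ENNReal.toReal_mul]
  exact ENNReal.toReal_mono (ENNReal.mul_ne_top hf.2.ne hg.2.ne) (eLpNorm_mul_four_le hf hg)

lemma l2_bounded_mul_le {f g : Plane → ℝ} {C : ℝ} (hC0 : 0 ≤ C) (hC : ∀ x, |g x| ≤ C)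
    (hf : MemLp f 2 volume) : l2 (fun x => g x * f x) ≤ C * l2 f := by
  have h : eLpNorm (fun x => g x * f x) 2 volume ≤ ENNReal.ofReal C * eLpNorm f 2 volume := by
    refine eLpNorm_le_mul_eLpNorm_of_ae_le_mul (Eventually.of_forall fun x => ?_) 2
    rw [norm_mul]
    exact mul_le_mul_of_nonneg_right (hC x) (norm_nonneg _)
  have := ENNReal.toReal_mono (ENNReal.mul_ne_top ENNReal.ofReal_ne_top hf.2.ne) h
  rwa [ENNReal.toReal_mul, ENNReal.toReal_ofReal hC0] at this

lemma l4_bounded_mul_le {f g : Plane → ℝ} {C : ℝ} (hC0 : 0 ≤ C) (hC : ∀ x, |g x| ≤ C)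
    (hf : MemLp f 4 volume) : l4 (fun x => g x * f x) ≤ C * l4 f := by
  have h : eLpNorm (fun x => g x * f x) 4 volume ≤ ENNReal.ofReal C * eLpNorm f 4 volume := by
    refine eLpNorm_le_mul_eLpNorm_of_ae_le_mul (Eventually.of_forall fun x => ?_) 4
    rw [norm_mul]
    exact mul_le_mul_of_nonneg_right (hC x) (norm_nonneg _)
  have := ENNReal.toReal_mono (ENNReal.mul_ne_top ENNReal.ofReal_ne_top hf.2.ne) h
  rwa [ENNReal.toReal_mul, ENNReal.toReal_ofReal hC0] at this

lemma IsH1.memLp_four {v : Plane → ℝ} {G : Fin 2 → Plane → ℝ} (h : IsH1 v G) :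
    MemLp v 4 volume := by
  obtain ⟨C, -, hC⟩ := exists_ladyzhenskaya
  refine ⟨h.memLp.1, ?_⟩
  have h1 := (hC v G h).trans_lt (ENNReal.mul_lt_top ENNReal.ofReal_lt_top
    (ENNReal.mul_lt_top h.memLp.2 (ENNReal.add_lt_top.2 ⟨(h.grad_memLp 0).2, (h.grad_memLp 1).2⟩)))
  by_contra hn
  rw [not_lt, top_le_iff] at hn
  rw [hn] at h1
  simp at h1

lemma exists_l4_sq_le : ∃ C : ℝ, 0 ≤ C ∧ ∀ (v : Plane → ℝ) (G : Fin 2 → Plane → ℝ), IsH1 v G →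
    l4 v ^ 2 ≤ C * (l2 v * (l2 (G 0) + l2 (G 1))) := by
  obtain ⟨C, hC0, hC⟩ := exists_ladyzhenskaya
  refine ⟨C, hC0, fun v G h => ?_⟩
  have h0 := (h.grad_memLp 0).2.ne
  have h1 := (h.grad_memLp 1).2.ne
  have := ENNReal.toReal_mono (ENNReal.mul_ne_top ENNReal.ofReal_ne_top
    (ENNReal.mul_ne_top h.memLp.2.ne (ENNReal.add_ne_top.2 ⟨h0, h1⟩))) (hC v G h)
  rwa [ENNReal.toReal_pow, ENNReal.toReal_mul, ENNReal.toReal_ofReal hC0, ENNReal.toReal_mul,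
    ENNReal.toReal_add h0 h1] at this

lemma IsH1.of_test {θ : Plane → ℝ} (hθ : ContDiff ℝ ∞ θ) (hc : HasCompactSupport θ) :
    IsH1 θ (partialDeriv θ) :=
  ⟨memLp_of_test hθ hc 2, fun j => memLp_of_test (contDiff_partialDeriv hθ j)
    (hasCompactSupport_partialDeriv hc j) 2, .of_contDiff hθ⟩

lemma IsH1.sub {v w : Plane → ℝ} {G K : Fin 2 → Plane → ℝ} (h : IsH1 v G) (k : IsH1 w K) :
    IsH1 (fun x => v x - w x) (fun j x => G j x - K j x) :=
  ⟨h.memLp.sub k.memLp, fun j => (h.grad_memLp j).sub (k.grad_memLp j), h.weak.sub k.weak⟩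

/-- By Ladyzhenskaya's inequality, convergence in `H¹` implies convergence in `L⁴`. -/
lemma tendsto_eLpNorm_four {v : Plane → ℝ} {G : Fin 2 → Plane → ℝ} (h : IsH1 v G)
    {f : ℕ → Plane → ℝ} {F : ℕ → Fin 2 → Plane → ℝ} (hf : ∀ n, IsH1 (f n) (F n))
    (t0 : Tendsto (fun n => eLpNorm (fun x => f n x - v x) 2 volume) atTop (𝓝 0))
    (t1 : ∀ j, Tendsto (fun n => eLpNorm (fun x => F n j x - G j x) 2 volume) atTop (𝓝 0)) :
    Tendsto (fun n => eLpNorm (fun x => f n x - v x) 4 volume) atTop (𝓝 0) := by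
  obtain ⟨C, hC0, hC⟩ := exists_ladyzhenskaya
  have lR : Tendsto (fun n => ENNReal.ofReal C * (eLpNorm (fun x => f n x - v x) 2 volume *
      (eLpNorm (fun x => F n 0 x - G 0 x) 2 volume +
        eLpNorm (fun x => F n 1 x - G 1 x) 2 volume))) atTop (𝓝 0) := by
    have := ENNReal.Tendsto.const_mul (a := ENNReal.ofReal C)
      (ENNReal.Tendsto.mul t0 (Or.inr (by simp)) ((t1 0).add (t1 1)) (Or.inr (by simp)))
      (Or.inr ENNReal.ofReal_ne_top)
    simpa using this
  have lS : Tendsto (fun n => eLpNorm (fun x => f n x - v x) 4 volume ^ 2) atTop (𝓝 0) :=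
    tendsto_of_tendsto_of_tendsto_of_le_of_le tendsto_const_nhds lR (fun _ => zero_le)
      fun n => hC (fun x => f n x - v x) (fun j x => F n j x - G j x) ((hf n).sub h)
  have := lS.ennrpow_const (1 / 2 : ℝ)
  simp only [← ENNReal.rpow_natCast, ← ENNReal.rpow_mul] at this
  norm_num at this
  exact this

/-- The null-Lagrangian identity `∫ ∂₁v ∂₀w = ∫ ∂₀v ∂₁w`. -/
lemma integral_grad_mul_comm {v w : Plane → ℝ} {G K : Fin 2 → Plane → ℝ} (h : IsH1 v G)
    (k : IsH1 w K) : ∫ x, G 1 x * K 0 x = ∫ x, G 0 x * K 1 x := by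
  obtain ⟨θ, hθ, hc, -, t1⟩ := k.exists_approx
  have hd : ∀ n j, MemLp (partialDeriv (θ n) j) 2 volume := fun n j =>
    (IsH1.of_test (hθ n) (hc n)).grad_memLp j
  have l0 := tendsto_integral_mul_of_tendsto_L2 (fun n => hd n 0) (k.grad_memLp 0)
    (h.grad_memLp 1) (t1 0)
  have l1 := tendsto_integral_mul_of_tendsto_L2 (fun n => hd n 1) (k.grad_memLp 1)
    (h.grad_memLp 0) (t1 1)
  simp only [mul_comm (G _ _)]
  refine tendsto_nhds_unique l0 (l1.congr fun n => ?_)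
  have e0 := h.weak.integral_eq _ (contDiff_partialDeriv (hθ n) 0)
    (hasCompactSupport_partialDeriv (hc n) 0) 1
  have e1 := h.weak.integral_eq _ (contDiff_partialDeriv (hθ n) 1)
    (hasCompactSupport_partialDeriv (hc n) 1) 0
  simp only [partialDeriv_comm (hθ n) 0 1] at e0
  simp only [mul_comm (G _ _)] at e0 e1
  linarith

/-- Transport by a divergence-free field is antisymmetric on `H¹`.  The two integrals are limits of
those of test functions, since the products with the field `c ∈ L⁴` are in `L²`. -/
lemma transport_antisymm {c : Fin 2 → Plane → ℝ} (hc4 : ∀ j, MemLp (c j) 4 volume)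
    (hdiv : ∀ θ : Plane → ℝ, ContDiff ℝ ∞ θ → HasCompactSupport θ →
      ∫ x, ∑ j, c j x * partialDeriv θ j x = 0)
    {v z : Plane → ℝ} {G Z : Fin 2 → Plane → ℝ} (hv : IsH1 v G) (hz : IsH1 z Z) :
    ∑ j, ∫ x, G j x * (c j x * z x) = - ∑ j, ∫ x, Z j x * (c j x * v x) := by
  -- If `z = ξ` is a test function, `v` is replaced by test functions `θ n`; then `θ n ξ` is a test
  -- function for the divergence-free condition.
  have step : ∀ ξ : Plane → ℝ, ContDiff ℝ ∞ ξ → HasCompactSupport ξ →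
      ∑ j, ∫ x, G j x * (c j x * ξ x) = - ∑ j, ∫ x, v x * (c j x * partialDeriv ξ j x) := by
    intro ξ hξ hξc
    obtain ⟨θ, hθ, hc, t0, t1⟩ := hv.exists_approx
    have m1 : ∀ j, MemLp (fun x => c j x * ξ x) 2 volume := fun j =>
      memLp_mul_four (hc4 j) (memLp_of_test hξ hξc 4)
    have m2 : ∀ j, MemLp (fun x => c j x * partialDeriv ξ j x) 2 volume := fun j =>
      memLp_mul_four (hc4 j) (memLp_of_test (contDiff_partialDeriv hξ j)
        (hasCompactSupport_partialDeriv hξc j) 4)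
    have mθ : ∀ n, IsH1 (θ n) (partialDeriv (θ n)) := fun n => .of_test (hθ n) (hc n)
    have l1 := tendsto_finsetSum Finset.univ fun j _ =>
      tendsto_integral_mul_of_tendsto_L2 (fun n => (mθ n).grad_memLp j) (hv.grad_memLp j)
        (m1 j) (t1 j)
    have lS := (tendsto_finsetSum Finset.univ fun j _ =>
      tendsto_integral_mul_of_tendsto_L2 (fun n => (mθ n).memLp) hv.memLp (m2 j) t0).neg
    refine tendsto_nhds_unique l1 (lS.congr fun n => ?_)
    have e := hdiv (fun x => θ n x * ξ x) ((hθ n).mul hξ) (hc n).mul_right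
    have e' : ∀ x, ∑ j, c j x * partialDeriv (fun x => θ n x * ξ x) j x =
        ∑ j, (θ n x * (c j x * partialDeriv ξ j x) + partialDeriv (θ n) j x * (c j x * ξ x)) := by
      intro x
      refine Finset.sum_congr rfl fun j _ => ?_
      rw [partialDeriv_mul ((hθ n).differentiable (by simp) x) (hξ.differentiable (by simp) x)]
      ring
    simp only [e'] at e
    have hi : ∀ j, Integrable (fun x => θ n x * (c j x * partialDeriv ξ j x) +
        partialDeriv (θ n) j x * (c j x * ξ x)) := fun j =>
      (integrable_mul_L2 (mθ n).memLp (m2 j)).add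
      (integrable_mul_L2 ((mθ n).grad_memLp j) (m1 j))
    rw [integral_finsetSum _ fun j _ => hi j] at e
    rw [Finset.sum_congr rfl fun j _ => integral_add (integrable_mul_L2 (mθ n).memLp (m2 j))
      (integrable_mul_L2 ((mθ n).grad_memLp j) (m1 j)), Finset.sum_add_distrib] at e
    linarith
  obtain ⟨ξ, hξ, hξc, t0, t1⟩ := hz.exists_approx
  have mξ : ∀ n, IsH1 (ξ n) (partialDeriv (ξ n)) := fun n => .of_test (hξ n) (hξc n)
  have t4 := tendsto_eLpNorm_four hz mξ t0 t1
  have lz : ∀ j, Tendsto (fun n => ∫ x, c j x * ξ n x * G j x) atTop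
      (𝓝 (∫ x, c j x * z x * G j x)) := by
    intro j
    refine tendsto_integral_mul_of_tendsto_L2
      (fun n => memLp_mul_four (hc4 j) (mξ n).memLp_four)
      (memLp_mul_four (hc4 j) hz.memLp_four) (hv.grad_memLp j) ?_
    have hb : Tendsto (fun n => eLpNorm (c j) 4 volume * eLpNorm (fun x => ξ n x - z x) 4 volume)
        atTop (𝓝 0) := by
      simpa using ENNReal.Tendsto.const_mul t4 (Or.inr (hc4 j).2.ne)
    refine tendsto_of_tendsto_of_tendsto_of_le_of_le tendsto_const_nhds hb (fun _ => zero_le)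
      fun n => ?_
    have := eLpNorm_mul_four_le (hc4 j) ((mξ n).sub hz).memLp_four
    simpa only [mul_sub] using this
  have lZ : ∀ j, Tendsto (fun n => ∫ x, partialDeriv (ξ n) j x * (c j x * v x)) atTop
      (𝓝 (∫ x, Z j x * (c j x * v x))) := fun j =>
    tendsto_integral_mul_of_tendsto_L2 (fun n => (mξ n).grad_memLp j) (hz.grad_memLp j)
      (memLp_mul_four (hc4 j) hv.memLp_four) (t1 j)
  have l1 := tendsto_finsetSum Finset.univ fun j (_ : j ∈ Finset.univ) => lz j
  have lS := (tendsto_finsetSum Finset.univ fun j (_ : j ∈ Finset.univ) => lZ j).neg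
  simp only [mul_comm (G _ _)]
  refine tendsto_nhds_unique l1 (lS.congr fun n => ?_)
  have := step (ξ n) (hξ n) (hξc n)
  simp only [mul_comm (G _ _)] at this
  rw [this]
  congr 1
  refine Finset.sum_congr rfl fun j _ => ?_
  congr 1; ext x; ring

/-! ### An abstract energy identity -/

/-- The Cauchy-Schwarz inequality, from the nonnegativity of the integral of `(m - c)²` where `c`
is the mean value of `m`. -/
lemma sq_integral_le {m : ℝ → ℝ} {a b : ℝ} (hab : a ≤ b) (hm : IntervalIntegrable m volume a b)
    (hm2 : IntervalIntegrable (fun s => m s ^ 2) volume a b) :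
    (∫ s in a..b, m s) ^ 2 ≤ (b - a) * ∫ s in a..b, m s ^ 2 := by
  rcases hab.eq_or_lt with rfl | hlt
  · simp
  have hh : 0 < b - a := sub_pos.2 hlt
  set c := (b - a)⁻¹ * ∫ s in a..b, m s
  have h5 : 0 ≤ ∫ s in a..b, (m s - c) ^ 2 :=
    intervalIntegral.integral_nonneg hab fun r _ => sq_nonneg _
  have h6 : ∫ s in a..b, (m s - c) ^ 2 =
      (∫ s in a..b, m s ^ 2) - 2 * c * (∫ s in a..b, m s) + (b - a) * c ^ 2 := by
    have : ∀ s, (m s - c) ^ 2 = m s ^ 2 - 2 * c * m s + c ^ 2 := fun s => by ring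
    simp only [this]
    rw [intervalIntegral.integral_add (hm2.sub (hm.const_mul _)) (by simp),
      intervalIntegral.integral_sub hm2 (hm.const_mul _), intervalIntegral.integral_const_mul,
      intervalIntegral.integral_const]
    simp
  have h7 : ∫ s in a..b, m s = (b - a) * c := by simp only [c]; field_simp
  rw [h6, h7] at h5
  rw [h7]
  nlinarith

section Energy

variable {H : Type*} [NormedAddCommGroup H] [InnerProductSpace ℝ H] [CompleteSpace H]

lemma tendsto_integral_inner {α ι : Type*} [MeasurableSpace α] {m : Measure α} {l : Filter ι}
    {f g : ι → α → H} {f₀ g₀ : α → H} (hf : ∀ n, MemLp (f n) 2 m) (hg : ∀ n, MemLp (g n) 2 m)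
    (hf₀ : MemLp f₀ 2 m) (hg₀ : MemLp g₀ 2 m)
    (tf : Tendsto (fun n => eLpNorm (fun x => f n x - f₀ x) 2 m) l (𝓝 0))
    (tg : Tendsto (fun n => eLpNorm (fun x => g n x - g₀ x) 2 m) l (𝓝 0)) :
    Tendsto (fun n => ∫ x, inner ℝ (f n x) (g n x) ∂m) l (𝓝 (∫ x, inner ℝ (f₀ x) (g₀ x) ∂m)) := by
  have e : ∀ {f g : α → H} (hf : MemLp f 2 m) (hg : MemLp g 2 m),
      inner ℝ (hf.toLp f) (hg.toLp g) = ∫ x, inner ℝ (f x) (g x) ∂m := by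
    intro f g hf hg
    rw [L2.inner_def]
    refine integral_congr_ae ?_
    filter_upwards [hf.coeFn_toLp, hg.coeFn_toLp] with x h1 h2
    rw [h1, h2]
  simp only [← e (hf _) (hg _), ← e hf₀ hg₀]
  refine Tendsto.inner ?_ ?_
  · exact (Lp.tendsto_Lp_iff_tendsto_eLpNorm'' _ hf _ hf₀).2 tf
  · exact (Lp.tendsto_Lp_iff_tendsto_eLpNorm'' _ hg _ hg₀).2 tg

/-- Forward Steklov averages of an `L²` function converge to it. -/
lemma tendsto_steklov {N : ℝ → H} (hN : MemLp N 2 volume) :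
    Tendsto (fun h : ℝ => eLpNorm (fun t => shiftAvg (volume.restrict (Icc (0 : ℝ) 1))
      (fun r => h * r) (fun _ => 1) N t - N t) 2 volume) (𝓝 0) (𝓝 0) := by
  rw [ENNReal.tendsto_nhds_zero]
  intro a ha
  obtain ⟨r, hr, hra⟩ := Metric.eventually_nhds_iff.1
    ((ENNReal.tendsto_nhds_zero.1 (tendsto_eLpNorm_shift_sub hN)) a ha)
  filter_upwards [Metric.ball_mem_nhds (0 : ℝ) hr] with h hh
  refine (eLpNorm_shiftAvg_sub_le (κ := volume.restrict (Icc (0 : ℝ) 1)) (C := 1) (by fun_prop)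
    measurable_const (fun _ => by simp) (by simp) hN (B := a) ?_).trans (by simp)
  filter_upwards [ae_restrict_mem measurableSet_Icc] with y hy
  apply hra
  have h3 : |h| < r := by simpa using hh
  rw [dist_zero_right, Real.norm_eq_abs, abs_mul, abs_of_nonneg hy.1]
  nlinarith [abs_nonneg h, hy.2, hy.1]

/-- Let `P` be the primitive of `N` vanishing at `0` and let `G` be symmetric, separately
continuous and of the form `G t s = G 0 s + ⟪P t, U s⟫` for almost every `s`.  Then
`t ↦ G t t` is absolutely continuous with derivative `2 ⟪N, U⟫`.

The weak continuity of a solution does not give the continuity of `t ↦ G t t` directly.  But at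
almost every time `s` this function is `G t s + ⟪P s - P t, U s⟫`, so that its averages over
`[t, t + h]` tend to `G t t` for every `t`, and these averages can be differenced. -/
lemma energy_identity {U N : ℝ → H} (hU : MemLp U 2 volume) (hN : MemLp N 2 volume)
    {G : ℝ → ℝ → ℝ} {T : ℝ}
    (hG : ∀ᵐ s, s ∈ Icc 0 T → ∀ t ∈ Icc 0 T,
      G t s = G 0 s + inner ℝ (∫ τ in (0 : ℝ)..t, N τ) (U s))
    (hsymm : ∀ t ∈ Icc 0 T, ∀ s ∈ Icc 0 T, G t s = G s t)
    (hcont : ∀ t ∈ Icc 0 T, ContinuousOn (G t) (Icc 0 T))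
    {t₁ t₂ : ℝ} (h1 : 0 ≤ t₁) (h12 : t₁ ≤ t₂) (h2 : t₂ < T) :
    G t₂ t₂ - G t₁ t₁ = 2 * ∫ τ in t₁..t₂, inner ℝ (N τ) (U τ) := by
  have hNi : ∀ a b, IntervalIntegrable N volume a b := fun a b =>
    ((hN.locallyIntegrable (by norm_num)).integrableOn_isCompact isCompact_uIcc).intervalIntegrable
  have hUi : ∀ a b, IntervalIntegrable U volume a b := fun a b =>
    ((hU.locallyIntegrable (by norm_num)).integrableOn_isCompact isCompact_uIcc).intervalIntegrable
  set P : ℝ → H := fun t => ∫ τ in (0 : ℝ)..t, N τ with hP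
  have hPc : Continuous P := intervalIntegral.continuous_primitive hNi 0
  have hT0 : 0 ∈ Icc 0 T := ⟨le_rfl, by linarith⟩
  have hPU : ∀ c : H, ∀ a b, IntervalIntegrable (fun s => inner ℝ (P s - c) (U s)) volume a b := by
    intro c a b
    rw [intervalIntegrable_iff]
    have hb := (isCompact_uIcc (a := a) (b := b)).exists_bound_of_continuousOn
      (f := fun s => P s - c) (by fun_prop)
    obtain ⟨D, hD⟩ := hb
    refine Integrable.mono' ((intervalIntegrable_iff.1 (hUi a b)).norm.const_mul D)
      (((hPc.sub continuous_const).aestronglyMeasurable).inner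
        (intervalIntegrable_iff.1 (hUi a b)).1) ?_
    filter_upwards [ae_restrict_mem measurableSet_uIoc] with s hs
    exact (norm_inner_le_norm _ _).trans
      (mul_le_mul_of_nonneg_right (hD s (uIoc_subset_uIcc hs)) (norm_nonneg _))
  have hEt : ∀ t ∈ Icc 0 T, ∀ᵐ s, s ∈ Icc 0 T → G s s = G t s + inner ℝ (P s - P t) (U s) := by
    intro t ht
    filter_upwards [hG] with s hs hsT
    rw [hs hsT s hsT, hs hsT t ht, inner_sub_left]
    ring
  have hGi : ∀ t ∈ Icc 0 T, ∀ a b, 0 ≤ a → a ≤ b → b ≤ T →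
      IntervalIntegrable (G t) volume a b := fun t ht a b ha hab hb =>
    ((hcont t ht).mono (by rw [uIcc_of_le hab]; exact Icc_subset_Icc ha hb)).intervalIntegrable
  have hEcongr : ∀ t ∈ Icc 0 T, ∀ a b, 0 ≤ a → a ≤ b → b ≤ T →
      (fun s => G t s + inner ℝ (P s - P t) (U s)) =ᵐ[volume.restrict (uIoc a b)]
        fun s => G s s := by
    intro t ht a b ha hab hb
    filter_upwards [ae_restrict_of_ae (hEt t ht), ae_restrict_mem measurableSet_uIoc] with s h3 h4
    rw [uIoc_of_le hab] at h4
    exact (h3 ⟨ha.trans h4.1.le, h4.2.trans hb⟩).symm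
  have hEi : ∀ a b, 0 ≤ a → a ≤ b → b ≤ T → IntervalIntegrable (fun s => G s s) volume a b := by
    intro a b ha hab hb
    exact ((hGi 0 hT0 a b ha hab hb).add (hPU (P 0) a b)).congr_ae (hEcongr 0 hT0 a b ha hab hb)
  -- Right averages of the energy converge at every time.
  have step1 : ∀ t, 0 ≤ t → t < T →
      Tendsto (fun h : ℝ => h⁻¹ * ∫ s in t..(t + h), G s s) (𝓝[>] 0) (𝓝 (G t t)) := by
    intro t ht htT
    have htm : t ∈ Icc 0 T := ⟨ht, htT.le⟩
    set m : ℝ → ℝ := fun s => ‖N s‖ + ‖U s‖ with hm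
    have hm2 : MemLp m 2 volume := hN.norm.add hU.norm
    have hmi : ∀ a b, IntervalIntegrable m volume a b := fun a b =>
      (hNi a b).norm.add (hUi a b).norm
    have hmsq : Integrable (fun s => m s ^ 2) := hm2.integrable_sq
    have A : Tendsto (fun h : ℝ => h⁻¹ * ∫ s in t..(t + h), G t s) (𝓝[>] 0) (𝓝 (G t t)) := by
      have hd : HasDerivWithinAt (fun x => ∫ s in t..x, G t s) (G t t) (Ici t) t := by
        have hcw : ContinuousWithinAt (G t) (Ici t) t := by
          refine (hcont t htm t htm).mono_of_mem_nhdsWithin ?_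
          filter_upwards [Icc_mem_nhdsGE htT] with x hx using ⟨ht.trans hx.1, hx.2⟩
        have hsm : StronglyMeasurableAtFilter (G t) (𝓝[>] t) volume := by
          refine ⟨Ioc t T, Ioc_mem_nhdsGT htT, ?_⟩
          have := (hGi t htm t T ht htT.le le_rfl)
          rw [intervalIntegrable_iff_integrableOn_Ioc_of_le htT.le] at this
          exact this.1
        exact intervalIntegral.integral_hasDerivWithinAt_right (by simp)
          hsm (hcw.mono Ioi_subset_Ici_self)
      have h3 := hasDerivWithinAt_iff_tendsto_slope.1 hd
      have h4 : Tendsto (fun h : ℝ => t + h) (𝓝[>] 0) (𝓝[Ici t \ {t}] t) := by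
        refine tendsto_nhdsWithin_iff.2 ⟨?_, ?_⟩
        · have : Tendsto (fun h : ℝ => t + h) (𝓝 0) (𝓝 (t + 0)) := by
            exact (continuous_const.add continuous_id).tendsto 0
          rw [add_zero] at this
          exact this.mono_left nhdsWithin_le_nhds
        · filter_upwards [self_mem_nhdsWithin] with h hh
          simp only [mem_Ioi] at hh
          simpa using hh
      refine (h3.comp h4).congr fun h => ?_
      simp [slope]
    have B : Tendsto (fun h : ℝ => h⁻¹ * ∫ s in t..(t + h), inner ℝ (P s - P t) (U s)) (𝓝[>] 0)
        (𝓝 0) := by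
      have hlim : Tendsto (fun h : ℝ => ∫ s in t..(t + h), m s ^ 2) (𝓝[>] 0) (𝓝 0) := by
        have hc := intervalIntegral.continuous_primitive (μ := volume) (f := fun s => m s ^ 2)
          (fun a b => hmsq.intervalIntegrable) t
        have := (hc.comp (by fun_prop : Continuous fun h : ℝ => t + h)).tendsto (0 : ℝ)
        simp only [Function.comp_def, add_zero, intervalIntegral.integral_same] at this
        exact this.mono_left nhdsWithin_le_nhds
      refine squeeze_zero_norm' ?_ hlim
      filter_upwards [self_mem_nhdsWithin] with h hh
      have hh0 : (0 : ℝ) < h := hh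
      have hle : t ≤ t + h := by linarith
      have hM : ∀ s ∈ Icc t (t + h), ‖P s - P t‖ ≤ ∫ r in t..(t + h), m r := by
        intro s hs
        have e : P s - P t = ∫ r in t..s, N r := by
          simp only [hP]
          rw [intervalIntegral.integral_interval_sub_left (hNi _ _) (hNi _ _)]
        rw [e]
        refine (intervalIntegral.norm_integral_le_integral_norm hs.1).trans ?_
        refine (intervalIntegral.integral_mono_on hs.1 (hNi _ _).norm (hmi _ _)
          (fun r _ => by simp [hm])).trans ?_
        refine intervalIntegral.integral_mono_interval le_rfl hs.1 hs.2
          (Eventually.of_forall fun r => by simp only [hm, Pi.zero_apply]; positivity) (hmi _ _)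
      have hI0 : 0 ≤ ∫ r in t..(t + h), m r :=
        intervalIntegral.integral_nonneg hle fun r _ => by simp only [hm]; positivity
      have hb : ‖∫ s in t..(t + h), inner ℝ (P s - P t) (U s)‖ ≤ (∫ r in t..(t + h), m r) ^ 2 := by
        refine (intervalIntegral.norm_integral_le_integral_norm hle).trans ?_
        rw [sq, ← intervalIntegral.integral_const_mul]
        refine intervalIntegral.integral_mono_on hle (hPU _ _ _).norm ((hmi _ _).const_mul _) ?_
        intro s hs
        refine (norm_inner_le_norm _ _).trans (mul_le_mul (hM s hs) ?_ (norm_nonneg _) hI0)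
        simp [hm]
      have hcs : (∫ r in t..(t + h), m r) ^ 2 ≤ h * ∫ s in t..(t + h), m s ^ 2 := by
        simpa using sq_integral_le hle (hmi _ _) hmsq.intervalIntegrable
      rw [norm_mul, norm_inv, Real.norm_of_nonneg hh0.le, inv_mul_le_iff₀ hh0]
      exact hb.trans hcs
    have C := A.add B
    rw [add_zero] at C
    refine C.congr' ?_
    filter_upwards [Ioc_mem_nhdsGT (sub_pos.2 htT)] with h hh
    have hle : t ≤ t + h := by linarith [hh.1]
    have hTh : t + h ≤ T := by linarith [hh.2]
    rw [← mul_add, ← intervalIntegral.integral_add (hGi t htm _ _ ht hle hTh) (hPU _ _ _)]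
    congr 1
    exact intervalIntegral.integral_congr_ae_restrict (hEcongr t htm _ _ ht hle hTh)
  have lhs := (step1 t₂ (h1.trans h12) h2).sub (step1 t₁ h1 (h12.trans_lt h2))
  -- The difference of the two averages is the integral over `[t₁, t₂]` of a difference quotient of
  -- the energy, which is the product of a Steklov average of `N` with `U (t + h) + U t`.
  have hshift : ∀ h : ℝ, MemLp (fun t => U (t + h)) 2 volume := fun h =>
    hU.comp_measurePreserving (measurePreserving_add_right volume h)
  have sA : ∀ h : ℝ, MemLp (shiftAvg (volume.restrict (Icc (0 : ℝ) 1))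
      (fun r => h * r) (fun _ => (1 : ℝ)) N) 2 volume := fun h =>
    memLp_shiftAvg (C := 1) (by fun_prop) measurable_const (fun _ => by simp) hN
  have rhs : Tendsto (fun h : ℝ => ∫ t in Ioc t₁ t₂, inner ℝ
      (shiftAvg (volume.restrict (Icc (0 : ℝ) 1)) (fun r => h * r) (fun _ => (1 : ℝ)) N t)
      (U (t + h) + U t)) (𝓝 0) (𝓝 (∫ t in Ioc t₁ t₂, inner ℝ (N t) (U t + U t))) := by
    have mono : ∀ {ι : Type} {l : Filter ι} {f : ι → ℝ → H},
        Tendsto (fun n => eLpNorm (f n) 2 volume) l (𝓝 0) →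
        Tendsto (fun n => eLpNorm (f n) 2 (volume.restrict (Ioc t₁ t₂))) l (𝓝 0) :=
      fun ht => tendsto_of_tendsto_of_tendsto_of_le_of_le tendsto_const_nhds ht
        (fun _ => zero_le) fun n => eLpNorm_mono_measure _ Measure.restrict_le_self
    refine tendsto_integral_inner (fun h => (sA h).restrict _)
      (fun h => ((hshift h).add hU).restrict _) (hN.restrict _) ((hU.add hU).restrict _)
      (mono (tendsto_steklov hN)) (mono ?_)
    refine (tendsto_eLpNorm_shift_sub hU).congr fun h => ?_
    congr 1; ext t; simp
  have rhs' := rhs.mono_left (nhdsWithin_le_nhds (s := Ioi 0))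
  have e2 : ∫ t in Ioc t₁ t₂, inner ℝ (N t) (U t + U t) =
      2 * ∫ τ in t₁..t₂, inner ℝ (N τ) (U τ) := by
    rw [intervalIntegral.integral_of_le h12, ← integral_const_mul]
    congr 1; ext t; rw [inner_add_right]; ring
  rw [e2] at rhs'
  refine tendsto_nhds_unique lhs (rhs'.congr' ?_)
  filter_upwards [Ioc_mem_nhdsGT (sub_pos.2 h2)] with h hh
  have hh0 : 0 < h := hh.1
  have hTh : t₂ + h ≤ T := by linarith [hh.2]
  have e3 : (∫ s in t₂..(t₂ + h), G s s) - ∫ s in t₁..(t₁ + h), G s s =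
      ∫ t in t₁..t₂, (G (t + h) (t + h) - G t t) := by
    have i1 := hEi t₁ t₂ h1 h12 h2.le
    have i2 := hEi t₂ (t₂ + h) (h1.trans h12) (by linarith) hTh
    have i3 := hEi t₁ (t₁ + h) h1 (by linarith) (by linarith)
    have i4 := hEi (t₁ + h) (t₂ + h) (by linarith) (by linarith) hTh
    have i5 : IntervalIntegrable (fun t => G (t + h) (t + h)) volume t₁ t₂ := by
      have := i4.comp_add_right h
      simpa using this
    rw [intervalIntegral.integral_sub i5 i1,
      intervalIntegral.integral_comp_add_right (fun t => G t t)]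
    have a1 := intervalIntegral.integral_add_adjacent_intervals i1 i2
    have a2 := intervalIntegral.integral_add_adjacent_intervals i3 i4
    linarith
  rw [← mul_sub, e3, intervalIntegral.integral_of_le h12, ← integral_const_mul]
  apply integral_congr_ae
  have hGh : ∀ᵐ t, t + h ∈ Icc 0 T → ∀ r ∈ Icc 0 T,
      G r (t + h) = G 0 (t + h) + inner ℝ (P r) (U (t + h)) :=
    (measurePreserving_add_right volume h).quasiMeasurePreserving.ae hG
  filter_upwards [ae_restrict_of_ae hG, ae_restrict_of_ae hGh, ae_restrict_mem measurableSet_Ioc]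
    with t g1 g2 ht
  have m1 : t ∈ Icc 0 T := ⟨h1.trans ht.1.le, by linarith [ht.2]⟩
  have m2 : t + h ∈ Icc 0 T := ⟨by linarith [m1.1], by linarith [ht.2]⟩
  have q1 := g2 m2 (t + h) m2
  have q2 := g2 m2 t m1
  have q3 := g1 m1 (t + h) m2
  have q4 := g1 m1 t m1
  have q5 := hsymm t m1 (t + h) m2
  have e4 : h • shiftAvg (volume.restrict (Icc (0 : ℝ) 1)) (fun r => h * r) (fun _ => (1 : ℝ)) N t =
      P (t + h) - P t := by
    simp only [hP]
    rw [intervalIntegral.integral_interval_sub_left (hNi _ _) (hNi _ _)]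
    have := intervalIntegral.smul_integral_comp_add_mul (a := 0) (b := 1) N h t
    simp only [mul_zero, add_zero, mul_one] at this
    rw [← this, shiftAvg, intervalIntegral.integral_of_le zero_le_one,
      integral_Icc_eq_integral_Ioc]
    simp
  have e5 : G (t + h) (t + h) - G t t = inner ℝ (P (t + h) - P t) (U (t + h) + U t) := by
    simp only [inner_sub_left, inner_add_right]
    simp only [hP] at *
    linarith
  rw [e5, ← e4, real_inner_smul_left]
  field_simp

end Energy

/-! ### Smooth fields are dense among the divergence-free fields in `H¹` -/

lemma partialDeriv_eqOn {θ χ : Plane → ℝ} {U : Set Plane} (hU : IsOpen U)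
    (h : ∀ x ∈ U, θ x = χ x) (j : Fin 2) : ∀ x ∈ U, partialDeriv θ j x = partialDeriv χ j x := by
  intro x hx
  have : θ =ᶠ[𝓝 x] χ := by
    filter_upwards [hU.mem_nhds hx] with y hy using h y hy
  rw [partialDeriv, partialDeriv, this.fderiv_eq]

lemma partialDeriv_zero (j : Fin 2) (x : Plane) : partialDeriv (fun _ => (0 : ℝ)) j x = 0 := by
  simp [partialDeriv]

lemma partialDeriv_sum {s : Finset ℕ} {Ψ : ℕ → Plane → ℝ} (h : ∀ k, ContDiff ℝ ∞ (Ψ k))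
    (j : Fin 2) (x : Plane) :
    partialDeriv (fun y => ∑ k ∈ s, Ψ k y) j x = ∑ k ∈ s, partialDeriv (Ψ k) j x := by
  rw [partialDeriv, fderiv_fun_sum fun k _ => (h k).differentiable (by simp) x]
  simp [partialDeriv]

/-- A localised potential `χ ψ` is replaced by a smooth one; the error in the gradient, multiplied
by the weight `a`, is small in `H¹`. The derivatives of `a` need not be bounded. -/
lemma exists_smooth_potential_local {a ψ χ : Plane → ℝ} {R : Fin 2 → Plane → ℝ}
    {R' : Fin 2 → Fin 2 → Plane → ℝ} (ha : ContDiff ℝ ∞ a) (hψ : IsH1 ψ R)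
    (hR : ∀ j, IsWeakGrad (R j) (R' j))
    (hR2 : ∀ j l (θ : Plane → ℝ), ContDiff ℝ ∞ θ → HasCompactSupport θ →
      MemLp (fun x => θ x * R' j l x) 2 volume)
    (hχ : ContDiff ℝ ∞ χ) (hχc : HasCompactSupport χ) {δ : ℝ} (hδ : 0 < δ) :
    ∃ Ψ : Plane → ℝ, ContDiff ℝ ∞ Ψ ∧ (∀ x, (∀ z, dist z x ≤ 1 → χ z = 0) → Ψ x = 0) ∧
      ∀ j, AEStronglyMeasurable (fun x => a x * (partialDeriv Ψ j x -
          (χ x * R j x + partialDeriv χ j x * ψ x))) volume ∧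
        eLpNorm (fun x => a x * (partialDeriv Ψ j x - (χ x * R j x + partialDeriv χ j x * ψ x)))
          2 volume ≤ ENNReal.ofReal δ ∧
        ∀ l, AEStronglyMeasurable (fun x => a x * (partialDeriv (partialDeriv Ψ j) l x -
            ((χ x * R' j l x + partialDeriv χ l x * R j x) +
              (partialDeriv χ j x * R l x + partialDeriv (partialDeriv χ j) l x * ψ x))) +
            partialDeriv a l x * (partialDeriv Ψ j x -
              (χ x * R j x + partialDeriv χ j x * ψ x))) volume ∧
          eLpNorm (fun x => a x * (partialDeriv (partialDeriv Ψ j) l x -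
            ((χ x * R' j l x + partialDeriv χ l x * R j x) +
              (partialDeriv χ j x * R l x + partialDeriv (partialDeriv χ j) l x * ψ x))) +
            partialDeriv a l x * (partialDeriv Ψ j x -
              (χ x * R j x + partialDeriv χ j x * ψ x))) 2 volume ≤ ENNReal.ofReal δ := by
  have hdχ := contDiff_partialDeriv hχ
  have hdχc := hasCompactSupport_partialDeriv hχc
  have hddχ := fun j => contDiff_partialDeriv (hdχ j)
  have hddχc := fun j => hasCompactSupport_partialDeriv (hdχc j)
  have hb : ∀ {f g : Plane → ℝ}, ContDiff ℝ ∞ g → HasCompactSupport g → MemLp f 2 volume →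
      MemLp (fun x => g x * f x) 2 volume := by
    intro f g hg hgc hf
    obtain ⟨D, -, hD⟩ := exists_bound_of_hasCompactSupport hg.continuous hgc
    exact memLp_bounded_mul hg.continuous.aestronglyMeasurable hD hf
  set A : Fin 2 → Plane → ℝ := fun j x => χ x * R j x + partialDeriv χ j x * ψ x with hA
  set B : Fin 2 → Fin 2 → Plane → ℝ := fun j l x => (χ x * R' j l x + partialDeriv χ l x * R j x) +
    (partialDeriv χ j x * R l x + partialDeriv (partialDeriv χ j) l x * ψ x) with hB
  have hA2 : ∀ j, MemLp (A j) 2 volume := fun j =>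
    (hb hχ hχc (hψ.grad_memLp j)).add (hb (hdχ j) (hdχc j) hψ.memLp)
  have h1 : IsH1 (fun x => χ x * ψ x) A := ⟨hb hχ hχc hψ.memLp, hA2, hψ.weak.mul_smooth hχ⟩
  have h2 : ∀ j, IsH1 (A j) (B j) := fun j => ⟨hA2 j, fun l =>
    ((hR2 j l χ hχ hχc).add (hb (hdχ l) (hdχc l) (hψ.grad_memLp j))).add
      ((hb (hdχ j) (hdχc j) (hψ.grad_memLp l)).add (hb (hddχ j l) (hddχc j l) hψ.memLp)),
    ((hR j).mul_smooth hχ).add (hψ.weak.mul_smooth (hdχ j))⟩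
  -- All functions below vanish off the compact set `K`, where `a` and its derivatives are bounded.
  set K := Metric.cthickening 1 (tsupport χ) with hK
  have hKc : IsCompact K := hχc.isCompact.cthickening
  have hχ0 : ∀ x ∈ Kᶜ, χ x = 0 := fun x hx => by
    by_contra h
    exact hx (Metric.self_subset_cthickening _ (subset_tsupport _ h))
  obtain ⟨D, hD0, hDa, hDd⟩ : ∃ D : ℝ, 0 ≤ D ∧ (∀ x ∈ K, |a x| ≤ D) ∧
      ∀ l, ∀ x ∈ K, |partialDeriv a l x| ≤ D := by
    obtain ⟨d, hd⟩ := hKc.exists_bound_of_continuousOn ha.continuous.continuousOn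
    have := fun l => hKc.exists_bound_of_continuousOn
      (contDiff_partialDeriv ha l).continuous.continuousOn
    choose e he using this
    refine ⟨|d| + (|e 0| + |e 1|), by positivity, fun x hx => ?_, fun l x hx => ?_⟩
    · have := hd x hx
      have h3 := le_abs_self d
      have h4 := abs_nonneg (e 0)
      have h5 := abs_nonneg (e 1)
      rw [Real.norm_eq_abs] at this
      linarith
    · have := he l x hx
      have h3 := le_abs_self (e l)
      have h4 := abs_nonneg (e 0)
      have h5 := abs_nonneg (e 1)
      have h6 := abs_nonneg d
      rw [Real.norm_eq_abs] at this
      fin_cases l <;> simp only [Fin.zero_eta, Fin.mk_one] at * <;> linarith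
  set δ' := δ / (2 * (D + 1)) with hδ'
  have hδ'0 : 0 < δ' := by positivity
  have hDδ : D * δ' + D * δ' ≤ δ := by
    have : δ = 2 * (D + 1) * δ' := by rw [hδ']; field_simp
    nlinarith
  have hp : 0 < ENNReal.ofReal δ' := ENNReal.ofReal_pos.2 hδ'0
  have t0 := fun j => ENNReal.tendsto_nhds_zero.1 (tendsto_moll (hA2 j)) _ hp
  have t1 := fun j l => ENNReal.tendsto_nhds_zero.1 (tendsto_moll ((h2 j).grad_memLp l)) _ hp
  have := ((eventually_all.2 t0).and
    (eventually_all.2 fun j => eventually_all.2 (t1 j))).filter_mono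
      (nhdsWithin_le_nhds (s := Ioi 0))
  obtain ⟨ε, hε, hε0⟩ := (this.and (Ioc_mem_nhdsGT (zero_lt_one' ℝ))).exists
  set Ψ := moll ε (fun x => χ x * ψ x)
  have hΨ : ContDiff ℝ ∞ Ψ := contDiff_moll hε0.1 h1.weak.locInt
  have hΨ0 : ∀ x, (∀ z, dist z x ≤ 1 → χ z = 0) → Ψ x = 0 := fun x hx =>
    moll_eq_zero hε0.1.le fun z hz => by rw [hx z (hz.trans hε0.2), zero_mul]
  have w1 : ∀ j, partialDeriv Ψ j =ᵐ[volume] moll ε (A j) := fun j =>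
    (IsWeakGrad.of_contDiff hΨ).unique (h1.mollify ε).weak j
  have w2 : ∀ j l, partialDeriv (partialDeriv Ψ j) l =ᵐ[volume] moll ε (B j l) := fun j l =>
    ((IsWeakGrad.of_contDiff (contDiff_partialDeriv hΨ j)).congr (w1 j)
      fun _ => EventuallyEq.rfl).unique ((h2 j).mollify ε).weak l
  have hKo : IsOpen Kᶜ := Metric.isClosed_cthickening.isOpen_compl
  have hΨK : ∀ x ∈ Kᶜ, Ψ x = 0 := fun x hx => hΨ0 x fun z hz => by
    by_contra h
    refine hx (Metric.mem_cthickening_of_dist_le x z 1 _ (subset_tsupport _ h) ?_)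
    rwa [dist_comm]
  have dz : ∀ {θ : Plane → ℝ}, (∀ x ∈ Kᶜ, θ x = 0) → ∀ l, ∀ x ∈ Kᶜ, partialDeriv θ l x = 0 :=
    fun h l x hx => (partialDeriv_eqOn hKo h l x hx).trans (partialDeriv_zero l x)
  have key : ∀ {f g : Plane → ℝ}, (∀ x ∈ K, |g x| ≤ D) → (∀ x ∈ Kᶜ, f x = 0) →
      eLpNorm f 2 volume ≤ ENNReal.ofReal δ' →
      eLpNorm (fun x => g x * f x) 2 volume ≤ ENNReal.ofReal (D * δ') := by
    intro f g hg hf hfδ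
    have : ∀ᵐ x, ‖g x * f x‖ ≤ D * ‖f x‖ := by
      refine Eventually.of_forall fun x => ?_
      by_cases hx : x ∈ K
      · rw [norm_mul]
        exact mul_le_mul_of_nonneg_right (hg x hx) (norm_nonneg _)
      · rw [hf x hx]; simp
    refine (eLpNorm_le_mul_eLpNorm_of_ae_le_mul this 2).trans ?_
    rw [ENNReal.ofReal_mul hD0]
    exact mul_le_mul_right hfδ _
  have e1 : ∀ j, eLpNorm (fun x => partialDeriv Ψ j x - A j x) 2 volume ≤ ENNReal.ofReal δ' := by
    intro j
    refine le_trans (eLpNorm_congr_ae ?_).le (hε.1 j)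
    filter_upwards [w1 j] with x hx
    rw [hx]
  have e2 : ∀ j l, eLpNorm (fun x => partialDeriv (partialDeriv Ψ j) l x - B j l x) 2 volume ≤
      ENNReal.ofReal δ' := by
    intro j l
    refine le_trans (eLpNorm_congr_ae ?_).le (hε.2 j l)
    filter_upwards [w2 j l] with x hx
    rw [hx]
  have z1 : ∀ j, ∀ x ∈ Kᶜ, partialDeriv Ψ j x - A j x = 0 := fun j x hx => by
    simp only [hA, dz hΨK j x hx, hχ0 x hx, dz hχ0 j x hx]
    simp
  have z2 : ∀ j l, ∀ x ∈ Kᶜ, partialDeriv (partialDeriv Ψ j) l x - B j l x = 0 := fun j l x hx => by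
    simp only [hB, dz (dz hΨK j) l x hx, hχ0 x hx, dz hχ0 j x hx, dz hχ0 l x hx,
      dz (dz hχ0 j) l x hx]
    simp
  have k1 := fun j => key hDa (z1 j) (e1 j)
  have k2 := fun j l => key hDa (z2 j l) (e2 j l)
  have k3 := fun j l => key (hDd l) (z1 j) (e1 j)
  have m1 : ∀ j, AEStronglyMeasurable (fun x => partialDeriv Ψ j x - A j x) volume := fun j =>
    (contDiff_partialDeriv hΨ j).continuous.aestronglyMeasurable.sub (hA2 j).1
  have m2 : ∀ j l, AEStronglyMeasurable (fun x => partialDeriv (partialDeriv Ψ j) l x - B j l x)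
      volume := fun j l => (contDiff_partialDeriv (contDiff_partialDeriv hΨ j) l).continuous
        |>.aestronglyMeasurable.sub ((h2 j).grad_memLp l).1
  have n1 := fun j => ha.continuous.aestronglyMeasurable.mul (m1 j)
  have n2 := fun j l => ha.continuous.aestronglyMeasurable.mul (m2 j l)
  have n3 := fun j l => (contDiff_partialDeriv ha l).continuous.aestronglyMeasurable.mul (m1 j)
  refine ⟨Ψ, hΨ, hΨ0, fun j => ⟨n1 j, (k1 j).trans (ENNReal.ofReal_le_ofReal ?_), fun l =>
    ⟨(n2 j l).add (n3 j l), ?_⟩⟩⟩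
  · have := mul_nonneg hD0 hδ'0.le
    linarith
  · refine (eLpNorm_add_le (n2 j l) (n3 j l) (by norm_num)).trans
      ((add_le_add (k2 j l) (k3 j l)).trans ?_)
    rw [← ENNReal.ofReal_add (by positivity) (by positivity)]
    exact ENNReal.ofReal_le_ofReal hDδ

/-- A locally finite sum of smooth functions is smooth. -/
lemma exists_smooth_sum {Ψ : ℕ → Plane → ℝ} (h : ∀ k, ContDiff ℝ ∞ (Ψ k))
    (h0 : ∀ (k : ℕ) (x : Plane), ‖x‖ + 1 < k → Ψ k x = 0) :
    ∃ Φ : Plane → ℝ, ContDiff ℝ ∞ Φ ∧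
      ∀ n : ℕ, ∀ x ∈ Metric.ball (0 : Plane) n, Φ x = ∑ k ∈ Finset.range (n + 2), Ψ k x := by
  have hs : ∀ x : Plane, ∀ m n : ℕ, ‖x‖ < m → ‖x‖ < n →
      ∑ k ∈ Finset.range (m + 2), Ψ k x = ∑ k ∈ Finset.range (n + 2), Ψ k x := by
    have : ∀ x : Plane, ∀ m n : ℕ, ‖x‖ < m → m ≤ n →
      ∑ k ∈ Finset.range (m + 2), Ψ k x = ∑ k ∈ Finset.range (n + 2), Ψ k x := by
      intro x m n hm hmn
      refine Finset.sum_subset (Finset.range_mono (by omega)) fun k _ hk => h0 k x ?_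
      have : m + 2 ≤ k := by simpa using hk
      have : ((m + 2 : ℕ) : ℝ) ≤ k := by exact_mod_cast this
      push_cast at this
      linarith
    intro x m n hm hn
    rcases le_total m n with hmn | hmn
    · exact this x m n hm hmn
    · exact (this x n m hn hmn).symm
  have hex : ∀ x : Plane, ‖x‖ < ((⌈‖x‖⌉₊ + 1 : ℕ) : ℝ) := fun x => by
    push_cast
    linarith [Nat.le_ceil ‖x‖]
  refine ⟨fun x => ∑ k ∈ Finset.range ((⌈‖x‖⌉₊ + 1) + 2), Ψ k x, ?_, fun n x hx =>
    hs x _ n (hex x) (by simpa using hx)⟩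
  refine contDiff_iff_contDiffAt.2 fun x => ?_
  have hc : ContDiff ℝ ∞ (fun y => ∑ k ∈ Finset.range ((⌈‖x‖⌉₊ + 1) + 2), Ψ k y) :=
    ContDiff.sum fun k _ => h k
  refine hc.contDiffAt.congr_of_eventuallyEq ?_
  filter_upwards [Metric.isOpen_ball.mem_nhds
    (show x ∈ Metric.ball (0 : Plane) ((⌈‖x‖⌉₊ + 1 : ℕ) : ℝ) by simpa using hex x)] with y hy
  exact hs y _ _ (hex y) (by simpa using hy)

lemma eLpNorm_le_of_forall_ball {f : Plane → ℝ} {c : ℝ≥0∞}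
    (h : ∀ n : ℕ, eLpNorm f 2 (volume.restrict (Metric.ball 0 n)) ≤ c) :
    eLpNorm f 2 volume ≤ c := by
  have e : ∀ m : Measure Plane, eLpNorm f 2 m = (∫⁻ x, ‖f x‖ₑ ^ 2 ∂m) ^ (1 / 2 : ℝ) := by
    intro m
    simp [eLpNorm_eq_lintegral_rpow_enorm_toReal (p := 2) (by norm_num) (by norm_num)]
  have h1 : ∀ n : ℕ, ∫⁻ x in Metric.ball (0 : Plane) n, ‖f x‖ₑ ^ 2 ≤ c ^ 2 := by
    intro n
    have := h n
    rw [e] at this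
    have h3 := pow_le_pow_left' this 2
    rwa [← ENNReal.rpow_natCast, ← ENNReal.rpow_mul,
      show (1 / 2 : ℝ) * ((2 : ℕ) : ℝ) = 1 by norm_num, ENNReal.rpow_one] at h3
  have h2 : ∫⁻ x, ‖f x‖ₑ ^ 2 ≤ c ^ 2 := by
    rw [← setLIntegral_univ, ← Metric.iUnion_ball_nat (0 : Plane), setLIntegral_iUnion_of_directed]
    · exact iSup_le h1
    · exact (monotone_nat_of_le_succ fun n => Metric.ball_subset_ball (by simp)).directed_le
  rw [e]
  refine (ENNReal.rpow_le_rpow h2 (by norm_num)).trans ?_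
  rw [← ENNReal.rpow_natCast, ← ENNReal.rpow_mul, show ((2 : ℕ) : ℝ) * (1 / 2 : ℝ) = 1 by norm_num,
      ENNReal.rpow_one]

/-- If, on every ball, `F` is a finite sum of functions whose norms are bounded by the terms of a
series of sum `δ`, then the norm of `F` is at most `δ`. -/
lemma eLpNorm_le_of_local_sum {F : Plane → ℝ} {f : ℕ → Plane → ℝ} {δ : ℝ} (hδ : 0 < δ)
    (hm : ∀ k, AEStronglyMeasurable (f k) volume)
    (hf : ∀ k, eLpNorm (f k) 2 volume ≤ ENNReal.ofReal (δ / 2 / 2 ^ k))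
    (hF : ∀ n : ℕ, ∀ x ∈ Metric.ball (0 : Plane) n, F x = ∑ k ∈ Finset.range (n + 2), f k x) :
    eLpNorm F 2 volume ≤ ENNReal.ofReal δ := by
  refine eLpNorm_le_of_forall_ball fun n => ?_
  have e : F =ᵐ[volume.restrict (Metric.ball 0 n)] ∑ k ∈ Finset.range (n + 2), f k := by
    filter_upwards [ae_restrict_mem Metric.isOpen_ball.measurableSet] with x hx
    rw [hF n x hx, Finset.sum_apply]
  rw [eLpNorm_congr_ae e]
  refine (eLpNorm_mono_measure _ Measure.restrict_le_self).trans ?_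
  refine (eLpNorm_sum_le (fun k _ => hm k) (by norm_num)).trans ?_
  refine (Finset.sum_le_sum fun k _ => hf k).trans ?_
  rw [← ENNReal.ofReal_sum_of_nonneg fun k _ => by positivity]
  refine ENNReal.ofReal_le_ofReal ?_
  have hs := hasSum_geometric_two' δ
  exact (hs.summable.sum_le_tsum _ fun k _ => by positivity).trans hs.tsum_eq.le

/-- A global version of `exists_smooth_potential_local`, by a partition of unity. -/
lemma exists_smooth_potential {a ψ : Plane → ℝ} {R : Fin 2 → Plane → ℝ}
    {R' : Fin 2 → Fin 2 → Plane → ℝ} (ha : ContDiff ℝ ∞ a) (hψ : IsH1 ψ R)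
    (hR : ∀ j, IsWeakGrad (R j) (R' j))
    (hR2 : ∀ j l (θ : Plane → ℝ), ContDiff ℝ ∞ θ → HasCompactSupport θ →
      MemLp (fun x => θ x * R' j l x) 2 volume) {δ : ℝ} (hδ : 0 < δ) :
    ∃ Φ : Plane → ℝ, ContDiff ℝ ∞ Φ ∧ ∀ j,
      eLpNorm (fun x => a x * (partialDeriv Φ j x - R j x)) 2 volume ≤ ENNReal.ofReal δ ∧
      ∀ l, eLpNorm (fun x => a x * (partialDeriv (partialDeriv Φ j) l x - R' j l x) +
        partialDeriv a l x * (partialDeriv Φ j x - R j x)) 2 volume ≤ ENNReal.ofReal δ := by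
  -- The cutoff `β k` is one on the ball of radius `k`; the shells `χ k` add up to one.
  let β : ℕ → ContDiffBump (0 : Plane) := fun k =>
    ⟨k + 1, k + 2, by positivity, by linarith⟩
  let χ : ℕ → Plane → ℝ := fun k => if k = 0 then β 0 else fun x => β k x - β (k - 1) x
  have hχ : ∀ k, ContDiff ℝ ∞ (χ k) := by
    intro k
    by_cases hk : k = 0
    · simp only [χ, hk, if_true]; exact (β 0).contDiff
    · simp only [χ, hk, if_false]; exact (β k).contDiff.sub (β _).contDiff
  have hχc : ∀ k, HasCompactSupport (χ k) := by
    intro k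
    by_cases hk : k = 0
    · simp only [χ, hk, if_true]; exact (β 0).hasCompactSupport
    · simp only [χ, hk, if_false]
      exact (β k).hasCompactSupport.sub (β _).hasCompactSupport
  have hβ1 : ∀ (k : ℕ) (x : Plane), ‖x‖ ≤ k + 1 → β k x = 1 := fun k x hx =>
    (β k).one_of_mem_closedBall (by simpa [β] using hx)
  have hχ0 : ∀ (k : ℕ) (z : Plane), ‖z‖ < k → χ k z = 0 := by
    intro k z hz
    have hk : k ≠ 0 := by
      rintro rfl
      simp only [CharP.cast_eq_zero] at hz
      exact absurd hz (not_lt.2 (norm_nonneg _))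
    obtain ⟨m, rfl⟩ := Nat.exists_eq_succ_of_ne_zero hk
    push_cast at hz
    simp only [χ, hk, if_false]
    rw [hβ1 _ z (by push_cast; linarith), hβ1 _ z (by simpa using hz.le), sub_self]
  have hsum : ∀ (n : ℕ) x, ∑ k ∈ Finset.range (n + 1), χ k x = β n x := by
    intro n x
    induction n with
    | zero => simp [χ]
    | succ n ih =>
      rw [Finset.sum_range_succ, ih]
      simp [χ]
  have hpos : ∀ k : ℕ, 0 < δ / 2 / 2 ^ k := fun k => by positivity
  choose Ψ hΨ hΨ0 hj using fun k =>
    exists_smooth_potential_local ha hψ hR hR2 (hχ k) (hχc k) (hpos k)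
  obtain ⟨Φ, hΦ, hΦs⟩ := exists_smooth_sum hΨ (fun k x hx => hΨ0 k x fun z hz => hχ0 k z (by
    have := norm_le_norm_add_norm_sub' z x
    rw [← dist_eq_norm] at this
    linarith))
  have s0 : ∀ n : ℕ, ∀ x ∈ Metric.ball (0 : Plane) n, ∑ k ∈ Finset.range (n + 2), χ k x = 1 := by
    intro n x hx
    have hx' : ‖x‖ < n := by simpa using hx
    rw [hsum (n + 1), hβ1 _ x (by push_cast; linarith)]
  have s1 : ∀ n : ℕ, ∀ j, ∀ x ∈ Metric.ball (0 : Plane) n,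
      ∑ k ∈ Finset.range (n + 2), partialDeriv (χ k) j x = 0 := by
    intro n j x hx
    rw [← partialDeriv_sum hχ, partialDeriv_eqOn Metric.isOpen_ball (s0 n) j x hx]
    simp [partialDeriv]
  have s2 : ∀ n : ℕ, ∀ j l, ∀ x ∈ Metric.ball (0 : Plane) n,
      ∑ k ∈ Finset.range (n + 2), partialDeriv (partialDeriv (χ k) j) l x = 0 := by
    intro n j l x hx
    rw [← partialDeriv_sum fun k => contDiff_partialDeriv (hχ k) j,
      partialDeriv_eqOn Metric.isOpen_ball (s1 n j) l x hx, partialDeriv_zero]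
  have p1 : ∀ n : ℕ, ∀ j, ∀ x ∈ Metric.ball (0 : Plane) n,
      partialDeriv Φ j x = ∑ k ∈ Finset.range (n + 2), partialDeriv (Ψ k) j x := by
    intro n j x hx
    rw [partialDeriv_eqOn Metric.isOpen_ball (hΦs n) j x hx, partialDeriv_sum hΨ]
  have p2 : ∀ n : ℕ, ∀ j l, ∀ x ∈ Metric.ball (0 : Plane) n, partialDeriv (partialDeriv Φ j) l x =
      ∑ k ∈ Finset.range (n + 2), partialDeriv (partialDeriv (Ψ k) j) l x := by
    intro n j l x hx
    rw [partialDeriv_eqOn Metric.isOpen_ball (p1 n j) l x hx,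
      partialDeriv_sum fun k => contDiff_partialDeriv (hΨ k) j]
  refine ⟨Φ, hΦ, fun j => ⟨?_, fun l => ?_⟩⟩
  · refine eLpNorm_le_of_local_sum hδ (fun k => (hj k j).1) (fun k => (hj k j).2.1)
      fun n x hx => ?_
    rw [← Finset.mul_sum, Finset.sum_sub_distrib, Finset.sum_add_distrib, ← Finset.sum_mul,
      ← Finset.sum_mul, s0 n x hx, s1 n j x hx, p1 n j x hx]
    ring
  · refine eLpNorm_le_of_local_sum hδ (fun k => ((hj k j).2.2 l).1) (fun k => ((hj k j).2.2 l).2)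
      fun n x hx => ?_
    simp only [Finset.sum_add_distrib, ← Finset.mul_sum, Finset.sum_sub_distrib, ← Finset.sum_mul,
      s0 n x hx, s1 n _ x hx, s2 n j l x hx, p1 n j x hx, p2 n j l x hx]
    ring

/-- Smooth fields are dense in the space `V` of the divergence-free fields of class `H¹`.  The
gradient of `b` may be unbounded, so that a mollification of `b v` with a fixed scale, divided by
`b`, need not be in `H¹`.  Only the rotated gradient which is the difference of `b v` and its
mollification is smoothed, with a scale that varies in space. -/
lemma exists_smooth_divFree_approx {b : Plane → ℝ} {b_i b_s : ℝ} (hb_i : 0 < b_i)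
    (hb : ContDiff ℝ ∞ b) (hbb : ∀ x, b_i ≤ b x ∧ b x ≤ b_s) {v : Plane → Plane}
    {G : Fin 2 → Fin 2 → Plane → ℝ} (hv : ∀ i, IsH1 (fun x => v x i) (G i))
    (hdiv : WeightedDivFree b v) {δ : ℝ} (hδ : 0 < δ) :
    ∃ φ : Plane → Plane, ContDiff ℝ ∞ φ ∧ WeightedDivFree b φ ∧
      ∀ i, IsH1 (fun x => φ x i) (grad φ i) ∧
        eLpNorm (fun x => φ x i - v x i) 2 volume ≤ ENNReal.ofReal δ ∧
        ∀ j, eLpNorm (fun x => grad φ i j x - G i j x) 2 volume ≤ ENNReal.ofReal δ := by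
  have hb0 : ∀ x, b x ≠ 0 := fun x => (hb_i.trans_le (hbb x).1).ne'
  have ha : ContDiff ℝ ∞ (fun x => (b x)⁻¹) := hb.inv hb0
  have hbabs : ∀ x, |b x| ≤ b_s := fun x => by
    rw [abs_of_pos (hb_i.trans_le (hbb x).1)]; exact (hbb x).2
  set w : Fin 2 → Plane → ℝ := fun i x => b x * v x i with hw
  set wG : Fin 2 → Fin 2 → Plane → ℝ := fun i j x => b x * G i j x + partialDeriv b j x * v x i
    with hwG
  have hw2 : ∀ i, MemLp (w i) 2 volume := fun i =>
    memLp_bounded_mul hb.continuous.aestronglyMeasurable hbabs (hv i).memLp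
  have hwW : ∀ i, IsWeakGrad (w i) (wG i) := fun i => (hv i).weak.mul_smooth hb
  have hwdiv : ∀ θ : Plane → ℝ, ContDiff ℝ ∞ θ → HasCompactSupport θ →
      ∫ x, w 0 x * partialDeriv θ 0 x + w 1 x * partialDeriv θ 1 x = 0 := by
    intro θ hθ hc
    rw [← hdiv θ hθ hc]
    congr 1; ext x
    simp only [hw, Fin.sum_univ_two]; ring
  set m : Fin 2 → Plane → ℝ := fun i => moll 1 (w i) with hm
  have hms : ∀ i, ContDiff ℝ ∞ (m i) := fun i => contDiff_moll one_pos (hwW i).locInt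
  have hmW : ∀ i, IsWeakGrad (m i) (partialDeriv (m i)) := fun i => .of_contDiff (hms i)
  obtain ⟨ψ, hψ⟩ := exists_stream hw2 hwdiv 1
  set R : Fin 2 → Plane → ℝ := ![fun x => m 1 x - w 1 x, fun x => w 0 x - m 0 x] with hRdef
  set R' : Fin 2 → Fin 2 → Plane → ℝ := ![fun j x => partialDeriv (m 1) j x - wG 1 j x,
    fun j x => wG 0 j x - partialDeriv (m 0) j x] with hR'def
  have hR : ∀ j, IsWeakGrad (R j) (R' j) := by
    intro j; fin_cases j
    · exact (hmW 1).sub (hwW 1)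
    · exact (hwW 0).sub (hmW 0)
  have hbm : ∀ {f g θ : Plane → ℝ}, Continuous g → ContDiff ℝ ∞ θ → HasCompactSupport θ →
      MemLp f 2 volume → MemLp (fun x => θ x * (g x * f x)) 2 volume := by
    intro f g θ hg hθ hc hf
    obtain ⟨D, -, hD⟩ := exists_bound_of_hasCompactSupport (θ := fun x => θ x * g x)
      (hθ.continuous.mul hg) hc.mul_right
    refine (memLp_bounded_mul (hθ.continuous.mul hg).aestronglyMeasurable hD hf).congr_norm ?_ ?_
    · exact hθ.continuous.aestronglyMeasurable.mul (hg.aestronglyMeasurable.mul hf.1)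
    · exact Eventually.of_forall fun x => congrArg norm (mul_assoc _ _ _)
  have hwL : ∀ i l (θ : Plane → ℝ), ContDiff ℝ ∞ θ → HasCompactSupport θ →
      MemLp (fun x => θ x * wG i l x) 2 volume := by
    intro i l θ hθ hc
    simp only [hwG, mul_add]
    exact (hbm hb.continuous hθ hc ((hv i).grad_memLp l)).add
      (hbm (contDiff_partialDeriv hb l).continuous hθ hc (hv i).memLp)
  have hmL : ∀ i l (θ : Plane → ℝ), ContDiff ℝ ∞ θ → HasCompactSupport θ →
      MemLp (fun x => θ x * partialDeriv (m i) l x) 2 volume := by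
    intro i l θ hθ hc
    exact (hθ.continuous.mul (contDiff_partialDeriv (hms i) l).continuous)
      |>.memLp_of_hasCompactSupport hc.mul_right
  have hR2 : ∀ j l (θ : Plane → ℝ), ContDiff ℝ ∞ θ → HasCompactSupport θ →
      MemLp (fun x => θ x * R' j l x) 2 volume := by
    intro j l θ hθ hc
    fin_cases j
    · simp only [hR'def, Fin.zero_eta, Matrix.cons_val_zero, mul_sub]
      exact (hmL 1 l θ hθ hc).sub (hwL 1 l θ hθ hc)
    · simp only [hR'def, Fin.mk_one, Matrix.cons_val_one, Matrix.cons_val_fin_one, mul_sub]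
      exact (hwL 0 l θ hθ hc).sub (hmL 0 l θ hθ hc)
  obtain ⟨Φ, hΦ, hE⟩ := exists_smooth_potential ha hψ hR hR2 hδ
  have hdΦ := contDiff_partialDeriv hΦ
  have hEW : ∀ j, IsWeakGrad (fun x => (b x)⁻¹ * (partialDeriv Φ j x - R j x)) _ := fun j =>
    ((IsWeakGrad.of_contDiff (hdΦ j)).sub (hR j)).mul_smooth ha
  set φ : Plane → Plane := fun x => !₂[(b x)⁻¹ * (m 0 x + partialDeriv Φ 1 x),
    (b x)⁻¹ * (m 1 x - partialDeriv Φ 0 x)] with hφ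
  have hφs : ContDiff ℝ ∞ φ := by
    refine contDiff_euclidean.2 fun i => ?_
    fin_cases i
    · exact ha.mul ((hms 0).add (hdΦ 1))
    · exact ha.mul ((hms 1).sub (hdΦ 0))
  have d0 : ∀ x, φ x 0 - v x 0 = (b x)⁻¹ * (partialDeriv Φ 1 x - R 1 x) := by
    intro x
    have := hb0 x
    simp [hφ, hRdef, hw]; field_simp; ring
  have d1 : ∀ x, φ x 1 - v x 1 = - ((b x)⁻¹ * (partialDeriv Φ 0 x - R 0 x)) := by
    intro x
    have := hb0 x
    simp [hφ, hRdef, hw]; field_simp; ring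
  have aem : ∀ j, AEStronglyMeasurable (fun x => (b x)⁻¹ * (partialDeriv Φ j x - R j x)) volume :=
    fun j => (hEW j).locInt.aestronglyMeasurable
  -- One component: its gradient is that of `v` up to the error term.
  have comp : ∀ (i j : Fin 2) (c : ℝ), |c| = 1 →
      (∀ x, φ x i - v x i = c * ((b x)⁻¹ * (partialDeriv Φ j x - R j x))) →
      IsH1 (fun x => φ x i) (grad φ i) ∧
        eLpNorm (fun x => φ x i - v x i) 2 volume ≤ ENNReal.ofReal δ ∧
        ∀ l, eLpNorm (fun x => grad φ i l x - G i l x) 2 volume ≤ ENNReal.ofReal δ := by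
    intro i j c hc hd
    have hnorm : ∀ f : Plane → ℝ, eLpNorm (fun x => c * f x) 2 volume = eLpNorm f 2 volume := by
      intro f
      refine eLpNorm_congr_norm_ae (Eventually.of_forall fun x => ?_)
      rw [norm_mul, Real.norm_eq_abs c, hc, one_mul]
    have hφi : ContDiff ℝ ∞ (fun x => φ x i) := (contDiff_euclidean.1 hφs) i
    have hWφ : IsWeakGrad (fun x => φ x i) (grad φ i) := .of_contDiff hφi
    have hu := fun l => (hWφ.sub (hv i).weak).unique
      (((hEW j).const_mul c).congr (Eventually.of_forall fun x => (hd x).symm)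
        fun _ => EventuallyEq.rfl) l
    have n0 : eLpNorm (fun x => φ x i - v x i) 2 volume ≤ ENNReal.ofReal δ := by
      simp only [hd]
      rw [hnorm]
      exact (hE j).1
    have n1 : ∀ l, eLpNorm (fun x => grad φ i l x - G i l x) 2 volume ≤ ENNReal.ofReal δ := by
      intro l
      rw [eLpNorm_congr_ae (hu l), hnorm]
      exact (hE j).2 l
    have L0 : MemLp (fun x => φ x i - v x i) 2 volume :=
      ⟨(hWφ.sub (hv i).weak).locInt.aestronglyMeasurable, n0.trans_lt ENNReal.ofReal_lt_top⟩
    have L1 : ∀ l, MemLp (fun x => grad φ i l x - G i l x) 2 volume := fun l =>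
      ⟨((hWφ.sub (hv i).weak).grad_locInt l).aestronglyMeasurable,
        (n1 l).trans_lt ENNReal.ofReal_lt_top⟩
    refine ⟨⟨?_, fun l => ?_, hWφ⟩, n0, n1⟩
    · exact (L0.add (hv i).memLp).ae_eq (Eventually.of_forall fun x => by simp)
    · have := (L1 l).add ((hv i).grad_memLp l)
      refine this.ae_eq (Eventually.of_forall fun x => ?_)
      simp
  have hc0 := comp 0 1 1 (by simp) (fun x => by rw [d0, one_mul])
  have hc1 := comp 1 0 (-1) (by simp) (fun x => by rw [d1]; ring)
  refine ⟨φ, hφs, ?_, fun i => ?_⟩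
  swap
  · fin_cases i
    · exact hc0
    · exact hc1
  -- The field `b φ` is the sum of a mollified divergence-free field and of a rotated gradient.
  intro θ hθ hc
  have hdθ := contDiff_partialDeriv hθ
  have hdθc := hasCompactSupport_partialDeriv hc
  have e : ∀ x, b x * ∑ i, φ x i * partialDeriv θ i x =
      (m 0 x * partialDeriv θ 0 x + m 1 x * partialDeriv θ 1 x) +
      (partialDeriv Φ 1 x * partialDeriv θ 0 x - partialDeriv Φ 0 x * partialDeriv θ 1 x) := by
    intro x
    have := hb0 x
    simp [hφ, Fin.sum_univ_two]; field_simp; ring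
  simp only [e]
  have it : ∀ {f : Plane → ℝ} (i : Fin 2), ContDiff ℝ ∞ f →
      Integrable (fun x => f x * partialDeriv θ i x) := fun i hf =>
    integrable_mul_test hf.continuous.locallyIntegrable (hdθ i).continuous (hdθc i)
  refine (integral_add ((it 0 (hms 0)).add (it 1 (hms 1)))
    ((it 0 (hdΦ 1)).sub (it 1 (hdΦ 0)))).trans ?_
  simp only [Pi.add_apply, Pi.sub_apply]
  rw [integral_add (it 0 (hms 0)) (it 1 (hms 1)), integral_sub (it 0 (hdΦ 1)) (it 1 (hdΦ 0))]
  have q := fun i j => (IsWeakGrad.of_contDiff hΦ).integral_eq _ (hdθ i) (hdθc i) j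
  have q1 : (∫ x, partialDeriv Φ 1 x * partialDeriv θ 0 x) =
      ∫ x, partialDeriv Φ 0 x * partialDeriv θ 1 x := by
    have q2 := q 0 1
    have q3 := q 1 0
    simp only [partialDeriv_comm hθ 0 1] at q2
    linarith
  rw [q1, sub_self, add_zero]
  have dL : ∀ j, MemLp (partialDeriv θ j) 2 volume := fun j => memLp_of_test (hdθ j) (hdθc j) 2
  obtain ⟨i0, r0⟩ := integral_moll_mul (hw2 0) (dL 0) 1
  obtain ⟨i1, r1⟩ := integral_moll_mul (hw2 1) (dL 1) 1
  simp only [hm]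
  rw [r0, r1, ← integral_add i0 i1]
  refine integral_eq_zero_of_ae (Eventually.of_forall fun y => ?_)
  have := hwdiv (fun x => θ (x + (1 : ℝ) • y)) (hθ.comp (contDiff_id.add contDiff_const))
    (hc.comp_homeomorph (Homeomorph.addRight _))
  simp only [partialDeriv_comp_add] at this
  have hsh : ∀ i, Integrable (fun x => w i x * partialDeriv θ i (x + (1 : ℝ) • y)) := fun i =>
    (hw2 i).integrable_mul ((dL i).comp_measurePreserving (measurePreserving_add_right volume _))
  rw [integral_add (hsh 0) (hsh 1)] at this
  simp only [Pi.zero_apply]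
  rw [← mul_add, this, mul_zero]

/-! ### Functions of space and time as Hilbert space valued functions of time -/

/-- Measurability of a map into a separable metric space, tested on the preimages of balls. -/
lemma measurable_of_dist_lt {α E : Type*} [MeasurableSpace α] [PseudoMetricSpace E]
    [SecondCountableTopology E] [MeasurableSpace E] [BorelSpace E] {f : α → E}
    (h : ∀ (g : E) (r : ℝ), MeasurableSet {t | dist (f t) g < r}) : Measurable f := by
  refine measurable_of_isOpen fun U hU => ?_
  obtain ⟨S, hSc, hS⟩ := TopologicalSpace.exists_countable_dense E
  have e : f ⁻¹' U = ⋃ x ∈ S, ⋃ q : ℚ, ⋃ _ : Metric.ball x q ⊆ U, {t | dist (f t) x < q} := by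
    ext t
    simp only [mem_preimage, mem_iUnion, mem_ofPred_eq, exists_prop]
    constructor
    · intro ht
      obtain ⟨ε, hε, hball⟩ := Metric.isOpen_iff.1 hU _ ht
      obtain ⟨x, hx, hxS⟩ := hS.inter_open_nonempty (Metric.ball (f t) (ε / 2))
        Metric.isOpen_ball ⟨f t, Metric.mem_ball_self (half_pos hε)⟩
      rw [Metric.mem_ball, dist_comm] at hx
      obtain ⟨q, hq1, hq2⟩ := exists_rat_btwn hx
      refine ⟨x, hxS, q, fun z hz => hball ?_, hq1⟩
      rw [Metric.mem_ball] at hz ⊢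
      have := dist_triangle z x (f t)
      rw [dist_comm x] at this
      linarith
    · rintro ⟨x, -, q, hq, ht⟩
      exact hq ht
  rw [e]
  exact MeasurableSet.biUnion hSc fun x _ => MeasurableSet.iUnion fun q =>
    MeasurableSet.iUnion fun _ => h x q

/-- A square integrable function of space and time is a square integrable function of time with
values in `L²`. -/
lemma exists_memLp_curry {S : Set ℝ} (hS : MeasurableSet S) {F : ℝ → Plane → ℝ}
    (hF : MemLp (fun p : ℝ × Plane => F p.1 p.2) 2 ((volume.restrict S).prod volume)) :
    ∃ N : ℝ → Lp ℝ 2 (volume : Measure Plane), MemLp N 2 volume ∧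
      ∀ᵐ t ∂(volume.restrict S), (N t : Plane → ℝ) =ᵐ[volume] F t := by
  classical
  obtain ⟨F', hF's, hF'e⟩ := hF.1
  have hae := Measure.ae_ae_of_ae_prod hF'e
  have hF'2 : MemLp F' 2 ((volume.restrict S).prod volume) := hF.ae_eq hF'e
  have hsl : ∀ t, StronglyMeasurable (fun x => F' (t, x)) := fun t =>
    hF's.comp_measurable measurable_prodMk_left
  have hme : ∀ g : Plane → ℝ, StronglyMeasurable g →
      Measurable fun t => eLpNorm (fun x => F' (t, x) - g x) 2 volume := by
    intro g hg
    have h1 : Measurable fun t => ∫⁻ x, ‖F' (t, x) - g x‖ₑ ^ 2 := by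
      refine Measurable.lintegral_prod_right' (f := fun p : ℝ × Plane => ‖F' p - g p.2‖ₑ ^ 2) ?_
      exact ((hF's.sub (hg.comp_measurable measurable_snd)).enorm).pow_const 2
    have h2 : ∀ t, eLpNorm (fun x => F' (t, x) - g x) 2 volume =
        (∫⁻ x, ‖F' (t, x) - g x‖ₑ ^ 2) ^ (1 / 2 : ℝ) := by
      intro t
      simp [eLpNorm_eq_lintegral_rpow_enorm_toReal (p := 2) (by norm_num) (by norm_num)]
    simp only [h2]
    exact h1.pow_const _
  have hm0 : Measurable fun t => eLpNorm (fun x => F' (t, x)) 2 volume := by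
    simpa using hme (fun _ => 0) stronglyMeasurable_const
  set N : ℝ → Lp ℝ 2 (volume : Measure Plane) := fun t =>
    if h : MemLp (fun x => F' (t, x)) 2 volume then h.toLp _ else 0 with hN
  have hGd : MeasurableSet {t | MemLp (fun x => F' (t, x)) 2 volume} := by
    have : {t | MemLp (fun x => F' (t, x)) 2 volume} =
        {t | eLpNorm (fun x => F' (t, x)) 2 volume < ⊤} := by
      ext t
      exact ⟨fun h => h.2, fun h => ⟨(hsl t).aestronglyMeasurable, h⟩⟩
    rw [this]
    exact measurableSet_lt hm0 measurable_const
  let _ : MeasurableSpace (Lp ℝ 2 (volume : Measure Plane)) := borel _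
  have : Fact ((2 : ℝ≥0∞) ≠ ⊤) := ⟨by simp⟩
  have : BorelSpace (Lp ℝ 2 (volume : Measure Plane)) := ⟨rfl⟩
  have hNm : Measurable N := by
    refine measurable_of_dist_lt fun g r => ?_
    have hg := Lp.stronglyMeasurable g
    have e : {t | dist (N t) g < r} =
        ({t | MemLp (fun x => F' (t, x)) 2 volume} ∩
          {t | eLpNorm (fun x => F' (t, x) - g x) 2 volume < ENNReal.ofReal r}) ∪
        ({t | MemLp (fun x => F' (t, x)) 2 volume}ᶜ ∩ {_t | dist 0 g < r}) := by
      ext t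
      simp only [mem_ofPred_eq, mem_union, mem_inter_iff, mem_compl_iff]
      by_cases h : MemLp (fun x => F' (t, x)) 2 volume
      · simp only [hN, h, dite_true, true_and, not_true, false_and, or_false]
        rw [← edist_lt_ofReal]
        conv_lhs => rw [← Lp.toLp_coeFn g (Lp.memLp g), Lp.edist_toLp_toLp]
        rfl
      · simp [hN, h]
    rw [e]
    exact (hGd.inter (measurableSet_lt (hme _ hg) measurable_const)).union
      (hGd.compl.inter (MeasurableSet.const _))
  have hNn : ∀ t, ‖N t‖ₑ ^ 2 ≤ ∫⁻ x, ‖F' (t, x)‖ₑ ^ 2 := by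
    intro t
    rw [← eLpNorm_two_sq]
    gcongr
    by_cases h : MemLp (fun x => F' (t, x)) 2 volume
    · simp only [hN, h, dite_true]
      rw [Lp.enorm_toLp]
    · simp [hN, h]
  have hfin : ∫⁻ t in S, ∫⁻ x, ‖F' (t, x)‖ₑ ^ 2 < ⊤ := by
    rw [← lintegral_prod (fun p => ‖F' p‖ₑ ^ 2) (hF's.enorm.pow_const 2).aemeasurable,
      ← eLpNorm_two_sq]
    exact ENNReal.pow_lt_top hF'2.2
  have hNS : MemLp N 2 (volume.restrict S) := by
    refine ⟨hNm.aestronglyMeasurable, ?_⟩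
    by_contra h
    rw [not_lt, top_le_iff] at h
    have h2 := eLpNorm_two_sq (volume.restrict S) N
    rw [h] at h2
    have := (lintegral_mono hNn).trans_lt hfin
    rw [← h2] at this
    simp at this
  refine ⟨S.indicator N, (memLp_indicator_iff_restrict hS).2 hNS, ?_⟩
  have hgood : ∀ᵐ t ∂(volume.restrict S), ∫⁻ x, ‖F' (t, x)‖ₑ ^ 2 < ⊤ := by
    refine ae_lt_top ?_ hfin.ne
    exact Measurable.lintegral_prod_right' (f := fun p : ℝ × Plane => ‖F' p‖ₑ ^ 2)
      (hF's.enorm.pow_const 2)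
  filter_upwards [hgood, hae, ae_restrict_mem hS] with t h1 h2 h3
  have hM : MemLp (fun x => F' (t, x)) 2 volume := by
    refine ⟨(hsl t).aestronglyMeasurable, ?_⟩
    rw [← eLpNorm_two_sq] at h1
    by_contra h
    rw [not_lt, top_le_iff] at h
    simp [h] at h1
  rw [indicator_of_mem h3]
  simp only [hN, hM, dite_true]
  exact hM.coeFn_toLp.trans (EventuallyEq.symm h2)

section Family

variable {ι : Type*} [Fintype ι]

/-- The Hilbert space of the families `(F k)` of functions in `L²`. -/
abbrev L2Family (ι : Type*) [Fintype ι] : Type _ :=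
  PiLp 2 (fun _ : ι => Lp ℝ 2 (volume : Measure Plane))

/-- `X` is the element of the Hilbert space represented by the family of functions `F`. -/
def Represents (X : L2Family ι) (F : ι → Plane → ℝ) : Prop :=
  ∀ k, (X k : Plane → ℝ) =ᵐ[volume] F k

lemma exists_represents {F : ι → Plane → ℝ} (h : ∀ k, MemLp (F k) 2 volume) :
    ∃ X : L2Family ι, Represents X F :=
  ⟨WithLp.toLp 2 fun k => (h k).toLp (F k), fun k => (h k).coeFn_toLp⟩

lemma Represents.inner {X Y : L2Family ι} {F G : ι → Plane → ℝ} (hX : Represents X F)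
    (hY : Represents Y G) : inner ℝ X Y = ∑ k, ∫ x, F k x * G k x := by
  rw [PiLp.inner_apply]
  refine Finset.sum_congr rfl fun k _ => ?_
  rw [L2.inner_def]
  refine integral_congr_ae ?_
  filter_upwards [hX k, hY k] with x h1 h2
  simp [h1, h2, mul_comm]

lemma Represents.tendsto {X : ℕ → L2Family ι} {Y : L2Family ι} {F : ℕ → ι → Plane → ℝ}
    {G : ι → Plane → ℝ} (hX : ∀ n, Represents (X n) (F n)) (hY : Represents Y G)
    (h : ∀ k, Tendsto (fun n => eLpNorm (fun x => F n k x - G k x) 2 volume) atTop (𝓝 0)) :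
    Tendsto X atTop (𝓝 Y) := by
  have : ∀ k, Tendsto (fun n => X n k) atTop (𝓝 (Y k)) := by
    intro k
    rw [Lp.tendsto_Lp_iff_tendsto_eLpNorm']
    refine (h k).congr fun n => eLpNorm_congr_ae ?_
    filter_upwards [hX n k, hY k] with x h1 h2
    simp [h1, h2]
  have h2 : Tendsto (fun n => (WithLp.ofLp (X n))) atTop (𝓝 (WithLp.ofLp Y)) :=
    tendsto_pi_nhds.2 this
  exact ((PiLp.continuous_toLp 2 _).tendsto _).comp h2

lemma exists_memLp_represents {S : Set ℝ} (hS : MeasurableSet S) {F : ι → ℝ → Plane → ℝ}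
    (hF : ∀ k, MemLp (fun p : ℝ × Plane => F k p.1 p.2) 2 ((volume.restrict S).prod volume)) :
    ∃ N : ℝ → L2Family ι, MemLp N 2 volume ∧
      ∀ᵐ t ∂(volume.restrict S), Represents (N t) (fun k => F k t) := by
  choose N hN hNe using fun k => exists_memLp_curry hS (hF k)
  refine ⟨fun t => WithLp.toLp 2 fun k => N k t, memLp_piLp_iff.2 hN, ?_⟩
  exact (eventually_all.2 hNe).mono fun t ht k => ht k

end Family

/-! ### The terms of the weak formulation at a fixed time -/

/-- The standing assumptions on the depth `b` and on the damping coefficient `η`. -/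
structure Coefficients (b η : Plane → ℝ) (b_i b_s M : ℝ) : Prop where
  pos : 0 < b_i
  smooth_b : ContDiff ℝ ∞ b
  lower : ∀ x, b_i ≤ b x
  upper : ∀ x, b x ≤ b_s
  smooth_η : ContDiff ℝ ∞ η
  η_pos : ∀ x, 0 < η x
  η_le : ∀ x, η x ≤ M

/-- The field `v`, with weak gradient `G`, belongs to the space `V`. -/
structure InV (b : Plane → ℝ) (v : Plane → Plane) (G : Fin 2 → Fin 2 → Plane → ℝ) : Prop where
  isH1 : ∀ i, IsH1 (fun x => v x i) (G i)
  divFree : WeightedDivFree b v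

/-- The index `(i, none)` stands for the component `vᵢ` of a vector field, and the index
`(i, some j)` for the entry `∂ⱼ vᵢ` of its gradient. -/
abbrev Idx : Type := Fin 2 × Option (Fin 2)

/-- A vector field together with its gradient. -/
def state (v : Plane → Plane) (G : Fin 2 → Fin 2 → Plane → ℝ) : Idx → Plane → ℝ
  | (i, none) => fun x => v x i
  | (i, some j) => G i j

/-- The linear functional of the test field and of its gradient given by the damping, the viscous
and the convective term, the latter after an integration by parts. -/
noncomputable def flux (ν : ℝ) (b η : Plane → ℝ) (v : Plane → Plane)
    (G : Fin 2 → Fin 2 → Plane → ℝ) : Idx → Plane → ℝ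
  | (i, none) => fun x => -(b x * (η x * v x i))
  | (i, some j) => fun x => b x * (v x j * v x i) - ν * (b x * stress G i j x)

/-- The force as a linear functional of the test field and of its gradient. -/
def forcing (b : Plane → ℝ) (f : Plane → Plane) : Idx → Plane → ℝ
  | (i, none) => fun x => b x * f x i
  | (_, some _) => fun _ => 0

/-- The components `√η vᵢ` and `∂ⱼ vᵢ`, whose squares add up to the dissipation. -/
noncomputable def dissipState (η : Plane → ℝ) (v : Plane → Plane) (G : Fin 2 → Fin 2 → Plane → ℝ) :
    Idx → Plane → ℝ
  | (i, none) => fun x => √(η x) * v x i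
  | (i, some j) => G i j

/-- The dissipation `∫ η |v|² + |∇v|²`. -/
noncomputable def dissip (η : Plane → ℝ) (v : Plane → Plane) (G : Fin 2 → Fin 2 → Plane → ℝ) : ℝ :=
  ∑ k, ∫ x, dissipState η v G k x ^ 2

lemma sum_idx {R : Type*} [AddCommMonoid R] (F : Idx → R) :
    ∑ k, F k = ∑ i, (F (i, none) + ∑ j, F (i, some j)) := by
  rw [Fintype.sum_prod_type]
  simp [Fintype.sum_option]

section Static

variable {ν : ℝ} {b η : Plane → ℝ} {b_i b_s M : ℝ} {u v : Plane → Plane}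
  {G Z : Fin 2 → Fin 2 → Plane → ℝ}

lemma Coefficients.b_pos (h : Coefficients b η b_i b_s M) (x : Plane) : 0 < b x :=
  h.pos.trans_le (h.lower x)

lemma Coefficients.b_s_pos (h : Coefficients b η b_i b_s M) : 0 < b_s :=
  (h.b_pos 0).trans_le (h.upper 0)

lemma Coefficients.abs_b_le (h : Coefficients b η b_i b_s M) (x : Plane) : |b x| ≤ b_s := by
  rw [abs_of_pos (h.b_pos x)]; exact h.upper x

lemma Coefficients.abs_η_le (h : Coefficients b η b_i b_s M) (x : Plane) : |η x| ≤ M := by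
  rw [abs_of_pos (h.η_pos x)]; exact h.η_le x

lemma Coefficients.abs_sqrt_η_le (h : Coefficients b η b_i b_s M) (x : Plane) : |√(η x)| ≤ √M := by
  rw [abs_of_nonneg (Real.sqrt_nonneg _)]; exact Real.sqrt_le_sqrt (h.η_le x)

lemma Coefficients.memLp_b_mul (h : Coefficients b η b_i b_s M) {f : Plane → ℝ} {p : ℝ≥0∞}
    (hf : MemLp f p volume) : MemLp (fun x => b x * f x) p volume :=
  memLp_bounded_mul h.smooth_b.continuous.aestronglyMeasurable h.abs_b_le hf

lemma Coefficients.memLp_η_mul (h : Coefficients b η b_i b_s M) {f : Plane → ℝ} {p : ℝ≥0∞}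
    (hf : MemLp f p volume) : MemLp (fun x => η x * f x) p volume :=
  memLp_bounded_mul h.smooth_η.continuous.aestronglyMeasurable h.abs_η_le hf

lemma Coefficients.memLp_sqrt_η_mul (h : Coefficients b η b_i b_s M) {f : Plane → ℝ} {p : ℝ≥0∞}
    (hf : MemLp f p volume) : MemLp (fun x => √(η x) * f x) p volume :=
  memLp_bounded_mul h.smooth_η.continuous.sqrt.aestronglyMeasurable h.abs_sqrt_η_le hf

lemma memLp_stress (hG : ∀ i j, MemLp (G i j) 2 volume) (i j : Fin 2) :
    MemLp (stress G i j) 2 volume := by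
  have e : stress G i j = fun x =>
      (G i j x + G j i x) - (if i = j then 1 else 0) * ∑ k, G k k x := by
    ext x; simp [stress]
  rw [e]
  refine ((hG i j).add (hG j i)).sub (MemLp.const_mul ?_ _)
  simp only [Fin.sum_univ_two]
  exact (hG 0 0).add (hG 1 1)

lemma InV.memLp_four (hv : InV b v G) (i : Fin 2) : MemLp (fun x => v x i) 4 volume :=
  (hv.isH1 i).memLp_four

lemma InV.memLp_state (hv : InV b v G) (k : Idx) : MemLp (state v G k) 2 volume := by
  rcases k with ⟨i, _ | j⟩
  · exact (hv.isH1 i).memLp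
  · exact (hv.isH1 i).grad_memLp j

lemma InV.memLp_dissipState (h : Coefficients b η b_i b_s M) (hv : InV b v G) (k : Idx) :
    MemLp (dissipState η v G k) 2 volume := by
  rcases k with ⟨i, _ | j⟩
  · exact h.memLp_sqrt_η_mul (hv.isH1 i).memLp
  · exact (hv.isH1 i).grad_memLp j

lemma innerB_eq_sum (h : Coefficients b η b_i b_s M) (hu : ∀ i, MemLp (fun x => u x i) 2 volume)
    (hv : ∀ i, MemLp (fun x => v x i) 2 volume) :
    innerB b u v = ∑ i, ∫ x, b x * u x i * v x i := by
  simp only [innerB, Finset.mul_sum, ← mul_assoc]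
  exact integral_finsetSum _ fun i _ => integrable_mul_L2 (h.memLp_b_mul (hu i)) (hv i)

lemma forcing_pairing (h : Coefficients b η b_i b_s M) {f : Plane → Plane}
    (hf : ∀ i, MemLp (fun x => f x i) 2 volume) (hv : ∀ i, MemLp (fun x => v x i) 2 volume) :
    ∑ k, ∫ x, forcing b f k x * state v Z k x = innerB b v f := by
  rw [innerB_eq_sum h hv hf, sum_idx]
  simp only [forcing, state, zero_mul, integral_zero, Finset.sum_const_zero, add_zero]
  exact Finset.sum_congr rfl fun i _ => integral_congr_ae (Eventually.of_forall fun x => by ring)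

/-- Contracting the stress with a stress is twice contracting it with a gradient, since the stress
is symmetric and trace-free. -/
lemma stressForm_eq_sum (h : Coefficients b η b_i b_s M) (hG : ∀ i j, MemLp (G i j) 2 volume)
    (hZ : ∀ i j, MemLp (Z i j) 2 volume) :
    stressForm b G Z = 2 * ∑ i, ∑ j, ∫ x, b x * stress G i j x * Z i j x := by
  have e : ∀ x, b x * ∑ i, ∑ j, stress G i j x * stress Z i j x =
      2 * ∑ i, ∑ j, b x * stress G i j x * Z i j x := by
    intro x
    simp [stress, Fin.sum_univ_two]
    ring
  simp only [stressForm, e]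
  rw [integral_const_mul, integral_finsetSum]
  · congr 1
    refine Finset.sum_congr rfl fun i _ => integral_finsetSum _ fun j _ =>
      integrable_mul_L2 (h.memLp_b_mul (memLp_stress hG i j)) (hZ i j)
  · exact fun i _ => integrable_finsetSum _ fun j _ =>
      integrable_mul_L2 (h.memLp_b_mul (memLp_stress hG i j)) (hZ i j)

lemma convection_eq_sum (h : Coefficients b η b_i b_s M) (hu : InV b u G) (hv : InV b v Z) :
    convection b u G v = ∑ i, ∑ j, ∫ x, G i j x * (b x * u x j * v x i) := by
  have hi : ∀ i j, Integrable (fun x => G i j x * (b x * u x j * v x i)) := fun i j => by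
    refine integrable_mul_L2 ((hu.isH1 i).grad_memLp j) ?_
    exact memLp_mul_four (h.memLp_b_mul (hu.memLp_four j)) (hv.memLp_four i)
  have e : ∀ x, b x * ∑ i, ∑ j, u x j * G i j x * v x i =
      ∑ i, ∑ j, G i j x * (b x * u x j * v x i) := by
    intro x
    simp only [Finset.mul_sum]
    exact Finset.sum_congr rfl fun i _ => Finset.sum_congr rfl fun j _ => by ring
  simp only [convection, e]
  rw [integral_finsetSum _ fun i _ => integrable_finsetSum _ fun j _ => hi i j]
  exact Finset.sum_congr rfl fun i _ => integral_finsetSum _ fun j _ => hi i j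

/-- Integration by parts in the convective term. -/
lemma convection_eq_neg_sum (h : Coefficients b η b_i b_s M) (hu : InV b u G) (hv : InV b v Z) :
    convection b u G v = - ∑ i, ∑ j, ∫ x, Z i j x * (b x * u x j * u x i) := by
  rw [convection_eq_sum h hu hv, ← Finset.sum_neg_distrib]
  refine Finset.sum_congr rfl fun i _ => ?_
  refine transport_antisymm (fun j => h.memLp_b_mul (hu.memLp_four j)) (fun θ hθ hc => ?_)
    (hu.isH1 i) (hv.isH1 i)
  rw [← hu.divFree θ hθ hc]
  congr 1; ext x
  simp only [Finset.mul_sum, mul_assoc]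

lemma convection_self (h : Coefficients b η b_i b_s M) (hu : InV b u G) :
    convection b u G u = 0 := by
  have h1 := convection_eq_sum h hu hu
  have h2 := convection_eq_neg_sum h hu hu
  linarith

lemma flux_pairing (h : Coefficients b η b_i b_s M) (hu : InV b u G) (hv : InV b v Z) :
    ∑ k, ∫ x, flux ν b η u G k x * state v Z k x =
      -(ν / 2 * stressForm b G Z + innerB b (fun x => η x • u x) v + convection b u G v) := by
  have hG := fun i j => (hu.isH1 i).grad_memLp j
  have hZ := fun i j => (hv.isH1 i).grad_memLp j
  rw [convection_eq_neg_sum h hu hv, stressForm_eq_sum h hG hZ, innerB_eq_sum h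
    (fun i => by simpa using h.memLp_η_mul (hu.isH1 i).memLp) (fun i => (hv.isH1 i).memLp), sum_idx]
  have e1 : ∀ i, ∫ x, flux ν b η u G (i, none) x * state v Z (i, none) x =
      - ∫ x, b x * (η x • u x) i * v x i := by
    intro i
    rw [← integral_neg]
    refine integral_congr_ae (Eventually.of_forall fun x => ?_)
    simp [flux, state]
  have e2 : ∀ i j, ∫ x, flux ν b η u G (i, some j) x * state v Z (i, some j) x =
      (∫ x, Z i j x * (b x * u x j * u x i)) - ν * ∫ x, b x * stress G i j x * Z i j x := by
    intro i j
    rw [← integral_const_mul, ← integral_sub]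
    · refine integral_congr_ae (Eventually.of_forall fun x => ?_)
      simp only [flux, state]; ring
    · exact integrable_mul_L2 (hZ i j)
        (memLp_mul_four (h.memLp_b_mul (hu.memLp_four j)) (hu.memLp_four i))
    · exact (integrable_mul_L2 (h.memLp_b_mul (memLp_stress hG i j)) (hZ i j)).const_mul ν
  simp only [e1, e2, Finset.sum_add_distrib, Finset.sum_sub_distrib, Finset.sum_neg_distrib,
    ← Finset.mul_sum]
  ring

lemma dissip_nonneg : 0 ≤ dissip η v G :=
  Finset.sum_nonneg fun _ _ => integral_nonneg fun _ => sq_nonneg _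

lemma dissip_eq (h : Coefficients b η b_i b_s M) :
    dissip η v G = (∑ i, ∫ x, η x * v x i ^ 2) + ∑ i, ∑ j, ∫ x, G i j x ^ 2 := by
  rw [dissip, sum_idx, Finset.sum_add_distrib]
  simp only [dissipState, mul_pow]
  congr 1
  refine Finset.sum_congr rfl fun i _ => integral_congr_ae (Eventually.of_forall fun x => ?_)
  simp only [Real.sq_sqrt (h.η_pos x).le]

lemma l2_dissipState_le (h : Coefficients b η b_i b_s M) (hv : InV b v G) (k : Idx) :
    l2 (dissipState η v G k) ≤ √(dissip η v G) := by
  refine Real.le_sqrt_of_sq_le ?_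
  rw [l2_sq (hv.memLp_dissipState h k), dissip]
  exact Finset.single_le_sum (f := fun k => ∫ x, dissipState η v G k x ^ 2)
    (fun _ _ => integral_nonneg fun _ => sq_nonneg _) (Finset.mem_univ k)

lemma l2_grad_le (h : Coefficients b η b_i b_s M) (hv : InV b v G) (i j : Fin 2) :
    l2 (G i j) ≤ √(dissip η v G) := l2_dissipState_le h hv (i, some j)

/-- **Korn's inequality**: the stress controls the gradient, because the determinant of the
gradient has integral zero. -/
lemma le_stressForm (h : Coefficients b η b_i b_s M) (hv : InV b v G) :
    2 * b_i * ∑ i, ∑ j, ∫ x, G i j x ^ 2 ≤ stressForm b G G := by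
  have hG := fun i j => (hv.isH1 i).grad_memLp j
  have hi : ∀ i j k l, Integrable (fun x => G i j x * G k l x) := fun i j k l =>
    integrable_mul_L2 (hG i j) (hG k l)
  have hdet := integral_grad_mul_comm (hv.isH1 0) (hv.isH1 1)
  have hsq : ∀ i j, Integrable (fun x => G i j x ^ 2) := fun i j => (hG i j).integrable_sq
  -- Pointwise `|S|² = 2 |G|² - 4 det G`, and `b_i |S|² ≤ b |S|²`; the weight is estimated before
  -- the determinant is integrated.
  have e1 : 2 * b_i * ∑ i, ∑ j, ∫ x, G i j x ^ 2 = ∫ x, b_i * (2 * ((G 0 0 x ^ 2 + G 0 1 x ^ 2) +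
      (G 1 0 x ^ 2 + G 1 1 x ^ 2)) + 4 * (G 0 1 x * G 1 0 x - G 0 0 x * G 1 1 x)) := by
    rw [integral_const_mul, integral_add, integral_const_mul, integral_const_mul,
      integral_sub (hi 0 1 1 0) (hi 0 0 1 1), integral_add, integral_add (hsq 0 0) (hsq 0 1),
      integral_add (hsq 1 0) (hsq 1 1), hdet]
    · simp only [Fin.sum_univ_two]; ring
    · exact (hsq 0 0).add (hsq 0 1)
    · exact (hsq 1 0).add (hsq 1 1)
    · exact (((hsq 0 0).add (hsq 0 1)).add ((hsq 1 0).add (hsq 1 1))).const_mul 2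
    · exact ((hi 0 1 1 0).sub (hi 0 0 1 1)).const_mul 4
  rw [e1, stressForm]
  refine integral_mono_ae ?_ ?_ (Eventually.of_forall fun x => ?_)
  · exact (((((hsq 0 0).add (hsq 0 1)).add ((hsq 1 0).add (hsq 1 1))).const_mul 2).add
      (((hi 0 1 1 0).sub (hi 0 0 1 1)).const_mul 4)).const_mul b_i
  · simp only [Finset.mul_sum, ← mul_assoc]
    exact integrable_finsetSum _ fun i _ => integrable_finsetSum _ fun j _ =>
      integrable_mul_L2 (h.memLp_b_mul (memLp_stress hG i j)) (memLp_stress hG i j)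
  · have e2 : ∑ i, ∑ j, stress G i j x * stress G i j x = 2 * ((G 0 0 x ^ 2 + G 0 1 x ^ 2) +
        (G 1 0 x ^ 2 + G 1 1 x ^ 2)) + 4 * (G 0 1 x * G 1 0 x - G 0 0 x * G 1 1 x) := by
      simp [stress, Fin.sum_univ_two]; ring
    simp only
    rw [← e2]
    refine mul_le_mul_of_nonneg_right (h.lower x) ?_
    exact Finset.sum_nonneg fun i _ => Finset.sum_nonneg fun j _ => mul_self_nonneg _

/-- The energy is dissipated at the rate given by `dissip`. -/
lemma flux_pairing_self_le (hν : 0 < ν) (h : Coefficients b η b_i b_s M) (hu : InV b u G) :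
    ∑ k, ∫ x, flux ν b η u G k x * state u G k x ≤ -(min ν 1 * b_i * dissip η u G) := by
  rw [flux_pairing h hu hu, convection_self h hu, add_zero, neg_le_neg_iff, dissip_eq h,
    innerB_eq_sum h (fun i => by simpa using h.memLp_η_mul (hu.isH1 i).memLp)
      (fun i => (hu.isH1 i).memLp)]
  have hK := le_stressForm h hu
  have hA : 0 ≤ ∑ i, ∑ j, ∫ x, G i j x ^ 2 := Finset.sum_nonneg fun i _ =>
    Finset.sum_nonneg fun j _ => integral_nonneg fun _ => sq_nonneg _
  have hB : 0 ≤ ∑ i, ∫ x, η x * u x i ^ 2 := Finset.sum_nonneg fun i _ =>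
    integral_nonneg fun x => mul_nonneg (h.η_pos x).le (sq_nonneg _)
  have hη : b_i * ∑ i, ∫ x, η x * u x i ^ 2 ≤ ∑ i, ∫ x, b x * (η x • u x) i * u x i := by
    rw [Finset.mul_sum]
    refine Finset.sum_le_sum fun i _ => ?_
    rw [← integral_const_mul]
    refine integral_mono_ae ?_ ?_ (Eventually.of_forall fun x => ?_)
    · refine Integrable.const_mul ?_ _
      refine (integrable_mul_L2 (h.memLp_η_mul (hu.isH1 i).memLp) (hu.isH1 i).memLp).congr
        (Eventually.of_forall fun x => ?_)
      simp only; ring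
    · exact integrable_mul_L2 (h.memLp_b_mul (by simpa using h.memLp_η_mul (hu.isH1 i).memLp))
        (hu.isH1 i).memLp
    · have := mul_le_mul_of_nonneg_right (h.lower x)
        (mul_nonneg (h.η_pos x).le (sq_nonneg (u x i)))
      simp only [PiLp.smul_apply, smul_eq_mul]
      linarith
  have m1 : min ν 1 * b_i * ∑ i, ∑ j, ∫ x, G i j x ^ 2 ≤ ν * b_i * ∑ i, ∑ j, ∫ x, G i j x ^ 2 :=
    mul_le_mul_of_nonneg_right (mul_le_mul_of_nonneg_right (min_le_left _ _) h.pos.le) hA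
  have m2 : min ν 1 * b_i * ∑ i, ∫ x, η x * u x i ^ 2 ≤ 1 * b_i * ∑ i, ∫ x, η x * u x i ^ 2 :=
    mul_le_mul_of_nonneg_right (mul_le_mul_of_nonneg_right (min_le_right _ _) h.pos.le) hB
  rw [mul_add]
  nlinarith

lemma le_innerB_self (h : Coefficients b η b_i b_s M) (hu : ∀ i, MemLp (fun x => u x i) 2 volume)
    (i : Fin 2) : b_i * l2 (fun x => u x i) ^ 2 ≤ innerB b u u := by
  rw [innerB_eq_sum h hu hu, l2_sq (hu i), ← integral_const_mul]
  have h0 : ∀ i, 0 ≤ ∫ x, b x * u x i * u x i := fun i => integral_nonneg fun x => by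
    have := mul_nonneg (h.b_pos x).le (mul_self_nonneg (u x i))
    simpa [mul_assoc] using this
  refine le_trans ?_ (Finset.single_le_sum (f := fun i => ∫ x, b x * u x i * u x i)
    (fun i _ => h0 i) (Finset.mem_univ i))
  refine integral_mono_ae ((hu i).integrable_sq.const_mul _)
    (integrable_mul_L2 (h.memLp_b_mul (hu i)) (hu i)) (Eventually.of_forall fun x => ?_)
  have := mul_le_mul_of_nonneg_right (h.lower x) (sq_nonneg (u x i))
  simp only
  linarith

lemma abs_innerB_le (h : Coefficients b η b_i b_s M) (hu : ∀ i, MemLp (fun x => u x i) 2 volume)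
    (hv : ∀ i, MemLp (fun x => v x i) 2 volume) :
    |innerB b u v| ≤ b_s * ∑ i, l2 (fun x => u x i) * l2 (fun x => v x i) := by
  rw [innerB_eq_sum h hu hv, Finset.mul_sum]
  refine (Finset.abs_sum_le_sum_abs _ _).trans (Finset.sum_le_sum fun i _ => ?_)
  refine (abs_integral_mul_le (h.memLp_b_mul (hu i)) (hv i)).trans ?_
  rw [← mul_assoc]
  exact mul_le_mul_of_nonneg_right (l2_bounded_mul_le h.b_s_pos.le h.abs_b_le (hu i)) (l2_nonneg _)

lemma l2_stress_le (h : Coefficients b η b_i b_s M) (hv : InV b v G) (i j : Fin 2) :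
    l2 (stress G i j) ≤ 2 * √(dissip η v G) := by
  have hG := fun i j => (hv.isH1 i).grad_memLp j
  have hsq : ∀ i j, Integrable (fun x => G i j x ^ 2) := fun i j => (hG i j).integrable_sq
  refine abs_le_of_sq_le_sq' ?_ (by positivity) |>.2
  rw [mul_pow, Real.sq_sqrt dissip_nonneg, l2_sq (memLp_stress hG i j)]
  have h1 : ∫ x, stress G i j x ^ 2 ≤ ∫ x, 4 * ∑ i, ∑ j, G i j x ^ 2 := by
    refine integral_mono_ae (memLp_stress hG i j).integrable_sq ?_
      (Eventually.of_forall fun x => ?_)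
    · exact (integrable_finsetSum _ fun i _ =>
        integrable_finsetSum _ fun j _ => hsq i j).const_mul 4
    · fin_cases i <;> fin_cases j <;> simp [stress, Fin.sum_univ_two] <;>
        nlinarith [sq_nonneg (G 0 0 x - G 1 1 x), sq_nonneg (G 0 1 x - G 1 0 x),
          sq_nonneg (G 0 0 x + G 1 1 x), sq_nonneg (G 0 1 x + G 1 0 x)]
  have h2 : ∫ x, 4 * ∑ i, ∑ j, G i j x ^ 2 = 4 * ∑ i, ∑ j, ∫ x, G i j x ^ 2 := by
    rw [integral_const_mul,
      integral_finsetSum _ fun i _ => integrable_finsetSum _ fun j _ => hsq i j]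
    congr 1
    exact Finset.sum_congr rfl fun i _ => integral_finsetSum _ fun j _ => hsq i j
  have h3 : 0 ≤ ∑ i, ∫ x, η x * v x i ^ 2 := Finset.sum_nonneg fun i _ =>
    integral_nonneg fun x => mul_nonneg (h.η_pos x).le (sq_nonneg _)
  rw [dissip_eq h]
  linarith

/-- Ladyzhenskaya's inequality, in terms of the dissipation. -/
lemma exists_l4_sq_le_dissip : ∃ C : ℝ, 0 ≤ C ∧ ∀ {b η : Plane → ℝ} {b_i b_s M : ℝ}
    {v : Plane → Plane} {G : Fin 2 → Fin 2 → Plane → ℝ} {U : ℝ}, Coefficients b η b_i b_s M →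
    InV b v G → (∀ i, l2 (fun x => v x i) ≤ U) → ∀ i,
    l4 (fun x => v x i) ^ 2 ≤ C * U * √(dissip η v G) := by
  obtain ⟨C, hC, hl⟩ := exists_l4_sq_le
  refine ⟨2 * C, by positivity, fun {b η b_i b_s M v G U} h hv hU i => ?_⟩
  refine (hl _ _ (hv.isH1 i)).trans ?_
  have h0 := l2_grad_le h hv i 0
  have h1 := l2_grad_le h hv i 1
  have h2 : l2 (fun x => v x i) * (l2 (G i 0) + l2 (G i 1)) ≤ U * (2 * √(dissip η v G)) :=
    mul_le_mul (hU i) (by linarith) (add_nonneg (l2_nonneg _) (l2_nonneg _))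
      ((l2_nonneg _).trans (hU i))
  calc _ ≤ C * (U * (2 * √(dissip η v G))) := mul_le_mul_of_nonneg_left h2 hC
    _ = _ := by ring

/-- The damping, viscous and convective terms are controlled by the dissipations of the solution
and of the test field. -/
lemma exists_abs_flux_pairing_le (hν : 0 < ν) (h : Coefficients b η b_i b_s M) {U : ℝ}
    (hU0 : 0 ≤ U) :
    ∃ C : ℝ, 0 ≤ C ∧ ∀ u G v Z, InV b u G → InV b v Z → (∀ i, l2 (fun x => u x i) ≤ U) →
      |∑ k, ∫ x, flux ν b η u G k x * state v Z k x| ≤ C * (√(dissip η u G) * √(dissip η v Z)) := by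
  obtain ⟨L, hL, hl⟩ := exists_l4_sq_le_dissip
  have hbs := h.b_s_pos
  refine ⟨∑ k : Idx, (b_s + (b_s * (L * U) + ν * (b_s * 2))), Finset.sum_nonneg fun k _ =>
    by positivity, fun u G v Z hu hv hU => ?_⟩
  rw [Finset.sum_mul]
  refine (Finset.abs_sum_le_sum_abs _ _).trans (Finset.sum_le_sum fun k _ => ?_)
  set d := √(dissip η u G)
  set e := √(dissip η v Z)
  have hd : 0 ≤ d := Real.sqrt_nonneg _
  have he : 0 ≤ e := Real.sqrt_nonneg _
  rcases k with ⟨i, _ | j⟩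
  · have e1 : ∫ x, flux ν b η u G (i, none) x * state v Z (i, none) x =
        - ∫ x, b x * dissipState η u G (i, none) x * dissipState η v Z (i, none) x := by
      rw [← integral_neg]
      refine integral_congr_ae (Eventually.of_forall fun x => ?_)
      have := Real.mul_self_sqrt (h.η_pos x).le
      simp only [flux, state, dissipState]
      linear_combination (b x * u x i * v x i) * this
    rw [e1, abs_neg]
    refine (abs_integral_mul_le (h.memLp_b_mul (hu.memLp_dissipState h _))
      (hv.memLp_dissipState h _)).trans ?_
    have h1 := l2_bounded_mul_le h.b_s_pos.le h.abs_b_le (hu.memLp_dissipState h (i, none))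
    have h2 := h1.trans (mul_le_mul_of_nonneg_left (l2_dissipState_le h hu (i, none)) hbs.le)
    have h3 := mul_le_mul h2 (l2_dissipState_le h hv (i, none)) (l2_nonneg _) (by positivity)
    refine h3.trans ?_
    have : 0 ≤ (b_s * (L * U) + ν * (b_s * 2)) * (d * e) := by positivity
    linarith
  · have hG := fun i j => (hu.isH1 i).grad_memLp j
    have hZ := (hv.isH1 i).grad_memLp j
    have m1 := h.memLp_b_mul (memLp_mul_four (hu.memLp_four j) (hu.memLp_four i))
    have m2 := h.memLp_b_mul (memLp_stress hG i j)
    have e1 : ∫ x, flux ν b η u G (i, some j) x * state v Z (i, some j) x =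
        (∫ x, b x * (u x j * u x i) * Z i j x) - ν * ∫ x, b x * stress G i j x * Z i j x := by
      rw [← integral_const_mul, ← integral_sub (integrable_mul_L2 m1 hZ)
        ((integrable_mul_L2 m2 hZ).const_mul ν)]
      refine integral_congr_ae (Eventually.of_forall fun x => ?_)
      simp only [flux, state]; ring
    have hZe : l2 (Z i j) ≤ e := l2_grad_le h hv i j
    have b1 : |∫ x, b x * (u x j * u x i) * Z i j x| ≤ b_s * (L * U * d) * e := by
      refine (abs_integral_mul_le m1 hZ).trans (mul_le_mul ?_ hZe (l2_nonneg _) (by positivity))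
      refine (l2_bounded_mul_le h.b_s_pos.le h.abs_b_le
        (memLp_mul_four (hu.memLp_four j) (hu.memLp_four i))).trans ?_
      refine mul_le_mul_of_nonneg_left ?_ hbs.le
      refine (l2_mul_four_le (hu.memLp_four j) (hu.memLp_four i)).trans ?_
      have q1 := hl h hu hU i
      have q2 := hl h hu hU j
      nlinarith [sq_nonneg (l4 (fun x => u x j) - l4 (fun x => u x i))]
    have b2 : |∫ x, b x * stress G i j x * Z i j x| ≤ b_s * (2 * d) * e := by
      refine (abs_integral_mul_le m2 hZ).trans (mul_le_mul ?_ hZe (l2_nonneg _) (by positivity))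
      refine (l2_bounded_mul_le h.b_s_pos.le h.abs_b_le (memLp_stress hG i j)).trans ?_
      exact mul_le_mul_of_nonneg_left (l2_stress_le h hu i j) hbs.le
    rw [e1]
    refine (abs_sub _ _).trans ?_
    rw [abs_mul, abs_of_pos hν]
    have := mul_le_mul_of_nonneg_left b2 hν.le
    have : 0 ≤ b_s * (d * e) := by positivity
    linarith

end Static

/-! ### From the weak formulation to the energy identity -/

lemma ae_restrict_Ici_of_Icc {p : ℝ → Prop}
    (h : ∀ T, 0 < T → ∀ᵐ t ∂(volume.restrict (Icc 0 T)), p t) :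
    ∀ᵐ t ∂(volume.restrict (Ici (0 : ℝ))), p t := by
  have e : Ici (0 : ℝ) = ⋃ n : ℕ, Icc 0 ((n : ℝ) + 1) := by
    ext t
    simp only [mem_Ici, mem_iUnion, mem_Icc]
    refine ⟨fun ht => ⟨⌈t⌉₊, ht, (Nat.le_ceil t).trans (by linarith)⟩, fun ⟨_, h, _⟩ => h⟩
  rw [e, ae_restrict_iUnion_eq]
  exact eventually_iSup.2 fun n => h _ (by positivity)

lemma ae_restrict_Icc_of_Ici {p : ℝ → Prop} (h : ∀ᵐ t ∂(volume.restrict (Ici (0 : ℝ))), p t)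
    (T : ℝ) : ∀ᵐ t ∂(volume.restrict (Icc 0 T)), p t :=
  ae_restrict_of_ae_restrict_of_subset Icc_subset_Ici_self h

lemma memLp_apply {α : Type*} [MeasurableSpace α] {m : Measure α} {p : ℝ≥0∞} {v : α → Plane}
    (h : MemLp v p m) (i : Fin 2) : MemLp (fun x => v x i) p m :=
  (memLp_piLp_iff.1 h) i

lemma eLpNorm_apply_le {α : Type*} [MeasurableSpace α] {m : Measure α} {p : ℝ≥0∞} (v : α → Plane)
    (i : Fin 2) : eLpNorm (fun x => v x i) p m ≤ eLpNorm v p m :=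
  eLpNorm_mono fun x => PiLp.norm_apply_le (v x) i

lemma eLpNorm_four_pow {α : Type*} [MeasurableSpace α] (m : Measure α) (f : α → ℝ) :
    eLpNorm f 4 m ^ 4 = ∫⁻ x, ‖f x‖ₑ ^ 4 ∂m := by
  rw [eLpNorm_eq_lintegral_rpow_enorm_toReal (by norm_num) (by norm_num),
    ← ENNReal.rpow_natCast, ← ENNReal.rpow_mul]
  norm_num

/-- A function in `L^∞(L²) ∩ L²(H¹)` lies in `L⁴` in space and time. -/
lemma memLp_four_of_isH1 {S : Set ℝ} {v : ℝ → Plane → ℝ} {G : ℝ → Fin 2 → Plane → ℝ}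
    (hv : AEStronglyMeasurable (fun p : ℝ × Plane => v p.1 p.2) ((volume.restrict S).prod volume))
    (hG : ∀ j, MemLp (fun p : ℝ × Plane => G p.1 j p.2) 2 ((volume.restrict S).prod volume))
    (h1 : ∀ᵐ t ∂(volume.restrict S), IsH1 (v t) (G t)) {B : ℝ}
    (hB : ∀ᵐ t ∂(volume.restrict S), eLpNorm (v t) 2 volume ≤ ENNReal.ofReal B) :
    MemLp (fun p : ℝ × Plane => v p.1 p.2) 4 ((volume.restrict S).prod volume) := by
  refine ⟨hv, ?_⟩
  obtain ⟨C, -, hC⟩ := exists_ladyzhenskaya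
  have key : ∀ᵐ t ∂(volume.restrict S), ∫⁻ x, ‖v t x‖ₑ ^ 4 ≤
      (ENNReal.ofReal C * ENNReal.ofReal B) ^ 2 * (4 * (∫⁻ x, ‖G t 0 x‖ₑ ^ 2) +
        4 * ∫⁻ x, ‖G t 1 x‖ₑ ^ 2) := by
    filter_upwards [h1, hB] with t ht hBt
    have h2 := hC _ _ ht
    rw [← eLpNorm_four_pow, ← eLpNorm_two_sq, ← eLpNorm_two_sq, show (4 : ℕ) = 2 * 2 by norm_num,
      pow_mul]
    calc _ ≤ (ENNReal.ofReal C * (ENNReal.ofReal B *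
            (eLpNorm (G t 0) 2 volume + eLpNorm (G t 1) 2 volume))) ^ 2 := by
          gcongr
          exact h2.trans (by gcongr)
      _ = (ENNReal.ofReal C * ENNReal.ofReal B) ^ 2 *
            (eLpNorm (G t 0) 2 volume + eLpNorm (G t 1) 2 volume) ^ 2 := by ring
      _ ≤ _ := by
          gcongr
          rcases le_total (eLpNorm (G t 0) 2 volume) (eLpNorm (G t 1) 2 volume) with hle | hle
          · refine le_trans (pow_le_pow_left' (add_le_add_left hle _) 2) (le_trans (le_of_eq ?_)
              le_add_self)
            ring
          · refine le_trans (pow_le_pow_left' (add_le_add_right hle _) 2) (le_trans (le_of_eq ?_)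
              le_self_add)
            ring
  have hfin : ∀ j, ∫⁻ t in S, ∫⁻ x, ‖G t j x‖ₑ ^ 2 < ⊤ := by
    intro j
    rw [← lintegral_prod (fun p : ℝ × Plane => ‖G p.1 j p.2‖ₑ ^ 2) ((hG j).1.enorm.pow_const 2),
      ← eLpNorm_two_sq]
    exact ENNReal.pow_lt_top (hG j).2
  have hm : ∀ j, AEMeasurable (fun t => ∫⁻ x, ‖G t j x‖ₑ ^ 2) (volume.restrict S) := fun j =>
    AEMeasurable.lintegral_prod_right' (f := fun p : ℝ × Plane => ‖G p.1 j p.2‖ₑ ^ 2)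
      ((hG j).1.enorm.pow_const 2)
  have h4 : eLpNorm (fun p : ℝ × Plane => v p.1 p.2) 4
      ((volume.restrict S).prod volume) ^ 4 < ⊤ := by
    rw [eLpNorm_four_pow, lintegral_prod _ (hv.enorm.pow_const 4)]
    refine (lintegral_mono_ae key).trans_lt ?_
    rw [lintegral_const_mul' _ _ (by finiteness), lintegral_add_left' ((hm 0).const_mul 4),
      lintegral_const_mul' _ _ (by finiteness), lintegral_const_mul' _ _ (by finiteness)]
    have := hfin 0
    have := hfin 1
    finiteness
  by_contra h
  rw [not_lt, top_le_iff] at h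
  simp [h] at h4

lemma isTestField_const {b : Plane → ℝ} {φ : Plane → Plane} (hφ : ContDiff ℝ ∞ φ)
    (hV : InV b φ (grad φ)) : IsTestField b (fun _ => φ) := by
  have hd : ∀ t, timeDeriv (fun _ => φ) t = fun _ => 0 := fun t => by
    ext x; simp [timeDeriv]
  refine ⟨hφ.comp contDiff_snd, fun t _ => ⟨?_, hV.divFree⟩,
    fun t _ i j => (hV.isH1 i).grad_memLp j,
    fun t _ => ?_, fun t _ => ?_, fun t _ i j => ?_, fun t _ => ?_⟩
  · exact memLp_piLp_iff.2 fun i => (hV.isH1 i).memLp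
  · rw [hd]
    exact ⟨MemLp.zero', fun θ _ _ => by simp⟩
  all_goals simpa [hd] using tendsto_const_nhds

section Energy

variable {ν : ℝ} {b η : Plane → ℝ} {b_i b_s M : ℝ} {f : ℝ → Plane → Plane} {u₀ : Plane → Plane}
  {u : ℝ → Plane → Plane} {Du : ℝ → Fin 2 → Fin 2 → Plane → ℝ}

lemma IsWeakSolutionWith.memLp_apply (hs : IsWeakSolutionWith ν b η f u₀ u Du) {t : ℝ}
    (ht : 0 ≤ t) (i : Fin 2) : MemLp (fun x => u t x i) 2 volume :=
  ShallowWater.memLp_apply (hs.memH t ht).1 i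

lemma IsWeakSolutionWith.ae_inV (hs : IsWeakSolutionWith ν b η f u₀ u Du) :
    ∀ᵐ t ∂(volume.restrict (Ici (0 : ℝ))), InV b (u t) (Du t) := by
  refine ae_restrict_Ici_of_Icc fun T hT => ?_
  have h1 : ∀ i j, ∀ᵐ t ∂(volume.restrict (Icc 0 T)), MemLp (Du t i j) 2 volume := by
    intro i j
    obtain ⟨N, -, hN⟩ := exists_memLp_curry measurableSet_Icc (F := fun t => Du t i j)
      (hs.grad_memLp T hT i j)
    filter_upwards [hN] with t ht
    exact (Lp.memLp (N t)).ae_eq ht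
  filter_upwards [eventually_all.2 fun i => eventually_all.2 (h1 i),
    ae_restrict_Icc_of_Ici hs.hasWeakGradient T, ae_restrict_mem measurableSet_Icc]
    with t h2 h3 h4
  have hL := (hs.memH t h4.1).1.locallyIntegrable (by norm_num)
  exact ⟨fun i => ⟨hs.memLp_apply h4.1 i, h2 i, (hasWeakGradient_iff hL).1 h3 i⟩,
    (hs.memH t h4.1).2⟩

lemma IsWeakSolutionWith.memLp_state (hs : IsWeakSolutionWith ν b η f u₀ u Du) {T : ℝ} (hT : 0 < T)
    (k : Idx) : MemLp (fun p : ℝ × Plane => state (u p.1) (Du p.1) k p.2) 2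
      ((volume.restrict (Icc 0 T)).prod volume) := by
  rcases k with ⟨i, _ | j⟩
  · exact ShallowWater.memLp_apply (hs.memLp T hT) i
  · exact hs.grad_memLp T hT i j

lemma memLp_snd_mul {m : Measure (ℝ × Plane)} {g : Plane → ℝ} (hg : Continuous g) {C : ℝ}
    (hC : ∀ x, |g x| ≤ C) {F : ℝ × Plane → ℝ} {p : ℝ≥0∞} (hF : MemLp F p m) :
    MemLp (fun q => g q.2 * F q) p m :=
  memLp_bounded_mul (hg.comp continuous_snd).aestronglyMeasurable (fun q => hC q.2) hF

lemma IsWeakSolutionWith.memLp_dissipState (h : Coefficients b η b_i b_s M)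
    (hs : IsWeakSolutionWith ν b η f u₀ u Du) {T : ℝ} (hT : 0 < T) (k : Idx) :
    MemLp (fun p : ℝ × Plane => dissipState η (u p.1) (Du p.1) k p.2) 2
      ((volume.restrict (Icc 0 T)).prod volume) := by
  rcases k with ⟨i, _ | j⟩
  · exact memLp_snd_mul h.smooth_η.continuous.sqrt h.abs_sqrt_η_le
      (ShallowWater.memLp_apply (hs.memLp T hT) i)
  · exact hs.grad_memLp T hT i j

lemma IsWeakSolutionWith.memLp_flux (h : Coefficients b η b_i b_s M)
    (hs : IsWeakSolutionWith ν b η f u₀ u Du) {T : ℝ} (hT : 0 < T) (k : Idx) :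
    MemLp (fun p : ℝ × Plane => flux ν b η (u p.1) (Du p.1) k p.2) 2
      ((volume.restrict (Icc 0 T)).prod volume) := by
  have hu := fun i => ShallowWater.memLp_apply (hs.memLp T hT) i
  have hD := hs.grad_memLp T hT
  obtain ⟨B, hB⟩ := hs.bounded T hT
  have hu4 : ∀ i, MemLp (fun p : ℝ × Plane => u p.1 p.2 i) 4
      ((volume.restrict (Icc 0 T)).prod volume) := by
    intro i
    refine memLp_four_of_isH1 (v := fun t x => u t x i) (G := fun t => Du t i) (hu i).1
      (fun j => hD i j) ?_ (B := B) ?_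
    · filter_upwards [ae_restrict_Icc_of_Ici hs.ae_inV T] with t ht using ht.isH1 i
    · filter_upwards [ae_restrict_mem measurableSet_Icc] with t ht
      exact (eLpNorm_apply_le _ i).trans (hB t ht)
  have hb := h.smooth_b.continuous
  rcases k with ⟨i, _ | j⟩
  · exact (memLp_snd_mul hb h.abs_b_le
      (memLp_snd_mul h.smooth_η.continuous h.abs_η_le (hu i))).neg
  · have hS : MemLp (fun p : ℝ × Plane => stress (Du p.1) i j p.2) 2
        ((volume.restrict (Icc 0 T)).prod volume) := by
      have e : (fun p : ℝ × Plane => stress (Du p.1) i j p.2) = fun p => (Du p.1 i j p.2 +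
          Du p.1 j i p.2) - (if i = j then 1 else 0) * ∑ k, Du p.1 k k p.2 := by
        ext p; simp [stress]
      rw [e]
      refine ((hD i j).add (hD j i)).sub (MemLp.const_mul ?_ _)
      simp only [Fin.sum_univ_two]
      exact (hD 0 0).add (hD 1 1)
    exact (memLp_snd_mul hb h.abs_b_le ((hu4 i).mul (hpqr := holderTriple_four) (hu4 j))).sub
      ((memLp_snd_mul hb h.abs_b_le hS).const_mul ν)

/-- The assumptions on the force that enter the energy identity. -/
structure IsForce (f : ℝ → Plane → Plane) (B : ℝ) : Prop where
  meas : AEStronglyMeasurable (fun p : ℝ × Plane => f p.1 p.2)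
      ((volume.restrict (Ici (0 : ℝ))).prod volume)
  bound : ∀ᵐ t ∂(volume.restrict (Ici (0 : ℝ))),
    MemLp (f t) 2 volume ∧ eLpNorm (f t) 2 volume ≤ ENNReal.ofReal B

lemma IsForce.memLp {B : ℝ} (hf : IsForce f B) (T : ℝ) :
    MemLp (fun p : ℝ × Plane => f p.1 p.2) 2 ((volume.restrict (Icc 0 T)).prod volume) := by
  have hm : AEStronglyMeasurable (fun p : ℝ × Plane => f p.1 p.2)
      ((volume.restrict (Icc 0 T)).prod volume) :=
    hf.meas.mono_ac ((Measure.absolutelyContinuous_of_le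
      (Measure.restrict_mono Icc_subset_Ici_self le_rfl)).prod Measure.AbsolutelyContinuous.rfl)
  refine ⟨hm, ?_⟩
  have : eLpNorm (fun p : ℝ × Plane => f p.1 p.2) 2 ((volume.restrict (Icc 0 T)).prod volume) ^ 2 <
      ⊤ := by
    rw [eLpNorm_two_sq, lintegral_prod _ (hm.enorm.pow_const 2)]
    have : ∀ᵐ t ∂(volume.restrict (Icc 0 T)), ∫⁻ x, ‖f t x‖ₑ ^ 2 ≤ ENNReal.ofReal B ^ 2 := by
      filter_upwards [ae_restrict_Icc_of_Ici hf.bound T] with t ht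
      rw [← eLpNorm_two_sq]
      exact pow_le_pow_left' ht.2 2
    refine (lintegral_mono_ae this).trans_lt ?_
    rw [lintegral_const]
    simp only [MeasurableSet.univ, Measure.restrict_apply, univ_inter, Real.volume_Icc]
    finiteness
  by_contra hc
  rw [not_lt, top_le_iff] at hc
  simp [hc] at this

lemma IsForce.memLp_forcing (h : Coefficients b η b_i b_s M) {B : ℝ} (hf : IsForce f B) (T : ℝ)
    (k : Idx) : MemLp (fun p : ℝ × Plane => forcing b (f p.1) k p.2) 2
      ((volume.restrict (Icc 0 T)).prod volume) := by
  rcases k with ⟨i, _ | j⟩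
  · exact memLp_snd_mul h.smooth_b.continuous h.abs_b_le (ShallowWater.memLp_apply (hf.memLp T) i)
  · exact MemLp.zero'

/-- The solution, the flux and the force on `[0, T]`, as curves in a Hilbert space. -/
structure Curves (ν : ℝ) (b η : Plane → ℝ) (f : ℝ → Plane → Plane) (u : ℝ → Plane → Plane)
    (Du : ℝ → Fin 2 → Fin 2 → Plane → ℝ) (T : ℝ) (U N₁ N₂ : ℝ → L2Family Idx) : Prop where
  memLp_state : MemLp U 2 volume
  memLp_flux : MemLp N₁ 2 volume
  memLp_force : MemLp N₂ 2 volume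
  represents : ∀ᵐ t ∂(volume.restrict (Icc 0 T)), InV b (u t) (Du t) ∧
    (∀ i, MemLp (fun x => f t x i) 2 volume) ∧ Represents (U t) (state (u t) (Du t)) ∧
    Represents (N₁ t) (flux ν b η (u t) (Du t)) ∧ Represents (N₂ t) (forcing b (f t))

lemma IsWeakSolutionWith.exists_curves (h : Coefficients b η b_i b_s M)
    (hs : IsWeakSolutionWith ν b η f u₀ u Du) {B : ℝ} (hf : IsForce f B) {T : ℝ} (hT : 0 < T) :
    ∃ U N₁ N₂, Curves ν b η f u Du T U N₁ N₂ := by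
  obtain ⟨U, hU, hU'⟩ := exists_memLp_represents (F := fun k t => state (u t) (Du t) k)
    measurableSet_Icc (hs.memLp_state hT)
  obtain ⟨N₁, h1, h1'⟩ := exists_memLp_represents (F := fun k t => flux ν b η (u t) (Du t) k)
    measurableSet_Icc (hs.memLp_flux h hT)
  obtain ⟨N₂, h2, h2'⟩ := exists_memLp_represents (F := fun k t => forcing b (f t) k)
    measurableSet_Icc (hf.memLp_forcing h T)
  refine ⟨U, N₁, N₂, hU, h1, h2, ?_⟩
  filter_upwards [hU', h1', h2', ae_restrict_Icc_of_Ici hs.ae_inV T,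
    ae_restrict_Icc_of_Ici hf.bound T] with t q1 q2 q3 q4 q5
  exact ⟨q4, fun i => ShallowWater.memLp_apply q5.1 i, q1, q2, q3⟩

lemma intervalIntegrable_of_memLp {H : Type*} [NormedAddCommGroup H] {N : ℝ → H}
    (hN : MemLp N 2 volume) (s t : ℝ) : IntervalIntegrable N volume s t :=
  ((hN.locallyIntegrable (by norm_num)).integrableOn_isCompact isCompact_uIcc).intervalIntegrable

lemma integral_inner_const {H : Type*} [NormedAddCommGroup H] [InnerProductSpace ℝ H]
    [CompleteSpace H] {N : ℝ → H} (hN : MemLp N 2 volume) (V : H) (s t : ℝ) :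
    ∫ τ in s..t, inner ℝ (N τ) V = inner ℝ (∫ τ in s..t, N τ) V := by
  have := (innerSL ℝ V).intervalIntegral_comp_comm (intervalIntegrable_of_memLp hN s t)
  simp only [innerSL_apply_apply] at this
  rw [real_inner_comm, ← this]
  simp only [real_inner_comm]

/-- The weak formulation, tested with a smooth time-independent field. -/
lemma Curves.pairing_smooth {T : ℝ} {U N₁ N₂ : ℝ → L2Family Idx}
    (hc : Curves ν b η f u Du T U N₁ N₂) (h : Coefficients b η b_i b_s M)
    (hs : IsWeakSolutionWith ν b η f u₀ u Du) {φ : Plane → Plane} (hφ : ContDiff ℝ ∞ φ)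
    (hV : InV b φ (grad φ)) {V : L2Family Idx} (hVr : Represents V (state φ (grad φ))) {t : ℝ}
    (ht : t ∈ Icc 0 T) :
    innerB b (u t) φ = innerB b u₀ φ + inner ℝ (∫ τ in (0 : ℝ)..t, (N₁ τ + N₂ τ)) V := by
  have key := hs.identity _ (isTestField_const hφ hV) t ht.1
  have hsub : ∀ᵐ τ ∂(volume.restrict (uIoc 0 t)), InV b (u τ) (Du τ) ∧
      (∀ i, MemLp (fun x => f τ x i) 2 volume) ∧ Represents (U τ) (state (u τ) (Du τ)) ∧
      Represents (N₁ τ) (flux ν b η (u τ) (Du τ)) ∧ Represents (N₂ τ) (forcing b (f τ)) := by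
    refine ae_restrict_of_ae_restrict_of_subset ?_ hc.represents
    rw [uIoc_of_le ht.1]
    exact fun x hx => ⟨hx.1.le, hx.2.trans ht.2⟩
  have hd : ∀ t, timeDeriv (fun _ => φ) t = fun _ => 0 := fun t => by
    ext x; simp [timeDeriv]
  have e1 : ∫ τ in (0 : ℝ)..t, (- innerB b (u τ) (timeDeriv (fun _ => φ) τ) +
      ν / 2 * stressForm b (Du τ) (grad φ) + innerB b (fun x => η x • u τ x) φ +
        convection b (u τ) (Du τ) φ) = ∫ τ in (0 : ℝ)..t, - inner ℝ (N₁ τ) V := by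
    refine intervalIntegral.integral_congr_ae_restrict ?_
    filter_upwards [hsub] with τ hτ
    rw [hτ.2.2.2.1.inner hVr, flux_pairing h hτ.1 hV, hd]
    simp [innerB]
  have e2 : ∫ τ in (0 : ℝ)..t, innerB b φ (f τ) = ∫ τ in (0 : ℝ)..t, inner ℝ (N₂ τ) V := by
    refine intervalIntegral.integral_congr_ae_restrict ?_
    filter_upwards [hsub] with τ hτ
    rw [hτ.2.2.2.2.inner hVr, forcing_pairing h hτ.2.1 fun i => (hV.isH1 i).memLp]
  rw [e1, e2, intervalIntegral.integral_neg, integral_inner_const hc.memLp_flux,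
    integral_inner_const hc.memLp_force] at key
  rw [intervalIntegral.integral_add (intervalIntegrable_of_memLp hc.memLp_flux _ _)
    (intervalIntegrable_of_memLp hc.memLp_force _ _), inner_add_left]
  linarith

lemma tendsto_innerB (h : Coefficients b η b_i b_s M) {w v : Plane → Plane} {φ : ℕ → Plane → Plane}
    (hw : ∀ i, MemLp (fun x => w x i) 2 volume) (hv : ∀ i, MemLp (fun x => v x i) 2 volume)
    (hφ : ∀ n i, MemLp (fun x => φ n x i) 2 volume)
    (ht : ∀ i, Tendsto (fun n => eLpNorm (fun x => φ n x i - v x i) 2 volume) atTop (𝓝 0)) :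
    Tendsto (fun n => innerB b w (φ n)) atTop (𝓝 (innerB b w v)) := by
  rw [innerB_eq_sum h hw hv]
  have e : ∀ n, innerB b w (φ n) = ∑ i, ∫ x, φ n x i * (b x * w x i) := fun n => by
    rw [innerB_eq_sum h hw (hφ n)]
    simp only [mul_comm]
  simp only [e, mul_comm (b _ * w _ _)]
  exact tendsto_finsetSum _ fun i _ => tendsto_integral_mul_of_tendsto_L2 (fun n => hφ n i) (hv i)
    (h.memLp_b_mul (hw i)) (ht i)

/-- The weak formulation, tested with any field in `V`. -/
lemma Curves.pairing {T : ℝ} {U N₁ N₂ : ℝ → L2Family Idx}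
    (hc : Curves ν b η f u Du T U N₁ N₂) (h : Coefficients b η b_i b_s M)
    (hs : IsWeakSolutionWith ν b η f u₀ u Du) (hu₀ : ∀ i, MemLp (fun x => u₀ x i) 2 volume)
    {v : Plane → Plane} {G : Fin 2 → Fin 2 → Plane → ℝ} (hV : InV b v G) {V : L2Family Idx}
    (hVr : Represents V (state v G)) {t : ℝ} (ht : t ∈ Icc 0 T) :
    innerB b (u t) v = innerB b u₀ v + inner ℝ (∫ τ in (0 : ℝ)..t, (N₁ τ + N₂ τ)) V := by
  have hδ : ∀ n : ℕ, (0 : ℝ) < 1 / (n + 1) := fun n => by positivity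
  choose φ hφ hdiv hφH using fun n => exists_smooth_divFree_approx h.pos h.smooth_b
    (fun x => ⟨h.lower x, h.upper x⟩) hV.isH1 hV.divFree (hδ n)
  have h0 : Tendsto (fun n : ℕ => ENNReal.ofReal (1 / ((n : ℝ) + 1))) atTop (𝓝 0) := by
    simpa using ENNReal.tendsto_ofReal tendsto_one_div_add_atTop_nhds_zero_nat
  have hin : ∀ n, InV b (φ n) (grad (φ n)) := fun n => ⟨fun i => (hφH n i).1, hdiv n⟩
  have t0 : ∀ i, Tendsto (fun n => eLpNorm (fun x => φ n x i - v x i) 2 volume) atTop (𝓝 0) :=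
    fun i => tendsto_of_tendsto_of_tendsto_of_le_of_le tendsto_const_nhds h0 (fun _ => zero_le)
      fun n => (hφH n i).2.1
  have t1 : ∀ i j, Tendsto (fun n => eLpNorm (fun x => grad (φ n) i j x - G i j x) 2 volume) atTop
      (𝓝 0) := fun i j => tendsto_of_tendsto_of_tendsto_of_le_of_le tendsto_const_nhds h0
        (fun _ => zero_le) fun n => (hφH n i).2.2 j
  choose W hW using fun n => exists_represents (hin n).memLp_state
  have hWt : Tendsto W atTop (𝓝 V) := by
    refine Represents.tendsto hW hVr fun k => ?_
    rcases k with ⟨i, _ | j⟩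
    · exact t0 i
    · exact t1 i j
  have l1 := tendsto_innerB h (hs.memLp_apply ht.1) (fun i => (hV.isH1 i).memLp)
    (fun n i => ((hin n).isH1 i).memLp) t0
  have l2 := tendsto_innerB h hu₀ (fun i => (hV.isH1 i).memLp)
    (fun n i => ((hin n).isH1 i).memLp) t0
  have l3 : Tendsto (fun n => inner ℝ (∫ τ in (0 : ℝ)..t, (N₁ τ + N₂ τ)) (W n)) atTop
      (𝓝 (inner ℝ (∫ τ in (0 : ℝ)..t, (N₁ τ + N₂ τ)) V)) := tendsto_const_nhds.inner hWt
  exact tendsto_nhds_unique l1 ((l2.add l3).congr fun n =>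
    (hc.pairing_smooth h hs (hφ n) (hin n) (hW n) ht).symm)

lemma innerB_comm (v w : Plane → Plane) : innerB b v w = innerB b w v := by
  simp only [innerB, mul_comm (v _ _)]

/-- The energy identity. -/
lemma Curves.energy_eq {T : ℝ} {U N₁ N₂ : ℝ → L2Family Idx}
    (hc : Curves ν b η f u Du T U N₁ N₂) (h : Coefficients b η b_i b_s M)
    (hs : IsWeakSolutionWith ν b η f u₀ u Du) (hu₀ : ∀ i, MemLp (fun x => u₀ x i) 2 volume)
    {t₁ t₂ : ℝ} (h1 : 0 ≤ t₁) (h12 : t₁ ≤ t₂) (h2 : t₂ < T) :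
    innerB b (u t₂) (u t₂) - innerB b (u t₁) (u t₁) =
      2 * ∫ τ in t₁..t₂, inner ℝ (N₁ τ + N₂ τ) (U τ) := by
  refine energy_identity (G := fun t s => innerB b (u t) (u s)) hc.memLp_state
    (hc.memLp_flux.add hc.memLp_force) ?_ (fun t _ s _ => innerB_comm _ _) ?_ h1 h12 h2
  · have := (ae_restrict_iff' measurableSet_Icc).1 hc.represents
    filter_upwards [this] with s hs' hsT t ht
    obtain ⟨q1, -, q2, -⟩ := hs' hsT
    have e1 := hc.pairing h hs hu₀ q1 q2 ht
    have e2 := hc.pairing h hs hu₀ q1 q2 ⟨le_rfl, ht.1.trans ht.2⟩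
    simp only [intervalIntegral.integral_same, inner_zero_left, add_zero] at e2
    simp only [e1, e2, Pi.add_apply]
  · intro t ht
    have := (hs.weaklyContinuous (u t) (hs.memH t ht.1)).mono
      (Icc_subset_Ici_self : Icc 0 T ⊆ Ici 0)
    exact this.congr fun s _ => innerB_comm _ _

end Energy

/-! ### A priori bounds -/

lemma exp_one_add_pos {t : ℝ} (ht : 0 ≤ t) : 0 < Real.exp 1 + t := by positivity

lemma one_le_exp_one_add {t : ℝ} (ht : 0 ≤ t) : 1 ≤ Real.exp 1 + t := by
  have := Real.one_le_exp (zero_le_one' ℝ)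
  linarith

/-- The decay rate of the force. -/
noncomputable def rate (t : ℝ) : ℝ := (Real.exp 1 + t) ^ (-2 : ℤ)

lemma rate_nonneg (t : ℝ) : 0 ≤ rate t := by
  unfold rate
  exact Even.zpow_nonneg (by decide) _

lemma continuousOn_rate : ContinuousOn rate (Ici 0) := by
  unfold rate
  refine ContinuousOn.zpow₀ (by fun_prop) _ fun t ht => Or.inl (exp_one_add_pos ht).ne'

lemma intervalIntegrable_rate {s t : ℝ} (hs : 0 ≤ s) (ht : 0 ≤ t) :
    IntervalIntegrable rate volume s t :=
  (continuousOn_rate.mono fun _ hx => (le_min hs ht).trans hx.1).intervalIntegrable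

lemma integral_rate {s t : ℝ} (hs : 0 ≤ s) (hst : s ≤ t) :
    ∫ τ in s..t, rate τ = 1 / (Real.exp 1 + s) - 1 / (Real.exp 1 + t) := by
  have := intervalIntegral.integral_eq_sub_of_hasDerivAt (a := s) (b := t)
    (f := fun τ => -(Real.exp 1 + τ)⁻¹) (f' := rate) (fun τ hτ => ?_)
    (intervalIntegrable_rate hs (hs.trans hst))
  · rw [this]; simp only [one_div]; ring
  · rw [uIcc_of_le hst] at hτ
    have hp := exp_one_add_pos (hs.trans hτ.1)
    have h1 := ((hasDerivAt_id τ).const_add (Real.exp 1)).inv hp.ne'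
    have h2 := h1.neg
    refine h2.congr_deriv ?_
    have e : rate τ = ((Real.exp 1 + τ) ^ 2)⁻¹ := by
      rw [rate, zpow_neg, zpow_ofNat]
    rw [e, id, neg_div, neg_neg, one_div]

lemma integral_rate_le {s t : ℝ} (hs : 0 ≤ s) (hst : s ≤ t) :
    ∫ τ in s..t, rate τ ≤ 1 / (Real.exp 1 + s) := by
  rw [integral_rate hs hst]
  have := one_div_pos.2 (exp_one_add_pos (hs.trans hst))
  linarith

section Apriori

variable {ν : ℝ} {b η : Plane → ℝ} {b_i b_s M : ℝ} {f : ℝ → Plane → Plane} {u₀ : Plane → Plane}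
  {u : ℝ → Plane → Plane} {Du : ℝ → Fin 2 → Fin 2 → Plane → ℝ}

lemma IsWeakSolutionWith.integrable_dissip (h : Coefficients b η b_i b_s M)
    (hs : IsWeakSolutionWith ν b η f u₀ u Du) {s t : ℝ} (hs0 : 0 ≤ s) (ht0 : 0 ≤ t) :
    IntervalIntegrable (fun τ => dissip η (u τ) (Du τ)) volume s t := by
  have hT : 0 < max s t + 1 := by positivity
  have h1 : Integrable (fun τ => dissip η (u τ) (Du τ))
      (volume.restrict (Icc 0 (max s t + 1))) := by
    unfold dissip
    exact integrable_finsetSum _ fun k _ =>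
      (hs.memLp_dissipState h hT k).integrable_sq.integral_prod_left
  rw [intervalIntegrable_iff]
  refine IntegrableOn.mono_set h1 fun x hx => ?_
  rw [uIoc, mem_Ioc] at hx
  exact ⟨((le_min hs0 ht0).trans hx.1.le), by linarith [hx.2]⟩

lemma intervalIntegrable_sqrt_dissip {s t : ℝ}
    (hi : IntervalIntegrable (fun τ => dissip η (u τ) (Du τ)) volume s t) :
    IntervalIntegrable (fun τ => √(dissip η (u τ) (Du τ))) volume s t := by
  rw [intervalIntegrable_iff] at hi ⊢
  have hc : Integrable (fun _ : ℝ => (1 : ℝ)) (volume.restrict (uIoc s t)) := by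
    rw [uIoc]; exact integrable_const 1
  refine Integrable.mono' (hi.add hc)
    (Real.continuous_sqrt.comp_aestronglyMeasurable hi.1) (Eventually.of_forall fun τ => ?_)
  rw [Real.norm_of_nonneg (Real.sqrt_nonneg _)]
  have h0 : 0 ≤ dissip η (u τ) (Du τ) := dissip_nonneg
  simp only [Pi.add_apply]
  nlinarith [Real.sq_sqrt h0, sq_nonneg (√(dissip η (u τ) (Du τ)) - 1),
    Real.sqrt_nonneg (dissip η (u τ) (Du τ))]

lemma integrable_inner_L2 {H : Type*} [NormedAddCommGroup H] [InnerProductSpace ℝ H]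
    {N U : ℝ → H} (hN : MemLp N 2 volume) (hU : MemLp U 2 volume) :
    Integrable (fun τ => inner ℝ (N τ) (U τ)) volume := by
  refine (L2.integrable_inner (𝕜 := ℝ) (hN.toLp N) (hU.toLp U)).congr ?_
  filter_upwards [hN.coeFn_toLp, hU.coeFn_toLp] with τ h1 h2
  rw [h1, h2]

lemma Curves.ae_uIoc {T : ℝ} {U N₁ N₂ : ℝ → L2Family Idx} (hc : Curves ν b η f u Du T U N₁ N₂)
    {s t : ℝ} (h1 : 0 ≤ s) (h2 : s ≤ t) (h3 : t ≤ T) :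
    ∀ᵐ τ ∂(volume.restrict (uIoc s t)), InV b (u τ) (Du τ) ∧
      (∀ i, MemLp (fun x => f τ x i) 2 volume) ∧ Represents (U τ) (state (u τ) (Du τ)) ∧
      Represents (N₁ τ) (flux ν b η (u τ) (Du τ)) ∧ Represents (N₂ τ) (forcing b (f τ)) := by
  refine ae_restrict_of_ae_restrict_of_subset ?_ hc.represents
  rw [uIoc_of_le h2]
  exact fun x hx => ⟨h1.trans hx.1.le, hx.2.trans h3⟩

lemma Curves.intervalIntegrable_inner {T : ℝ} {U N₁ N₂ : ℝ → L2Family Idx}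
    (hc : Curves ν b η f u Du T U N₁ N₂) (s t : ℝ) :
    IntervalIntegrable (fun τ => inner ℝ (N₁ τ + N₂ τ) (U τ)) volume s t := by
  have h1 : Integrable (fun τ => inner ℝ (N₁ τ + N₂ τ) (U τ)) volume :=
    integrable_inner_L2 (hc.memLp_flux.add hc.memLp_force) hc.memLp_state
  exact h1.intervalIntegrable

lemma IsWeakSolutionWith.energy_le (hν : 0 < ν) (h : Coefficients b η b_i b_s M)
    (hs : IsWeakSolutionWith ν b η f u₀ u Du) (hu₀ : ∀ i, MemLp (fun x => u₀ x i) 2 volume)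
    {B : ℝ} (hf : IsForce f B) {t₁ t₂ : ℝ} (h1 : 0 ≤ t₁) (h12 : t₁ ≤ t₂) {X : ℝ → ℝ}
    (hX : IntervalIntegrable X volume t₁ t₂)
    (hfX : ∀ᵐ τ ∂(volume.restrict (Ici (0 : ℝ))), τ ∈ Icc t₁ t₂ → innerB b (u τ) (f τ) ≤ X τ) :
    innerB b (u t₂) (u t₂) + 2 * (min ν 1 * b_i) * ∫ τ in t₁..t₂, dissip η (u τ) (Du τ) ≤
      innerB b (u t₁) (u t₁) + 2 * ∫ τ in t₁..t₂, X τ := by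
  obtain ⟨U, N₁, N₂, hc⟩ := hs.exists_curves h hf (T := t₂ + 1) (by linarith)
  have key := hc.energy_eq h hs hu₀ h1 h12 (by linarith)
  have hd := hs.integrable_dissip h h1 (h1.trans h12)
  have hle : ∫ τ in t₁..t₂, inner ℝ (N₁ τ + N₂ τ) (U τ) ≤
      ∫ τ in t₁..t₂, (X τ - min ν 1 * b_i * dissip η (u τ) (Du τ)) := by
    refine intervalIntegral.integral_mono_ae_restrict h12 (hc.intervalIntegrable_inner _ _)
      (hX.sub (hd.const_mul _)) ?_
    have hr := hc.ae_uIoc h1 h12 (by linarith)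
    rw [uIoc_of_le h12, Measure.restrict_congr_set Ioc_ae_eq_Icc] at hr
    filter_upwards [hr, ae_restrict_mem measurableSet_Icc,
      ae_restrict_of_ae_restrict_of_subset (fun x hx => h1.trans hx.1 : Icc t₁ t₂ ⊆ Ici 0) hfX]
      with τ q1 q2 q3
    obtain ⟨r1, r2, r3, r4, r5⟩ := q1
    rw [inner_add_left, r4.inner r3, r5.inner r3,
      forcing_pairing h r2 fun i => (r1.isH1 i).memLp]
    have := flux_pairing_self_le hν h r1
    have := q3 q2
    linarith
  rw [intervalIntegral.integral_sub hX (hd.const_mul _), intervalIntegral.integral_const_mul] at hle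
  linarith

lemma innerB_le_half (h : Coefficients b η b_i b_s M) {v w : Plane → Plane}
    (hv : ∀ i, MemLp (fun x => v x i) 2 volume) (hw : ∀ i, MemLp (fun x => w x i) 2 volume) :
    innerB b v w ≤ innerB b v v / 2 + innerB b w w / 2 := by
  rw [innerB_eq_sum h hv hw, innerB_eq_sum h hv hv, innerB_eq_sum h hw hw, Finset.sum_div,
    Finset.sum_div, ← Finset.sum_add_distrib]
  refine Finset.sum_le_sum fun i _ => ?_
  have i1 := integrable_mul_L2 (h.memLp_b_mul (hv i)) (hv i)
  have i2 := integrable_mul_L2 (h.memLp_b_mul (hw i)) (hw i)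
  rw [← integral_div, ← integral_div, ← integral_add (i1.div_const 2) (i2.div_const 2)]
  refine integral_mono_ae (integrable_mul_L2 (h.memLp_b_mul (hv i)) (hw i))
    ((i1.div_const 2).add (i2.div_const 2)) (Eventually.of_forall fun x => ?_)
  have := mul_nonneg (h.b_pos x).le (sq_nonneg (v x i - w x i))
  simp only
  linarith

/-- The energy at time zero is at most that of the initial datum.  Since `u₀` need not be
divergence-free, `u 0` is only its projection: the weak formulation is tested with `u s` for times
`s` near zero. -/
lemma IsWeakSolutionWith.energy_zero_le (h : Coefficients b η b_i b_s M)
    (hs : IsWeakSolutionWith ν b η f u₀ u Du) (hu₀ : ∀ i, MemLp (fun x => u₀ x i) 2 volume)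
    {B : ℝ} (hf : IsForce f B) : innerB b (u 0) (u 0) ≤ innerB b u₀ u₀ := by
  obtain ⟨U, N₁, N₂, hc⟩ := hs.exists_curves h hf (T := 1) one_pos
  have hE : Tendsto (fun s => innerB b (u s) (u s)) (𝓝[>] 0) (𝓝 (innerB b (u 0) (u 0))) := by
    have h1 := intervalIntegral.continuous_primitive (μ := volume)
      (fun s t => hc.intervalIntegrable_inner s t) 0
    have h2 := (h1.tendsto 0).mono_left (nhdsWithin_le_nhds (s := Ioi 0))
    rw [intervalIntegral.integral_same] at h2
    have h3 := (h2.const_mul 2).add_const (innerB b (u 0) (u 0))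
    rw [mul_zero, zero_add] at h3
    refine h3.congr' ?_
    filter_upwards [Ioo_mem_nhdsGT (zero_lt_one' ℝ)] with s hs'
    have := hc.energy_eq h hs hu₀ le_rfl hs'.1.le hs'.2
    linarith
  have hW : Tendsto (fun s => innerB b (u s) (u 0)) (𝓝[>] 0) (𝓝 (innerB b (u 0) (u 0))) :=
    ((hs.weaklyContinuous (u 0) (hs.memH 0 le_rfl)) 0 self_mem_Ici).mono_left
      (nhdsWithin_mono _ Ioi_subset_Ici_self)
  have hfr : ∃ᶠ s in 𝓝[>] (0 : ℝ), innerB b (u s) (u 0) ≤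
      innerB b u₀ u₀ / 2 + innerB b (u s) (u s) / 2 := by
    rw [frequently_iff]
    intro A hA
    obtain ⟨ε, hε, hA'⟩ := mem_nhdsGT_iff_exists_Ioo_subset.1 hA
    have hε0 : (0 : ℝ) < min ε 1 := lt_min hε one_pos
    have hne : volume.restrict (Ioo 0 (min ε 1)) ≠ 0 := by
      rw [Ne, Measure.restrict_eq_zero, Real.volume_Ioo]
      simpa using hε0
    have : (ae (volume.restrict (Ioo 0 (min ε 1)))).NeBot := ae_neBot.2 hne
    have hr := ae_restrict_of_ae_restrict_of_subset
      (fun x hx => ⟨hx.1.le, (hx.2.trans_le (min_le_right _ _)).le⟩ : Ioo 0 (min ε 1) ⊆ Icc 0 1)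
      hc.represents
    obtain ⟨s, hs1, hs2⟩ := (hr.and (ae_restrict_mem measurableSet_Ioo)).exists
    refine ⟨s, hA' ⟨hs2.1, hs2.2.trans_le (min_le_left _ _)⟩, ?_⟩
    have e := hc.pairing h hs hu₀ hs1.1 hs1.2.2.1 ⟨le_rfl, zero_le_one⟩
    rw [intervalIntegral.integral_same, inner_zero_left, add_zero] at e
    rw [innerB_comm, e]
    exact innerB_le_half h hu₀ (hs.memLp_apply hs2.1.le)
  have := le_of_tendsto_of_tendsto_of_frequently hW ((hE.div_const 2).const_add _) hfr
  linarith

lemma l2_apply_le {v : Plane → Plane} {B : ℝ} (hB0 : 0 ≤ B)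
    (hB : eLpNorm v 2 volume ≤ ENNReal.ofReal B) (i : Fin 2) : l2 (fun x => v x i) ≤ B :=
  ENNReal.toReal_le_of_le_ofReal hB0 ((eLpNorm_apply_le v i).trans hB)

/-- The assumptions on the force, with the decay in time. -/
structure IsDecayingForce (f : ℝ → Plane → Plane) (κ : ℝ) : Prop where
  nonneg : 0 ≤ κ
  meas : AEStronglyMeasurable (fun p : ℝ × Plane => f p.1 p.2)
      ((volume.restrict (Ici (0 : ℝ))).prod volume)
  bound : ∀ᵐ t ∂(volume.restrict (Ici (0 : ℝ))),
    MemLp (f t) 2 volume ∧ eLpNorm (f t) 2 volume ≤ ENNReal.ofReal (κ * rate t)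

lemma rate_le_one {t : ℝ} (ht : 0 ≤ t) : rate t ≤ 1 := by
  rw [rate, zpow_neg, zpow_ofNat]
  exact inv_le_one_of_one_le₀ (one_le_pow₀ (one_le_exp_one_add ht))

lemma IsDecayingForce.isForce {κ : ℝ} (hf : IsDecayingForce f κ) : IsForce f κ := by
  refine ⟨hf.meas, ?_⟩
  filter_upwards [hf.bound, ae_restrict_mem measurableSet_Ici] with t ht h0
  refine ⟨ht.1, ht.2.trans (ENNReal.ofReal_le_ofReal ?_)⟩
  exact mul_le_of_le_one_right hf.nonneg (rate_le_one h0)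

lemma IsDecayingForce.ae_abs_innerB_le (h : Coefficients b η b_i b_s M) {κ : ℝ}
    (hf : IsDecayingForce f κ) :
    ∀ᵐ τ ∂(volume.restrict (Ici (0 : ℝ))), ∀ (v : Plane → Plane) (B : ℝ),
      (∀ i, MemLp (fun x => v x i) 2 volume) → (∀ i, l2 (fun x => v x i) ≤ B) →
      |innerB b v (f τ)| ≤ 2 * b_s * B * κ * rate τ := by
  filter_upwards [hf.bound] with τ hτ v B hv hB
  have hB0 : 0 ≤ B := (l2_nonneg _).trans (hB 0)
  have hκ : 0 ≤ κ * rate τ := mul_nonneg hf.nonneg (rate_nonneg τ)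
  refine (abs_innerB_le h hv (ShallowWater.memLp_apply hτ.1)).trans ?_
  have : ∀ i, l2 (fun x => v x i) * l2 (fun x => f τ x i) ≤ B * (κ * rate τ) := fun i =>
    mul_le_mul (hB i) (l2_apply_le hκ hτ.2 i) (l2_nonneg _) hB0
  have h2 := mul_le_mul_of_nonneg_left (Finset.sum_le_sum fun i (_ : i ∈ Finset.univ) => this i)
    h.b_s_pos.le
  refine h2.trans (le_of_eq ?_)
  simp; ring

lemma le_of_le_add_mul_sqrt {S A k : ℝ} (hS : 0 ≤ S) (h : S ≤ A + k * √S) :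
    S ≤ 2 * A + k ^ 2 := by
  have h1 := Real.sq_sqrt hS
  nlinarith [sq_nonneg (√S - k)]

/-- A bound on the energy, depending only on the data. -/
lemma exists_energy_bound (hν : 0 < ν) (h : Coefficients b η b_i b_s M)
    (hu₀ : ∀ i, MemLp (fun x => u₀ x i) 2 volume) {κ : ℝ} (hf : IsDecayingForce f κ) :
    ∃ U : ℝ, 0 ≤ U ∧ ∀ u Du, IsWeakSolutionWith ν b η f u₀ u Du → ∀ t, 0 ≤ t → ∀ i,
      l2 (fun x => u t x i) ≤ U := by
  set k := 4 * b_s * κ / √b_i with hk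
  set Em := 2 * innerB b u₀ u₀ + k ^ 2 with hEm
  refine ⟨√(Em / b_i), Real.sqrt_nonneg _, fun u Du hs t ht i => ?_⟩
  have hl : ∀ t, 0 ≤ t → ∀ i, l2 (fun x => u t x i) ≤ √(innerB b (u t) (u t) / b_i) := by
    intro t ht i
    refine Real.le_sqrt_of_sq_le ((le_div_iff₀ h.pos).2 ?_)
    rw [mul_comm]
    exact le_innerB_self h (hs.memLp_apply ht) i
  have hE0 : ∀ t, 0 ≤ t → 0 ≤ innerB b (u t) (u t) := fun t ht =>
    (mul_nonneg h.pos.le (sq_nonneg _)).trans (le_innerB_self h (hs.memLp_apply ht) 0)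
  refine (hl t ht i).trans (Real.sqrt_le_sqrt (div_le_div_of_nonneg_right ?_ h.pos.le))
  -- The energy is bounded on `[0, t]`; its supremum there satisfies a quadratic inequality.
  have hbdd : BddAbove ((fun s => innerB b (u s) (u s)) '' Icc 0 t) := by
    obtain ⟨B, hB⟩ := hs.bounded (t + 1) (by linarith)
    refine ⟨b_s * ∑ _i : Fin 2, |B| * |B|, ?_⟩
    rintro _ ⟨s, hs', rfl⟩
    refine (le_abs_self _).trans ((abs_innerB_le h (hs.memLp_apply hs'.1)
      (hs.memLp_apply hs'.1)).trans ?_)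
    refine mul_le_mul_of_nonneg_left (Finset.sum_le_sum fun i _ => ?_) h.b_s_pos.le
    have := l2_apply_le (abs_nonneg B) ((hB s ⟨hs'.1, by linarith [hs'.2]⟩).trans
      (ENNReal.ofReal_le_ofReal (le_abs_self B))) i
    exact mul_le_mul this this (l2_nonneg _) (abs_nonneg _)
  set S := sSup ((fun s => innerB b (u s) (u s)) '' Icc 0 t) with hS
  have hSle : ∀ s ∈ Icc 0 t, innerB b (u s) (u s) ≤ S := fun s hs' =>
    le_csSup hbdd (mem_image_of_mem _ hs')
  have hS0 : 0 ≤ S := (hE0 t ht).trans (hSle t ⟨ht, le_rfl⟩)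
  have hstep : ∀ s ∈ Icc 0 t, innerB b (u s) (u s) ≤ innerB b u₀ u₀ + k * √S := by
    intro s hs'
    set A := 2 * b_s * √(S / b_i) * κ
    have hA : 0 ≤ A := by have := h.b_s_pos; have := hf.nonneg; positivity
    have key := hs.energy_le hν h hu₀ hf.isForce le_rfl hs'.1 (X := fun τ => A * rate τ)
      ((intervalIntegrable_rate le_rfl hs'.1).const_mul A) (by
        filter_upwards [hf.ae_abs_innerB_le h, ae_restrict_mem measurableSet_Ici]
          with τ q1 q2 q3
        refine (le_abs_self _).trans (q1 _ _ (hs.memLp_apply q2) fun i => (hl τ q2 i).trans ?_)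
        exact Real.sqrt_le_sqrt (div_le_div_of_nonneg_right (hSle τ ⟨q2, q3.2.trans hs'.2⟩)
          h.pos.le))
    have hd : 0 ≤ 2 * (min ν 1 * b_i) * ∫ τ in (0 : ℝ)..s, dissip η (u τ) (Du τ) := by
      have h0 := intervalIntegral.integral_nonneg (μ := volume) hs'.1
        fun τ _ => (dissip_nonneg : 0 ≤ dissip η (u τ) (Du τ))
      have := h.pos
      positivity
    rw [intervalIntegral.integral_const_mul] at key
    have hr : ∫ τ in (0 : ℝ)..s, rate τ ≤ 1 := by
      refine (integral_rate_le le_rfl hs'.1).trans ?_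
      rw [add_zero, div_le_one (Real.exp_pos _)]
      exact Real.one_le_exp zero_le_one
    have h0 := hs.energy_zero_le h hu₀ hf.isForce
    have hAk : 2 * A = k * √S := by
      simp only [A, hk, Real.sqrt_div hS0]; ring
    nlinarith
  have hSS : S ≤ innerB b u₀ u₀ + k * √S := by
    refine csSup_le ⟨_, mem_image_of_mem _ ⟨le_rfl, ht⟩⟩ ?_
    rintro _ ⟨s, hs', rfl⟩
    exact hstep s hs'
  exact (hSle t ⟨ht, le_rfl⟩).trans (le_of_le_add_mul_sqrt hS0 hSS)

/-- The information on a weak solution that enters the proof of decay, with constants that depend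
only on the data.  The field `energy` says that the energy plus `C / (e + t)`, which absorbs the
work of the force, is a Lyapunov function.  The field `duhamel` is the weak formulation on `[0, s]`
tested with the field `u s`, for almost every `s`. -/
structure Apriori (b η : Plane → ℝ) (f : ℝ → Plane → Plane) (u₀ : Plane → Plane)
    (u : ℝ → Plane → Plane) (Du : ℝ → Fin 2 → Fin 2 → Plane → ℝ) (c U C : ℝ) : Prop where
  memLp : ∀ t, 0 ≤ t → ∀ i, MemLp (fun x => u t x i) 2 volume
  bound : ∀ t, 0 ≤ t → ∀ i, l2 (fun x => u t x i) ≤ U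
  inV : ∀ᵐ t ∂(volume.restrict (Ici (0 : ℝ))), InV b (u t) (Du t)
  integrable : ∀ s t, 0 ≤ s → 0 ≤ t →
    IntervalIntegrable (fun τ => dissip η (u τ) (Du τ)) volume s t
  energy : ∀ s t, 0 ≤ s → s ≤ t →
    innerB b (u t) (u t) + C / (Real.exp 1 + t) + c * ∫ τ in s..t, dissip η (u τ) (Du τ) ≤
      innerB b (u s) (u s) + C / (Real.exp 1 + s)
  duhamel : ∀ᵐ s ∂(volume.restrict (Ici (0 : ℝ))), ∀ X : ℝ → ℝ, IntervalIntegrable X volume 0 s →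
    (∀ᵐ τ ∂(volume.restrict (Ici (0 : ℝ))), |innerB b (u s) (f τ)| ≤ X τ) →
    innerB b (u s) (u s) ≤ innerB b u₀ (u s) +
      ∫ τ in (0 : ℝ)..s, (C * (√(dissip η (u τ) (Du τ)) * √(dissip η (u s) (Du s))) + X τ)

lemma exists_apriori (hν : 0 < ν) (h : Coefficients b η b_i b_s M)
    (hu₀ : ∀ i, MemLp (fun x => u₀ x i) 2 volume) {κ : ℝ} (hf : IsDecayingForce f κ) :
    ∃ c U C : ℝ, 0 < c ∧ 0 ≤ U ∧ 0 ≤ C ∧ ∀ u Du, IsWeakSolutionWith ν b η f u₀ u Du →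
      Apriori b η f u₀ u Du c U C := by
  obtain ⟨U, hU, hUb⟩ := exists_energy_bound hν h hu₀ hf
  obtain ⟨K, hK, hKb⟩ := exists_abs_flux_pairing_le hν h hU
  have hbs := h.b_s_pos
  have hbi := h.pos
  have hκ := hf.nonneg
  set C₁ := 2 * (2 * b_s * U * κ)
  have hC₁ : 0 ≤ C₁ := by positivity
  refine ⟨2 * (min ν 1 * b_i), U, C₁ + K, by positivity, hU, by positivity, fun u Du hs =>
    ⟨fun t ht => hs.memLp_apply ht, hUb u Du hs, hs.ae_inV,
      fun s t hs' ht => hs.integrable_dissip h hs' ht, ?_, ?_⟩⟩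
  · intro s t h0 hst
    have key := hs.energy_le hν h hu₀ hf.isForce h0 hst (X := fun τ => 2 * b_s * U * κ * rate τ)
      ((intervalIntegrable_rate h0 (h0.trans hst)).const_mul _) (by
        filter_upwards [hf.ae_abs_innerB_le h, ae_restrict_mem measurableSet_Ici]
          with τ q1 q2 q3
        exact (le_abs_self _).trans (q1 _ _ (hs.memLp_apply q2) (hUb u Du hs τ q2)))
    rw [intervalIntegral.integral_const_mul, integral_rate h0 hst] at key
    have h1 : K / (Real.exp 1 + t) ≤ K / (Real.exp 1 + s) :=
      div_le_div_of_nonneg_left hK (exp_one_add_pos h0) (by linarith)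
    simp only [add_div]
    have h2 : ∀ r : ℝ, C₁ / (Real.exp 1 + r) = C₁ * (1 / (Real.exp 1 + r)) := fun r => by ring
    rw [h2, h2]
    linarith
  · refine ae_restrict_Ici_of_Icc fun T hT => ?_
    obtain ⟨V, N₁, N₂, hc⟩ := hs.exists_curves h hf.isForce hT
    filter_upwards [hc.represents, ae_restrict_mem measurableSet_Icc] with s q1 q2 X hX hfX
    obtain ⟨r1, -, r2, -⟩ := q1
    have hN : MemLp (fun τ => N₁ τ + N₂ τ) 2 volume := hc.memLp_flux.add hc.memLp_force
    rw [hc.pairing h hs hu₀ r1 r2 q2, ← integral_inner_const hN]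
    have hd := intervalIntegrable_sqrt_dissip (hs.integrable_dissip h le_rfl q2.1)
    gcongr
    refine intervalIntegral.integral_mono_ae_restrict q2.1 ?_ ?_ ?_
    · rw [intervalIntegrable_iff]
      exact (intervalIntegrable_iff.1 (intervalIntegrable_of_memLp hN 0 s)).inner_const _
    · exact ((hd.mul_const _).const_mul _).add hX
    · have hr := hc.ae_uIoc le_rfl q2.1 q2.2
      rw [uIoc_of_le q2.1, Measure.restrict_congr_set Ioc_ae_eq_Icc] at hr
      filter_upwards [hr, ae_restrict_mem measurableSet_Icc, ae_restrict_Icc_of_Ici hfX s]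
        with τ p1 p2 p3
      obtain ⟨m1, m2, m3, m4, m5⟩ := p1
      rw [inner_add_left, m4.inner r2, m5.inner r2, forcing_pairing h m2 fun i => (r1.isH1 i).memLp]
      have k1 := (le_abs_self _).trans (hKb _ _ _ _ m1 r1 (hUb u Du hs τ p2.1))
      have k2 := (le_abs_self _).trans p3
      have k3 : 0 ≤ C₁ * (√(dissip η (u τ) (Du τ)) * √(dissip η (u s) (Du s))) := by positivity
      linarith

end Apriori

/-! ### The force as a first derivative -/

lemma exists_eLpNorm_moll_sub_moll_le : ∃ C : ℝ≥0∞, C ≠ ⊤ ∧ ∀ (ε : ℝ) (v w : Plane → ℝ),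
    MemLp v 2 volume → MemLp w 2 volume →
    eLpNorm (fun x => moll ε v x - moll ε w x) 2 volume ≤
      C * eLpNorm (fun x => v x - w x) 2 volume := by
  obtain ⟨D, -, hD⟩ := exists_kernel_bound
  refine ⟨disc univ * ENNReal.ofReal D, by finiteness, fun ε v w hv hw => ?_⟩
  have hi := integrable_shiftAvg_integrand (κ := disc) (measurable_moll_shift ε)
    measurable_kernel hD hv
  have hj := integrable_shiftAvg_integrand (κ := disc) (measurable_moll_shift ε)
    measurable_kernel hD hw
  have e : (fun x => moll ε v x - moll ε w x) =ᵐ[volume] moll ε (fun x => v x - w x) := by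
    filter_upwards [hi, hj] with x h1 h2
    simp only [moll, shiftAvg]
    rw [← integral_sub h1 h2]
    simp only [smul_sub]
  rw [eLpNorm_congr_ae e, mul_assoc]
  exact eLpNorm_shiftAvg_le (measurable_moll_shift ε) measurable_kernel hD (hv.sub hw).1

lemma partialDeriv_comp_const_sub (θ : Plane → ℝ) (hθ : ContDiff ℝ ∞ θ) (j : Fin 2) (a x : Plane) :
    partialDeriv (fun z => θ (a - z)) j x = - partialDeriv θ j (a - x) := by
  have h1 : HasFDerivAt (fun z => a - z) (-ContinuousLinearMap.id ℝ Plane) x :=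
    (hasFDerivAt_id x).const_sub a
  have h2 := ((hθ.differentiable (by simp)) (a - x)).hasFDerivAt.comp x h1
  have h3 : fderiv ℝ (fun z => θ (a - z)) x = _ := h2.fderiv
  rw [partialDeriv, h3]
  simp [partialDeriv]

lemma partialDeriv_scaled_kernel (ε : ℝ) (j : Fin 2) (z : Plane) :
    partialDeriv (fun z : Plane => (ε ^ 2)⁻¹ * kernel (ε⁻¹ • z)) j z =
      (ε⁻¹) ^ 3 * partialDeriv kernel j (ε⁻¹ • z) := by
  have h1 : fderiv ℝ (fun z : Plane => kernel (ε⁻¹ • z)) z = ε⁻¹ • fderiv ℝ kernel (ε⁻¹ • z) :=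
    fderiv_comp_smul (f := kernel) (x := z) ε⁻¹
  have hd : DifferentiableAt ℝ (fun z : Plane => kernel (ε⁻¹ • z)) z :=
    (contDiff_kernel.comp (contDiff_const_smul _)).differentiable (by simp) z
  rw [partialDeriv, fderiv_const_mul hd, h1]
  simp only [partialDeriv, _root_.smul_apply, smul_eq_mul]
  ring

/-- Mollified derivatives are bounded by the `L⁴` norm. -/
lemma exists_abs_moll_partialDeriv_le : ∃ C : ℝ, 0 ≤ C ∧ ∀ (ε : ℝ) (θ : Plane → ℝ) (j : Fin 2)
    (x : Plane), 0 < ε → ε ≤ 1 → ContDiff ℝ ∞ θ → HasCompactSupport θ →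
    |moll ε (partialDeriv θ j) x| ≤ C * (ε⁻¹) ^ 3 * l4 θ := by
  obtain ⟨D, hD0, hD⟩ : ∃ D, 0 ≤ D ∧ ∀ j y, |partialDeriv kernel j y| ≤ D := by
    have := fun j => exists_bound_of_hasCompactSupport
      (contDiff_partialDeriv contDiff_kernel j).continuous
      (hasCompactSupport_partialDeriv hasCompactSupport_kernel j)
    choose d hd0 hd using this
    refine ⟨d 0 + d 1, add_nonneg (hd0 0) (hd0 1), fun j y => (hd j y).trans ?_⟩
    have := hd0 0
    have := hd0 1
    fin_cases j <;> simp only [Fin.zero_eta, Fin.mk_one] <;> linarith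
  set V : ℝ := ((disc univ) ^ (1 / (1 : ℝ≥0∞).toReal - 1 / (4 : ℝ≥0∞).toReal)).toReal with hV
  have hVfin : (disc univ) ^ (1 / (1 : ℝ≥0∞).toReal - 1 / (4 : ℝ≥0∞).toReal) ≠ ⊤ := by
    refine ENNReal.rpow_ne_top_of_nonneg ?_ (by finiteness)
    norm_num
  refine ⟨D * V, mul_nonneg hD0 ENNReal.toReal_nonneg, fun ε θ j x hε hε1 hθ hc => ?_⟩
  have hθx : ContDiff ℝ ∞ (fun z => θ (x - z)) := hθ.comp (contDiff_const.sub contDiff_id)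
  have e1 : moll ε (partialDeriv θ j) x =
      ∫ z in Metric.closedBall (0 : Plane) 1,
        (ε⁻¹) ^ 3 * partialDeriv kernel j (ε⁻¹ • z) * θ (x - z) := by
    have h1 := (IsWeakGrad.of_contDiff hθx).integral_eq _ (contDiff_scaled_kernel ε)
      (hasCompactSupport_scaled_kernel hε) j
    simp only [partialDeriv_comp_const_sub θ hθ, partialDeriv_scaled_kernel] at h1
    rw [moll_eq_convolution hε, convolution_def]
    have h2 : ∫ t, (ContinuousLinearMap.lsmul ℝ ℝ) ((ε ^ 2)⁻¹ * kernel (ε⁻¹ • t))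
        (partialDeriv θ j (x - t)) =
        - ∫ t, -partialDeriv θ j (x - t) * ((ε ^ 2)⁻¹ * kernel (ε⁻¹ • t)) := by
      rw [← integral_neg]
      congr 1; ext t
      simp; ring
    rw [h2, ← h1, setIntegral_eq_integral_of_forall_compl_eq_zero]
    · congr 1; ext z; ring
    · intro z hz
      have : partialDeriv kernel j (ε⁻¹ • z) = 0 := by
        refine (partialDeriv_eqOn (χ := fun _ => 0) Metric.isClosed_closedBall.isOpen_compl
          (fun y hy => kernel_eq_zero hy) j _ ?_).trans (partialDeriv_zero j _)
        simp only [mem_compl_iff, Metric.mem_closedBall, dist_zero_right, not_le] at hz ⊢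
        rw [norm_smul, norm_inv, Real.norm_of_nonneg hε.le]
        have : 1 ≤ ε⁻¹ := (one_le_inv₀ hε).2 hε1
        nlinarith [norm_nonneg z]
      rw [this]; ring
  have hm : AEStronglyMeasurable (fun z => θ (x - z)) disc := hθx.continuous.aestronglyMeasurable
  have h3 : eLpNorm (fun z => θ (x - z)) 1 disc ≤ ENNReal.ofReal (V * l4 θ) := by
    refine (eLpNorm_le_eLpNorm_mul_rpow_measure_univ (p := 1) (q := 4) (by norm_num) hm).trans ?_
    have h4 : eLpNorm (fun z => θ (x - z)) 4 volume = eLpNorm θ 4 volume :=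
      eLpNorm_comp_measurePreserving (g := θ) (f := fun z => x - z)
        (hθ.continuous.aestronglyMeasurable (μ := volume))
        (Measure.measurePreserving_sub_left volume x)
    rw [ENNReal.ofReal_mul ENNReal.toReal_nonneg, ENNReal.ofReal_toReal hVfin, mul_comm, l4,
      ENNReal.ofReal_toReal (memLp_of_test hθ hc 4).2.ne, ← h4]
    exact mul_le_mul_right (eLpNorm_mono_measure _ Measure.restrict_le_self) _
  have h5 : ‖∫ z in Metric.closedBall (0 : Plane) 1,
      (ε⁻¹) ^ 3 * partialDeriv kernel j (ε⁻¹ • z) * θ (x - z)‖ₑ ≤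
      ENNReal.ofReal (D * (ε⁻¹) ^ 3) * ENNReal.ofReal (V * l4 θ) := by
    refine (enorm_integral_le_lintegral_enorm _).trans (le_trans ?_ (mul_le_mul_right h3 _))
    rw [eLpNorm_one_eq_lintegral_enorm, ← lintegral_const_mul' _ _ (by finiteness)]
    refine lintegral_mono fun z => ?_
    rw [enorm_mul]
    gcongr
    rw [← ofReal_norm, norm_mul, Real.norm_of_nonneg (by positivity), mul_comm]
    exact ENNReal.ofReal_le_ofReal (mul_le_mul_of_nonneg_right (hD _ _) (by positivity))
  have h6 : 0 ≤ V * l4 θ := mul_nonneg ENNReal.toReal_nonneg (l4_nonneg _)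
  rw [e1, ← Real.norm_eq_abs]
  rw [← ofReal_norm, ← ENNReal.ofReal_mul (by positivity),
    ENNReal.ofReal_le_ofReal_iff (by positivity)] at h5
  exact h5.trans (le_of_eq (by ring))

/-- Mollified functions, paired with a derivative of an integrable function. -/
lemma exists_abs_integral_mul_moll_le : ∃ C : ℝ, 0 ≤ C ∧ ∀ (F : Plane → Plane)
    (g : Fin 2 → Plane → Plane) (m ε : ℝ) (z : Plane → ℝ) (Z : Fin 2 → Plane → ℝ) (i : Fin 2),
    IsFirstDerivOf F g → MemLp (fun x => F x i) 2 volume → 0 ≤ m →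
    (∀ j, eLpNorm (g j) 1 volume ≤ ENNReal.ofReal m) → 0 < ε → ε ≤ 1 → IsH1 z Z →
    |∫ x, moll ε z x * F x i| ≤ C * m * (ε⁻¹) ^ 3 * l4 z := by
  obtain ⟨C, hC0, hC⟩ := exists_abs_moll_partialDeriv_le
  obtain ⟨D, hD, hDm⟩ := exists_eLpNorm_moll_sub_moll_le
  refine ⟨2 * C, by positivity, fun F g m ε z Z i hF hF2 hm hg hε hε1 hz => ?_⟩
  have test : ∀ θ : Plane → ℝ, ContDiff ℝ ∞ θ → HasCompactSupport θ →
      |∫ x, moll ε θ x * F x i| ≤ 2 * C * m * (ε⁻¹) ^ 3 * l4 θ := by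
    intro θ hθ hc
    have hs : ContDiff ℝ ∞ (moll ε θ) := contDiff_moll hε hθ.continuous.locallyIntegrable
    have hcs : HasCompactSupport (moll ε θ) := hasCompactSupport_moll hε.le hc
    have key := hF _ hs hcs i
    simp only [mul_comm (moll ε θ _)]
    rw [key, abs_neg]
    have hA : 0 ≤ C * (ε⁻¹) ^ 3 * l4 θ := by have := l4_nonneg θ; positivity
    have hj : ∀ j, |∫ x, g j x i * partialDeriv (moll ε θ) j x| ≤ m * (C * (ε⁻¹) ^ 3 * l4 θ) := by
      intro j
      have hw := (IsWeakGrad.of_contDiff hs).unique ((IsH1.of_test hθ hc).mollify ε).weak j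
      have h1 : ‖∫ x, g j x i * partialDeriv (moll ε θ) j x‖ₑ ≤
          ENNReal.ofReal m * ENNReal.ofReal (C * (ε⁻¹) ^ 3 * l4 θ) := by
        refine (enorm_integral_le_lintegral_enorm _).trans (le_trans ?_ (mul_le_mul_left (hg j) _))
        rw [eLpNorm_one_eq_lintegral_enorm, ← lintegral_mul_const' _ _ (by finiteness)]
        refine lintegral_mono_ae ?_
        filter_upwards [hw] with x hx
        rw [enorm_mul, hx]
        gcongr
        · rw [← ofReal_norm, ← ofReal_norm]
          exact ENNReal.ofReal_le_ofReal (PiLp.norm_apply_le (g j x) i)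
        · rw [← ofReal_norm]
          exact ENNReal.ofReal_le_ofReal (hC ε θ j x hε hε1 hθ hc)
      rwa [← ofReal_norm, ← ENNReal.ofReal_mul hm,
        ENNReal.ofReal_le_ofReal_iff (by positivity)] at h1
    refine (Finset.abs_sum_le_sum_abs _ _).trans ((Finset.sum_le_sum fun j _ => hj j).trans
      (le_of_eq ?_))
    simp; ring
  obtain ⟨θ, hθ, hθc, t0, t1⟩ := hz.exists_approx
  have hθH := fun n => IsH1.of_test (hθ n) (hθc n)
  have t4 := tendsto_eLpNorm_four hz hθH t0 t1
  have tm : Tendsto (fun n => eLpNorm (fun x => moll ε (θ n) x - moll ε z x) 2 volume) atTop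
      (𝓝 0) := by
    refine tendsto_of_tendsto_of_tendsto_of_le_of_le tendsto_const_nhds
      (by simpa using ENNReal.Tendsto.const_mul t0 (Or.inr hD)) (fun _ => zero_le)
      fun n => hDm ε _ _ (hθH n).memLp hz.memLp
  have l1 := (tendsto_integral_mul_of_tendsto_L2 (fun n => memLp_moll (hθH n).memLp ε)
    (memLp_moll hz.memLp ε) hF2 tm).abs
  have l2 : Tendsto (fun n => l4 (θ n)) atTop (𝓝 (l4 z)) := by
    have h4 : Tendsto (fun n => l4 (fun x => θ n x - z x)) atTop (𝓝 0) := by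
      have := (ENNReal.tendsto_toReal ENNReal.zero_ne_top).comp t4
      simpa [l4, Function.comp_def] using this
    refine tendsto_iff_dist_tendsto_zero.2 (squeeze_zero (fun _ => dist_nonneg) (fun n => ?_) h4)
    have m1 := (hθH n).memLp_four
    have m2 := hz.memLp_four
    have : Fact ((1 : ℝ≥0∞) ≤ 4) := ⟨by norm_num⟩
    have key := abs_norm_sub_norm_le (m1.toLp (θ n)) (m2.toLp z)
    rw [← MemLp.toLp_sub, Lp.norm_toLp, Lp.norm_toLp, Lp.norm_toLp] at key
    exact key
  exact le_of_tendsto_of_tendsto' l1 (l2.const_mul _) fun n => test _ (hθ n) (hθc n)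

lemma l2_add_le {f g : Plane → ℝ} (hf : MemLp f 2 volume) (hg : MemLp g 2 volume) :
    l2 (fun x => f x + g x) ≤ l2 f + l2 g := by
  rw [l2, l2, l2, ← ENNReal.toReal_add hf.2.ne hg.2.ne]
  exact ENNReal.toReal_mono (by finiteness [hf.2, hg.2]) (eLpNorm_add_le hf.1 hg.1 (by norm_num))

section Force

variable {b η : Plane → ℝ} {b_i b_s M : ℝ} {f : ℝ → Plane → Plane}

/-- If `∇b` is bounded then the work of the force on a field `v` in `V` is bounded by powers of
the dissipation of `v`, up to an error which is small for small `ε`.  The mollification of `b v` is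
paired with the force as a derivative of integrable fields, the rest with the force as an `L²`
field; the latter is small because `b v` is in `H¹`. -/
lemma exists_abs_innerB_force_le (h : Coefficients b η b_i b_s M) {K : ℝ}
    (hK : ∀ x, ‖fderiv ℝ b x‖ ≤ K) {κ : ℝ} (hf : IsDecayingForce f κ)
    {g : Fin 2 → ℝ → Plane → Plane} {m : ℝ} (hm : 0 ≤ m)
    (hg : ∀ j, ∀ᵐ t ∂(volume.restrict (Ici (0 : ℝ))), eLpNorm (g j t) 1 volume ≤ ENNReal.ofReal m)
    (hfg : ∀ᵐ t ∂(volume.restrict (Ici (0 : ℝ))), IsFirstDerivOf (f t) (fun j => g j t))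
    {U : ℝ} (hU0 : 0 ≤ U) :
    ∃ C : ℝ, 0 ≤ C ∧ ∀ᵐ τ ∂(volume.restrict (Ici (0 : ℝ))), ∀ v G, InV b v G →
      (∀ i, l2 (fun x => v x i) ≤ U) → ∀ ε, 0 < ε → ε ≤ 1 →
      |innerB b v (f τ)| ≤ C * (ε * rate τ * (1 + √(dissip η v G)) +
        (ε⁻¹) ^ 3 * √√(dissip η v G)) := by
  obtain ⟨L, hL, hl⟩ := exists_l4_sq_le_dissip
  obtain ⟨A, hA, hAl⟩ := exists_abs_integral_mul_moll_le
  obtain ⟨B, hB, hBl⟩ := exists_eLpNorm_moll_sub_le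
  have hbs := h.b_s_pos
  have hκ := hf.nonneg
  have hK0 : 0 ≤ K := (norm_nonneg _).trans (hK 0)
  refine ⟨4 * κ * B * (b_s + K * U) + 2 * A * m * b_s * √(L * U), by positivity, ?_⟩
  filter_upwards [hf.bound, eventually_all.2 hg, hfg] with τ q1 q2 q3 v G hv hU ε hε hε1
  set d := √(dissip η v G)
  have hd : 0 ≤ d := Real.sqrt_nonneg _
  have hr := rate_nonneg τ
  have hf2 : ∀ i, MemLp (fun x => f τ x i) 2 volume := ShallowWater.memLp_apply q1.1
  have hfl : ∀ i, l2 (fun x => f τ x i) ≤ κ * rate τ :=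
    l2_apply_le (mul_nonneg hκ hr) q1.2
  have hpb : ∀ j x, |partialDeriv b j x| ≤ K := by
    intro j x
    refine ((fderiv ℝ b x).le_opNorm _).trans ?_
    simpa using hK x
  have comp : ∀ i, |∫ x, b x * v x i * f τ x i| ≤ κ * rate τ * (B * ε * (2 * (b_s * d + K * U))) +
      A * m * (ε⁻¹) ^ 3 * (b_s * (√(L * U) * √d)) := by
    intro i
    have hG := (hv.isH1 i).grad_memLp
    have hzm : MemLp (fun x => b x * v x i) 2 volume := h.memLp_b_mul (hv.isH1 i).memLp
    have m1 := fun j => h.memLp_b_mul (hG j)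
    have m2 : ∀ j, MemLp (fun x => partialDeriv b j x * v x i) 2 volume := fun j =>
      memLp_bounded_mul (contDiff_partialDeriv h.smooth_b j).continuous.aestronglyMeasurable
        (hpb j) (hv.isH1 i).memLp
    have hz : IsH1 (fun x => b x * v x i) (fun j x => b x * G i j x + partialDeriv b j x * v x i) :=
      ⟨hzm, fun j => (m1 j).add (m2 j), (hv.isH1 i).weak.mul_smooth h.smooth_b⟩
    have hZ : ∀ j, l2 (fun x => b x * G i j x + partialDeriv b j x * v x i) ≤ b_s * d + K * U := by
      intro j
      refine (l2_add_le (m1 j) (m2 j)).trans (add_le_add ?_ ?_)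
      · exact (l2_bounded_mul_le hbs.le h.abs_b_le (hG j)).trans
          (mul_le_mul_of_nonneg_left (l2_grad_le h hv i j) hbs.le)
      · exact (l2_bounded_mul_le hK0 (hpb j) (hv.isH1 i).memLp).trans
          (mul_le_mul_of_nonneg_left (hU i) hK0)
    have hz4 : l4 (fun x => b x * v x i) ≤ b_s * (√(L * U) * √d) := by
      refine (l4_bounded_mul_le hbs.le h.abs_b_le (hv.memLp_four i)).trans
        (mul_le_mul_of_nonneg_left ?_ hbs.le)
      rw [← Real.sqrt_mul (by positivity)]
      exact Real.le_sqrt_of_sq_le (hl h hv hU i)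
    have hmo := memLp_moll hzm ε
    have hsub : MemLp (fun x => moll ε (fun x => b x * v x i) x - b x * v x i) 2 volume :=
      hmo.sub hzm
    have split : ∫ x, b x * v x i * f τ x i =
        (∫ x, moll ε (fun x => b x * v x i) x * f τ x i) -
        ∫ x, (moll ε (fun x => b x * v x i) x - b x * v x i) * f τ x i := by
      rw [← integral_sub (integrable_mul_L2 hmo (hf2 i)) (integrable_mul_L2 hsub (hf2 i))]
      congr 1; ext x; ring
    rw [split]
    refine (abs_sub _ _).trans ?_
    rw [add_comm]
    refine add_le_add ?_ ?_
    · refine (abs_integral_mul_le hsub (hf2 i)).trans ?_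
      rw [mul_comm]
      refine mul_le_mul (hfl i) ?_ (l2_nonneg _) (mul_nonneg hκ hr)
      have h1 := hBl ε _ _ hε.le hz
      have h2 : l2 (fun x => moll ε (fun x => b x * v x i) x - b x * v x i) ≤ B * ε *
          (l2 (fun x => b x * G i 0 x + partialDeriv b 0 x * v x i) +
            l2 (fun x => b x * G i 1 x + partialDeriv b 1 x * v x i)) := by
        have h3 := ENNReal.toReal_mono (by
          have := (hz.grad_memLp 0).2.ne
          have := (hz.grad_memLp 1).2.ne
          finiteness) h1
        rw [ENNReal.toReal_mul, ENNReal.toReal_ofReal (by positivity),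
          ENNReal.toReal_add (hz.grad_memLp 0).2.ne (hz.grad_memLp 1).2.ne] at h3
        exact h3
      refine h2.trans (mul_le_mul_of_nonneg_left ?_ (by positivity))
      linarith [hZ 0, hZ 1]
    · refine (hAl _ _ m ε _ _ i q3 (hf2 i) hm q2 hε hε1 hz).trans ?_
      exact mul_le_mul_of_nonneg_left hz4 (by positivity)
  rw [innerB_eq_sum h (fun i => (hv.isH1 i).memLp) hf2]
  refine (Finset.abs_sum_le_sum_abs _ _).trans ((Finset.sum_le_sum fun i _ => comp i).trans ?_)
  simp only [Finset.sum_const, Finset.card_univ, Fintype.card_fin, nsmul_eq_mul]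
  have e1 : b_s * d + K * U ≤ (b_s + K * U) * (1 + d) := by nlinarith [mul_nonneg hK0 hU0]
  have e2 : κ * rate τ * (B * ε * (2 * (b_s * d + K * U))) ≤
      κ * rate τ * (B * ε * (2 * ((b_s + K * U) * (1 + d)))) := by gcongr
  have hX : 0 ≤ ε * rate τ * (1 + d) := by positivity
  have hY : 0 ≤ (ε⁻¹) ^ 3 * √d := by positivity
  have e3 : 0 ≤ 4 * κ * B * (b_s + K * U) * ((ε⁻¹) ^ 3 * √d) := by positivity
  have e4 : 0 ≤ 2 * A * m * b_s * √(L * U) * (ε * rate τ * (1 + d)) := by positivity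
  push_cast
  linarith

end Force

/-! ### Logarithmic decay from a recursive inequality -/

lemma one_le_log_exp_add {t : ℝ} (ht : 0 ≤ t) : 1 ≤ Real.log (Real.exp 1 + t) := by
  rw [Real.le_log_iff_exp_le (exp_one_add_pos ht)]
  linarith

/-- The error terms of the recursion are powers of `T` and beat the logarithm.  The exponent
`1 / 20` corresponds to `T = y ^ 20`. -/
lemma exists_log_estimates {r : ℝ} (hr0 : 0 < r) (hr : r < 1) : ∃ T₀ : ℝ, 1 ≤ T₀ ∧ ∀ T, T₀ ≤ T →
    r ^ 2 * Real.log (Real.exp 1 + 2 * T) ≤ Real.log (Real.exp 1 + T ^ r) ∧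
    (√(T ^ r / T) + (T ^ (1 / 20 : ℝ))⁻¹) * Real.log (Real.exp 1 + 2 * T) ≤ 4 := by
  set s := min ((1 - r) / 2) (1 / 20) with hs
  have hs0 : 0 < s := lt_min (by linarith) (by norm_num)
  have h1 : ∀ᶠ T in atTop, Real.log T ≤ T ^ s := by
    have := (isLittleO_log_rpow_atTop hs0).bound one_pos
    filter_upwards [this, eventually_ge_atTop (1 : ℝ)] with T hT h1
    rw [one_mul, Real.norm_of_nonneg (Real.log_nonneg h1),
      Real.norm_of_nonneg (Real.rpow_nonneg (by linarith) _)] at hT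
    exact hT
  have h2 : ∀ᶠ T in atTop, r * Real.log 4 / (1 - r) ≤ Real.log T :=
    Real.tendsto_log_atTop.eventually_ge_atTop _
  have h3 : ∀ᶠ T in atTop, Real.log 4 ≤ Real.log T := Real.tendsto_log_atTop.eventually_ge_atTop _
  obtain ⟨T₀, hT₀⟩ := eventually_atTop.1 (((h1.and h2).and h3).and
    (eventually_ge_atTop (Real.exp 1)))
  refine ⟨max T₀ 1, le_max_right _ _, fun T hT => ?_⟩
  obtain ⟨⟨⟨a1, a2⟩, a3⟩, a4⟩ := hT₀ T ((le_max_left _ _).trans hT)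
  have hT1 : 1 ≤ T := (le_max_right _ _).trans hT
  have hT0 : 0 < T := by linarith
  have hlog : Real.log (Real.exp 1 + 2 * T) ≤ Real.log T + Real.log 4 := by
    rw [← Real.log_mul hT0.ne' (by norm_num)]
    exact Real.log_le_log (by positivity) (by linarith)
  have hpos : 0 ≤ Real.log (Real.exp 1 + 2 * T) :=
    zero_le_one.trans (one_le_log_exp_add (by positivity))
  constructor
  · have b1 : r * Real.log T ≤ Real.log (Real.exp 1 + T ^ r) := by
      rw [← Real.log_rpow hT0]
      exact Real.log_le_log (Real.rpow_pos_of_pos hT0 _) (by linarith [Real.exp_pos 1])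
    rw [div_le_iff₀ (by linarith)] at a2
    have b2 : r * Real.log (Real.exp 1 + 2 * T) ≤ Real.log T := by nlinarith
    nlinarith
  · have b1 : √(T ^ r / T) ≤ T ^ (-s) := by
      have : T ^ r / T = T ^ (r - 1) := by rw [Real.rpow_sub_one hT0.ne']
      rw [this, Real.sqrt_eq_rpow, ← Real.rpow_mul hT0.le]
      refine Real.rpow_le_rpow_of_exponent_le hT1 ?_
      have := min_le_left ((1 - r) / 2) (1 / 20)
      rw [hs]; linarith
    have b2 : (T ^ (1 / 20 : ℝ))⁻¹ ≤ T ^ (-s) := by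
      rw [← Real.rpow_neg hT0.le]
      refine Real.rpow_le_rpow_of_exponent_le hT1 ?_
      have := min_le_right ((1 - r) / 2) (1 / 20)
      rw [hs]; linarith
    have b3 : Real.log (Real.exp 1 + 2 * T) ≤ 2 * T ^ s := by linarith
    have hp : 0 < T ^ s := Real.rpow_pos_of_pos hT0 _
    calc _ ≤ (T ^ (-s) + T ^ (-s)) * (2 * T ^ s) :=
          mul_le_mul (add_le_add b1 b2) b3 hpos (by positivity)
      _ = 4 := by rw [Real.rpow_neg hT0.le]; field_simp; norm_num

/-- The recursion reads `Φ (2 T) ≤ q Φ σ + error` with `q = A / (1 + A) < 1`.  It is used with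
`σ = T ^ r`, where `r < 1` is so close to one that `q ≤ r ^ 3`: for large `T` one has
`r ^ 2 * log (e + 2 T) ≤ log (e + σ)`, and a decay of order `1 / log` reproduces itself. -/
lemma exists_log_decay (A B Φ₀ : ℝ) (hA : 0 ≤ A) (hB : 0 ≤ B) :
    ∃ C : ℝ, ∀ Φ : ℝ → ℝ, (∀ t, 0 ≤ t → 0 ≤ Φ t) → (∀ t, 0 ≤ t → Φ t ≤ Φ₀) →
      (∀ y σ : ℝ, 1 ≤ y → 0 ≤ σ → σ ≤ y ^ 20 → Φ (2 * y ^ 20) ≤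
        A * (Φ σ - Φ (2 * y ^ 20)) + B * (√(σ / y ^ 20) + y⁻¹)) →
      ∀ t, 0 ≤ t → Φ t * Real.log (Real.exp 1 + t) ≤ C := by
  set q := A / (1 + A) with hq
  have hA1 : 0 < 1 + A := by linarith
  have hq0 : 0 ≤ q := by positivity
  have hq1 : q < 1 := by rw [hq, div_lt_one hA1]; linarith
  set r := 1 - (1 - q) / 3 with hr
  have hr0 : 0 < r := by rw [hr]; linarith
  have hr1 : r < 1 := by rw [hr]; linarith
  have hqr : q ≤ r ^ 3 := by
    have : q = 3 * r - 2 := by rw [hr]; ring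
    nlinarith [mul_nonneg (sq_nonneg (r - 1)) (by linarith : 0 ≤ r + 2)]
  obtain ⟨T₀, hT₀, hT⟩ := exists_log_estimates hr0 hr1
  set K := Φ₀ * Real.log (Real.exp 1 + 2 * T₀) with hK
  refine ⟨max K (4 * B / (1 - r)), fun Φ hΦ0 hΦ hrec t ht => ?_⟩
  have hL : ∀ {s : ℝ}, 0 ≤ s → 0 ≤ Real.log (Real.exp 1 + s) := fun hs =>
    zero_le_one.trans (one_le_log_exp_add hs)
  have hmono : ∀ {s s' : ℝ}, 0 ≤ s → s ≤ s' →
      Φ s * Real.log (Real.exp 1 + s) ≤ Φ₀ * Real.log (Real.exp 1 + s') := by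
    intro s s' hs hss
    exact mul_le_mul (hΦ s hs) (Real.log_le_log (exp_one_add_pos hs) (by linarith)) (hL hs)
      ((hΦ0 0 le_rfl).trans (hΦ 0 le_rfl))
  set F : ℝ → ℝ := fun s => Φ s * Real.log (Real.exp 1 + s) with hF
  have hbdd : BddAbove (F '' Icc 0 t) :=
    ⟨Φ₀ * Real.log (Real.exp 1 + t), by rintro _ ⟨s, hs, rfl⟩; exact hmono hs.1 hs.2⟩
  set S := sSup (F '' Icc 0 t) with hS
  have hSle : ∀ s ∈ Icc 0 t, F s ≤ S := fun s hs => le_csSup hbdd (mem_image_of_mem _ hs)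
  have step : ∀ s ∈ Icc 0 t, F s ≤ max K (r * S + 4 * B) := by
    intro s hs
    rcases le_total s (2 * T₀) with h | h
    · exact (hmono hs.1 h).trans (le_max_left _ _)
    refine le_trans ?_ (le_max_right _ _)
    set T := s / 2 with hTdef
    have hsT : s = 2 * T := by rw [hTdef]; ring
    have hTT : T₀ ≤ T := by linarith
    have hT1 : 1 ≤ T := hT₀.trans hTT
    have hT0 : 0 < T := by linarith
    obtain ⟨l1, l2⟩ := hT T hTT
    set y := T ^ (1 / 20 : ℝ) with hy
    have hy20 : y ^ 20 = T := by
      rw [hy, ← Real.rpow_natCast, ← Real.rpow_mul hT0.le]; norm_num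
    have hy1 : 1 ≤ y := Real.one_le_rpow hT1 (by norm_num)
    have hσ0 : 0 ≤ T ^ r := Real.rpow_nonneg hT0.le _
    have hσT : T ^ r ≤ T := by
      conv_rhs => rw [← Real.rpow_one T]
      exact Real.rpow_le_rpow_of_exponent_le hT1 hr1.le
    have key := hrec y (T ^ r) hy1 hσ0 (by rw [hy20]; exact hσT)
    rw [hy20] at key
    set E := √(T ^ r / T) + y⁻¹
    have hE : 0 ≤ E := by positivity
    have hΦ2 : Φ (2 * T) ≤ q * Φ (T ^ r) + B * E := by
      have e1 : (1 + A) * Φ (2 * T) ≤ A * Φ (T ^ r) + B * E := by linarith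
      have e2 : (1 + A) * (q * Φ (T ^ r) + B * E) = A * Φ (T ^ r) + B * E + A * (B * E) := by
        rw [hq]; field_simp; ring
      have e3 : 0 ≤ A * (B * E) := by positivity
      exact le_of_mul_le_mul_left (by linarith) hA1
    have hL2 := hL (by positivity : 0 ≤ 2 * T)
    have hSσ : F (T ^ r) ≤ S := hSle _ ⟨hσ0, by linarith [hs.2]⟩
    have hΦσ := hΦ0 _ hσ0
    have f1 : q * Real.log (Real.exp 1 + 2 * T) ≤ r * Real.log (Real.exp 1 + T ^ r) := by
      calc _ ≤ r ^ 3 * Real.log (Real.exp 1 + 2 * T) := mul_le_mul_of_nonneg_right hqr hL2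
        _ = r * (r ^ 2 * Real.log (Real.exp 1 + 2 * T)) := by ring
        _ ≤ _ := mul_le_mul_of_nonneg_left l1 hr0.le
    rw [hsT]
    calc F (2 * T) ≤ (q * Φ (T ^ r) + B * E) * Real.log (Real.exp 1 + 2 * T) :=
          mul_le_mul_of_nonneg_right hΦ2 hL2
      _ = Φ (T ^ r) * (q * Real.log (Real.exp 1 + 2 * T)) +
          B * (E * Real.log (Real.exp 1 + 2 * T)) := by ring
      _ ≤ Φ (T ^ r) * (r * Real.log (Real.exp 1 + T ^ r)) + B * 4 :=
          add_le_add (mul_le_mul_of_nonneg_left f1 hΦσ) (mul_le_mul_of_nonneg_left l2 hB)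
      _ = r * F (T ^ r) + 4 * B := by rw [hF]; ring
      _ ≤ _ := by nlinarith
  have hSS : S ≤ max K (r * S + 4 * B) := by
    refine csSup_le ⟨_, mem_image_of_mem _ ⟨le_rfl, ht⟩⟩ ?_
    rintro _ ⟨s, hs, rfl⟩
    exact step s hs
  refine (hSle t ⟨ht, le_rfl⟩).trans ?_
  rcases le_max_iff.1 hSS with h | h
  · exact h.trans (le_max_left _ _)
  · refine le_trans ?_ (le_max_right _ _)
    rw [le_div_iff₀ (by linarith)]
    linarith

/-! ### Decay of the energy -/

lemma sqrt_le_one_add {x : ℝ} (hx : 0 ≤ x) : √x ≤ 1 + x := by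
  nlinarith [Real.sq_sqrt hx, sq_nonneg (√x - 1), Real.sqrt_nonneg x]

/-- Young's inequality in the form `r ≤ λ + λ⁻³ r⁴`, with `λ = y⁻⁵`. -/
lemma sqrt_sqrt_le {x y : ℝ} (hx : 0 ≤ x) (hy : 1 ≤ y) : √√x ≤ (y⁻¹) ^ 5 + y ^ 15 * x := by
  set r := √√x with hr
  have hr0 : 0 ≤ r := Real.sqrt_nonneg _
  have hx4 : x = r ^ 4 := by
    have h1 : r ^ 2 = √x := Real.sq_sqrt (Real.sqrt_nonneg _)
    have h2 : √x ^ 2 = x := Real.sq_sqrt hx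
    rw [← h2, ← h1]; ring
  have hy0 : 0 < y := by linarith
  rcases le_total r ((y⁻¹) ^ 5) with h | h
  · have : 0 ≤ y ^ 15 * x := by positivity
    linarith
  · have h1 : 1 ≤ y ^ 5 * r := by
      have := mul_le_mul_of_nonneg_left h (pow_nonneg hy0.le 5)
      rwa [← mul_pow, mul_inv_cancel₀ hy0.ne', one_pow] at this
    have h2 : 1 ≤ (y ^ 5 * r) ^ 3 := one_le_pow₀ h1
    have h3 : y ^ 15 * x = (y ^ 5 * r) ^ 3 * r := by rw [hx4]; ring
    have h4 : 0 ≤ (y⁻¹) ^ 5 := by positivity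
    nlinarith

/-- One step of the recursion: averaging an upper bound of the energy over `[T, 2 T]`,
where `T = y ^ 20`, and splitting the integral of `√D` at `σ`. -/
lemma recursion_step {Φ D : ℝ → ℝ} {c C K Φ₀ : ℝ} (hc : 0 < c) (hC : 0 ≤ C) (hK : 0 ≤ K)
    (hD0 : ∀ s, 0 ≤ D s)
    (hΦ0 : ∀ t, 0 ≤ t → 0 ≤ Φ t) (hΦ : ∀ t, 0 ≤ t → Φ t ≤ Φ₀)
    (hD : ∀ s t, 0 ≤ s → 0 ≤ t → IntervalIntegrable D volume s t)
    (hD' : ∀ s t, 0 ≤ s → 0 ≤ t → IntervalIntegrable (fun τ => √(D τ)) volume s t)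
    (hen : ∀ s t, 0 ≤ s → s ≤ t → Φ t + c * ∫ τ in s..t, D τ ≤ Φ s)
    {y σ : ℝ} (hy : 1 ≤ y) (hσ : 0 ≤ σ) (hσT : σ ≤ y ^ 20)
    (hbd : ∀ᵐ s ∂(volume.restrict (Icc (y ^ 20) (2 * y ^ 20))),
      Φ s ≤ C / (Real.exp 1 + s) + (K * (y⁻¹ + y ^ 19 * D s) +
        K * ((∫ τ in (0 : ℝ)..s, √(D τ)) * √(D s)))) :
    Φ (2 * y ^ 20) ≤ 2 * K / c * (Φ σ - Φ (2 * y ^ 20)) +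
      (C + K * (1 + Φ₀ / c)) * (√(σ / y ^ 20) + y⁻¹) := by
  set T := y ^ 20 with hT
  have hy0 : 0 < y := by linarith
  have hT0 : 0 < T := by positivity
  have hTT : T ≤ 2 * T := by linarith
  have h2T : 0 ≤ 2 * T := by linarith
  have hΦ₀ : 0 ≤ Φ₀ := (hΦ0 0 le_rfl).trans (hΦ 0 le_rfl)
  set J := ∫ τ in σ..(2 * T), D τ with hJ
  have hσ2 : σ ≤ 2 * T := hσT.trans hTT
  have hint : ∀ {s t : ℝ}, s ≤ t → 0 ≤ ∫ τ in s..t, D τ := fun h =>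
    intervalIntegral.integral_nonneg h fun τ _ => hD0 τ
  have hint' : ∀ {s t : ℝ}, s ≤ t → 0 ≤ ∫ τ in s..t, √(D τ) := fun h =>
    intervalIntegral.integral_nonneg h fun τ _ => Real.sqrt_nonneg _
  have hJc : J ≤ (Φ σ - Φ (2 * T)) / c := by
    rw [le_div_iff₀ hc]; linarith [hen σ (2 * T) hσ hσ2]
  have htot : ∀ {s t : ℝ}, 0 ≤ s → s ≤ t → ∫ τ in s..t, D τ ≤ Φ₀ / c := by
    intro s t hs hst
    rw [le_div_iff₀ hc]
    linarith [hen s t hs hst, hΦ0 t (hs.trans hst), hΦ s hs]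
  have hCS : ∀ {s t : ℝ}, 0 ≤ s → s ≤ t →
      ∫ τ in s..t, √(D τ) ≤ √(t - s) * √(∫ τ in s..t, D τ) := by
    intro s t hs hst
    rw [← Real.sqrt_mul (by linarith)]
    refine Real.le_sqrt_of_sq_le ?_
    have := sq_integral_le hst (hD' s t hs (hs.trans hst)) (by
      simp only [Real.sq_sqrt (hD0 _)]; exact hD s t hs (hs.trans hst))
    simpa only [Real.sq_sqrt (hD0 _)] using this
  set I := ∫ τ in (0 : ℝ)..(2 * T), √(D τ) with hI
  set p := ∫ τ in T..(2 * T), √(D τ) with hp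
  have hJ1 : ∫ τ in T..(2 * T), D τ ≤ J :=
    intervalIntegral.integral_mono_interval hσT hTT le_rfl (Eventually.of_forall hD0)
      (hD _ _ hσ h2T)
  have hp1 : p ≤ √T * √J := by
    refine (hCS hT0.le hTT).trans ?_
    rw [show 2 * T - T = T by ring]
    exact mul_le_mul_of_nonneg_left (Real.sqrt_le_sqrt hJ1) (Real.sqrt_nonneg _)
  have hI1 : I ≤ √σ * √(Φ₀ / c) + √(2 * T) * √J := by
    rw [hI, ← intervalIntegral.integral_add_adjacent_intervals (hD' 0 σ le_rfl hσ)
      (hD' σ (2 * T) hσ h2T)]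
    refine add_le_add ((hCS le_rfl hσ).trans ?_) ((hCS hσ hσ2).trans ?_)
    · rw [sub_zero]
      exact mul_le_mul_of_nonneg_left (Real.sqrt_le_sqrt (htot le_rfl hσ)) (Real.sqrt_nonneg _)
    · exact mul_le_mul_of_nonneg_right (Real.sqrt_le_sqrt (by linarith)) (Real.sqrt_nonneg _)
  have hJ0 : 0 ≤ J := hint hσ2
  have hJΦ : J ≤ Φ₀ / c := htot hσ hσ2
  have hIp : I * p ≤ √(σ / T) * T * (Φ₀ / c) + 2 * (T * J) := by
    have e1 : I * p ≤ (√σ * √(Φ₀ / c) + √(2 * T) * √J) * (√T * √J) :=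
      mul_le_mul hI1 hp1 (hint' hTT) (by positivity)
    have e2 : √J * √(Φ₀ / c) ≤ Φ₀ / c := by
      calc √J * √(Φ₀ / c) ≤ √(Φ₀ / c) * √(Φ₀ / c) :=
            mul_le_mul_of_nonneg_right (Real.sqrt_le_sqrt hJΦ) (Real.sqrt_nonneg _)
        _ = _ := Real.mul_self_sqrt (by positivity)
    have e3 : √σ * √T = √(σ / T) * T := by
      rw [Real.sqrt_div hσ, div_mul_eq_mul_div, eq_div_iff (Real.sqrt_pos.2 hT0).ne', mul_assoc,
        Real.mul_self_sqrt hT0.le]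
    have e4 : √(2 * T) * √T ≤ 2 * T := by
      rw [Real.sqrt_mul (by norm_num), mul_assoc, Real.mul_self_sqrt hT0.le]
      have : √2 ≤ 2 := by
        rw [Real.sqrt_le_left (by norm_num)]; norm_num
      nlinarith
    have e5 : √J * √J = J := Real.mul_self_sqrt hJ0
    calc I * p ≤ _ := e1
      _ = (√σ * √T) * (√J * √(Φ₀ / c)) + (√(2 * T) * √T) * (√J * √J) := by ring
      _ ≤ (√σ * √T) * (Φ₀ / c) + (2 * T) * J := by
          rw [e5]
          exact add_le_add (mul_le_mul_of_nonneg_left e2 (by positivity))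
            (mul_le_mul_of_nonneg_right e4 hJ0)
      _ = _ := by rw [e3]; ring
  have hi0 : IntervalIntegrable (fun s => y ^ 19 * D s) volume T (2 * T) :=
    (hD _ _ hT0.le h2T).const_mul _
  have hi1 : IntervalIntegrable (fun s => K * (y⁻¹ + y ^ 19 * D s)) volume T (2 * T) :=
    (IntervalIntegrable.add (by simp) hi0).const_mul K
  have hi2 : IntervalIntegrable (fun s => K * (I * √(D s))) volume T (2 * T) :=
    ((hD' _ _ hT0.le h2T).const_mul _).const_mul _
  -- The bound on `Φ`, integrated over `[T, 2 T]`.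
  have hmain : T * (Φ (2 * T) - C / T) ≤
      K * (T * y⁻¹ + y ^ 19 * ∫ τ in T..(2 * T), D τ) + K * (I * p) := by
    have h1 : ∫ _s in T..(2 * T), (Φ (2 * T) - C / T) ≤
        ∫ s in T..(2 * T), (K * (y⁻¹ + y ^ 19 * D s) + K * (I * √(D s))) := by
      refine intervalIntegral.integral_mono_ae_restrict hTT (by simp) ?_ ?_
      · exact hi1.add hi2
      · filter_upwards [hbd, ae_restrict_mem measurableSet_Icc] with s h2 h3
        have hs0 : 0 ≤ s := hT0.le.trans h3.1
        have h4 : Φ (2 * T) ≤ Φ s := by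
          have := hen s (2 * T) hs0 h3.2
          have := mul_nonneg hc.le (hint h3.2)
          linarith
        have h5 : C / (Real.exp 1 + s) ≤ C / T :=
          div_le_div_of_nonneg_left hC hT0 (by linarith [h3.1, Real.exp_pos 1])
        have h6 : ∫ τ in (0 : ℝ)..s, √(D τ) ≤ I :=
          intervalIntegral.integral_mono_interval le_rfl hs0 h3.2
            (Eventually.of_forall fun _ => Real.sqrt_nonneg _) (hD' _ _ le_rfl h2T)
        have h7 := mul_le_mul_of_nonneg_left
          (mul_le_mul_of_nonneg_right h6 (Real.sqrt_nonneg (D s))) hK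
        linarith
    rw [intervalIntegral.integral_const, intervalIntegral.integral_add hi1 hi2,
      intervalIntegral.integral_const_mul,
      intervalIntegral.integral_const_mul, intervalIntegral.integral_const_mul,
      intervalIntegral.integral_add (by simp) hi0,
      intervalIntegral.integral_const, intervalIntegral.integral_const_mul,
      show 2 * T - T = T by ring, smul_eq_mul, smul_eq_mul] at h1
    exact h1
  have hy19 : y ^ 19 = T * y⁻¹ := by rw [hT]; field_simp
  have hJ1' : ∫ τ in T..(2 * T), D τ ≤ Φ₀ / c := htot hT0.le hTT
  have hCT : C / T ≤ C * y⁻¹ := by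
    rw [div_eq_mul_inv]
    refine mul_le_mul_of_nonneg_left (inv_anti₀ hy0 ?_) hC
    exact le_self_pow₀ hy (by norm_num)
  have hyi : 0 ≤ y⁻¹ := by positivity
  have hsq : 0 ≤ √(σ / T) := Real.sqrt_nonneg _
  have f1 : T * (Φ (2 * T) - C / T) ≤ T * (K * (y⁻¹ + y⁻¹ * (Φ₀ / c)) +
      K * (√(σ / T) * (Φ₀ / c) + 2 * J)) := by
    refine hmain.trans ?_
    rw [hy19]
    have g1 : T * y⁻¹ * ∫ τ in T..(2 * T), D τ ≤ T * y⁻¹ * (Φ₀ / c) :=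
      mul_le_mul_of_nonneg_left hJ1' (by positivity)
    have g2 := mul_le_mul_of_nonneg_left g1 hK
    have g3 := mul_le_mul_of_nonneg_left hIp hK
    linarith
  have f2 := le_of_mul_le_mul_left f1 hT0
  have f3 := mul_le_mul_of_nonneg_left hJc hK
  have f4 : 0 ≤ Φ₀ / c := by positivity
  have f5 : 2 * K / c * (Φ σ - Φ (2 * T)) = 2 * (K * ((Φ σ - Φ (2 * T)) / c)) := by ring
  rw [f5]
  have f6 : 0 ≤ C * √(σ / T) := by positivity
  have f7 : 0 ≤ K * √(σ / T) := by positivity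
  linarith

/-! ### Decay of weak solutions -/

section Conclusion

variable {ν : ℝ} {b η : Plane → ℝ} {b_i b_s M : ℝ} {f : ℝ → Plane → Plane} {u₀ : Plane → Plane}
  {u : ℝ → Plane → Plane} {Du : ℝ → Fin 2 → Fin 2 → Plane → ℝ}

lemma memLp_sqrt_abs {w : Plane → ℝ} {p : ℝ≥0∞} (hw : MemLp w p volume) :
    MemLp (fun x => √|w x|) (p * 2) volume := by
  have h1 := hw.norm_rpow_div (q := 1 / 2)
  have e : p / (1 / 2 : ℝ≥0∞) = p * 2 := by
    rw [one_div, div_eq_mul_inv, inv_inv]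
  rw [e] at h1
  refine h1.ae_eq (Eventually.of_forall fun x => ?_)
  simp [Real.sqrt_eq_rpow]

/-- An integrable initial datum, paired with a field `v` in `V`.  The fourth root of the dissipation
comes from the `L⁴` norm of `v`, by Ladyzhenskaya's inequality. -/
lemma exists_innerB_initial_le (h : Coefficients b η b_i b_s M)
    (hu₁ : ∀ i, MemLp (fun x => u₀ x i) 1 volume) (hu₂ : ∀ i, MemLp (fun x => u₀ x i) 2 volume)
    {U : ℝ} (hU0 : 0 ≤ U) :
    ∃ Q : ℝ, 0 ≤ Q ∧ ∀ v G, InV b v G → (∀ i, l2 (fun x => v x i) ≤ U) →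
      innerB b u₀ v ≤ Q * √√(dissip η v G) := by
  obtain ⟨L, hL, hl⟩ := exists_l4_sq_le_dissip
  have r2 : ∀ i, MemLp (fun x => √|u₀ x i|) 2 volume := fun i => by
    simpa using memLp_sqrt_abs (hu₁ i)
  have r4 : ∀ i, MemLp (fun x => √|u₀ x i|) 4 volume := fun i => by
    have := memLp_sqrt_abs (hu₂ i)
    rwa [show (2 : ℝ≥0∞) * 2 = 4 by norm_num] at this
  have hbs := h.b_s_pos.le
  have n2 := fun i => l2_nonneg fun x => √|u₀ x i|
  have n4 := fun i => l4_nonneg fun x => √|u₀ x i|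
  refine ⟨b_s * ∑ i, l2 (fun x => √|u₀ x i|) * l4 (fun x => √|u₀ x i|) * √(L * U),
    mul_nonneg hbs (Finset.sum_nonneg fun i _ =>
      mul_nonneg (mul_nonneg (n2 i) (n4 i)) (Real.sqrt_nonneg _)), fun v G hv hU => ?_⟩
  have hv2 := fun i => (hv.isH1 i).memLp
  rw [innerB_eq_sum h hu₂ hv2, Finset.mul_sum, Finset.sum_mul]
  refine Finset.sum_le_sum fun i _ => ?_
  have hm4 := memLp_mul_four (r4 i) (hv.memLp_four i)
  have hz4 : l4 (fun x => v x i) ≤ √(L * U) * √√(dissip η v G) := by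
    rw [← Real.sqrt_mul (by positivity)]
    exact Real.le_sqrt_of_sq_le (hl h hv hU i)
  -- `|u₀ v| = |u₀|^(1/2) (|u₀|^(1/2) |v|)`, with factors in `L²` and, for the latter, `L⁴ · L⁴`.
  have h1 : ∫ x, b x * u₀ x i * v x i ≤
      b_s * ∫ x, |(√|u₀ x i|)| * |(√|u₀ x i|) * v x i| := by
    rw [← integral_const_mul]
    refine integral_mono (integrable_mul_L2 (h.memLp_b_mul (hu₂ i)) (hv2 i))
      ((integrable_mul_L2 (r2 i).abs hm4.abs).const_mul _) fun x => ?_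
    refine (le_abs_self _).trans ?_
    simp only [abs_mul, abs_of_nonneg (Real.sqrt_nonneg |u₀ x i|)]
    rw [← mul_assoc √|u₀ x i|, Real.mul_self_sqrt (abs_nonneg _), ← mul_assoc]
    gcongr
    exact h.abs_b_le x
  refine h1.trans ?_
  rw [mul_assoc b_s]
  refine mul_le_mul_of_nonneg_left ?_ hbs
  refine (le_abs_self _).trans ((abs_integral_mul_le (r2 i).abs hm4.abs).trans ?_)
  have e : ∀ w : Plane → ℝ, l2 |w| = l2 w := fun w => by
    rw [l2, l2, ← eLpNorm_norm w]; rfl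
  rw [e, e, mul_assoc, mul_assoc]
  refine mul_le_mul_of_nonneg_left ?_ (n2 i)
  exact (l2_mul_four_le (r4 i) (hv.memLp_four i)).trans (mul_le_mul_of_nonneg_left hz4 (n4 i))

/-- The energy bound on `[y ^ 20, 2 y ^ 20]` which follows from the Duhamel inequality if `∇b` is
bounded.  Until time `y` the force is used as a derivative of integrable fields, with mollification
at scale `y⁻¹`; after time `y` its decay in `L²` suffices. -/
lemma exists_energy_le_of_bounded_grad (h : Coefficients b η b_i b_s M) {K : ℝ}
    (hK : ∀ x, ‖fderiv ℝ b x‖ ≤ K) {κ : ℝ} (hf : IsDecayingForce f κ)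
    (hu₁ : ∀ i, MemLp (fun x => u₀ x i) 1 volume) (hu₂ : ∀ i, MemLp (fun x => u₀ x i) 2 volume)
    {g : Fin 2 → ℝ → Plane → Plane} {m : ℝ} (hm : 0 ≤ m)
    (hg : ∀ j, ∀ᵐ t ∂(volume.restrict (Ici (0 : ℝ))), eLpNorm (g j t) 1 volume ≤ ENNReal.ofReal m)
    (hfg : ∀ᵐ t ∂(volume.restrict (Ici (0 : ℝ))), IsFirstDerivOf (f t) (fun j => g j t))
    {c U C : ℝ} (hU : 0 ≤ U) (hC : 0 ≤ C) :
    ∃ K' : ℝ, 0 ≤ K' ∧ ∀ u Du, Apriori b η f u₀ u Du c U C → ∀ y : ℝ, 1 ≤ y →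
      ∀ᵐ s ∂(volume.restrict (Icc (y ^ 20) (2 * y ^ 20))), innerB b (u s) (u s) ≤
        K' * (y⁻¹ + y ^ 19 * dissip η (u s) (Du s)) +
        K' * ((∫ τ in (0 : ℝ)..s, √(dissip η (u τ) (Du τ))) * √(dissip η (u s) (Du s))) := by
  obtain ⟨Q, hQ0, hQ⟩ := exists_innerB_initial_le h hu₁ hu₂ hU
  obtain ⟨C₂, hC₂, hforce⟩ := exists_abs_innerB_force_le h hK hf hm hg hfg hU
  have hbs := h.b_s_pos
  have hκ := hf.nonneg
  set C₃ := 2 * b_s * U * κ with hC₃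
  have hC₃0 : 0 ≤ C₃ := by positivity
  refine ⟨Q + 3 * C₂ + C₃ + C, by positivity, fun u Du ap y hy => ?_⟩
  have hy0 : 0 < y := by linarith
  have hyi : 0 < y⁻¹ := inv_pos.2 hy0
  have hyi1 : y⁻¹ ≤ 1 := inv_le_one_of_one_le₀ hy
  have hsub : Icc (y ^ 20) (2 * y ^ 20) ⊆ Ici 0 := fun s hs => (pow_nonneg hy0.le 20).trans hs.1
  filter_upwards [ae_restrict_of_ae_restrict_of_subset hsub ap.inV,
    ae_restrict_of_ae_restrict_of_subset hsub ap.duhamel, ae_restrict_mem measurableSet_Icc]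
    with s hV hd hs
  have hs0 : 0 ≤ s := hsub hs
  have hys : y ≤ s := (le_self_pow₀ hy (by norm_num)).trans hs.1
  set D := dissip η (u s) (Du s) with hD
  have hD0 : 0 ≤ D := dissip_nonneg
  -- A bound on the force is integrated which changes its form at time `y`.
  set P : ℝ → ℝ := fun τ => C₂ * (y⁻¹ * rate τ * (1 + √D) + (y⁻¹⁻¹) ^ 3 * √√D) with hP
  set X : ℝ → ℝ := fun τ => if τ ≤ y then P τ else C₃ * rate τ with hX
  have ir := fun {s t : ℝ} (hs : 0 ≤ s) (ht : 0 ≤ t) => intervalIntegrable_rate hs ht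
  have iP0 : IntervalIntegrable (fun τ => y⁻¹ * rate τ * (1 + √D)) volume 0 y :=
    ((ir le_rfl hy0.le).const_mul _).mul_const _
  have iP : IntervalIntegrable P volume 0 y :=
    (iP0.add (by simp)).const_mul _
  have iR : IntervalIntegrable (fun τ => C₃ * rate τ) volume y s := (ir hy0.le hs0).const_mul _
  have eP : EqOn P X (uIoc 0 y) := fun τ hτ => by
    rw [uIoc_of_le hy0.le] at hτ
    simp only [hX, if_pos hτ.2]
  have eR : EqOn (fun τ => C₃ * rate τ) X (uIoc y s) := fun τ hτ => by
    rw [uIoc_of_le hys] at hτ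
    simp only [hX, if_neg hτ.1.not_ge]
  have iX1 : IntervalIntegrable X volume 0 y := iP.congr eP
  have iX2 : IntervalIntegrable X volume y s := iR.congr eR
  have iX := iX1.trans iX2
  have key := hd X iX (by
    filter_upwards [hforce, hf.ae_abs_innerB_le h] with τ h1 h2
    simp only [hX]
    split_ifs
    · exact h1 _ _ hV (ap.bound s hs0) _ hyi hyi1
    · exact h2 _ _ (ap.memLp s hs0) (ap.bound s hs0))
  have iD : IntervalIntegrable (fun τ => √(dissip η (u τ) (Du τ))) volume 0 s :=
    intervalIntegrable_sqrt_dissip (ap.integrable 0 s le_rfl hs0)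
  rw [intervalIntegral.integral_add ((iD.mul_const _).const_mul _) iX,
    intervalIntegral.integral_const_mul, intervalIntegral.integral_mul_const,
    ← intervalIntegral.integral_add_adjacent_intervals iX1 iX2,
    ← intervalIntegral.integral_congr_ae (ae_of_all _ eP),
    ← intervalIntegral.integral_congr_ae (ae_of_all _ eR),
    intervalIntegral.integral_const_mul, intervalIntegral.integral_const_mul,
    intervalIntegral.integral_add iP0 (by simp), intervalIntegral.integral_mul_const,
    intervalIntegral.integral_const_mul, intervalIntegral.integral_const, sub_zero, inv_inv,
    smul_eq_mul] at key
  set I := ∫ τ in (0 : ℝ)..s, √(dissip η (u τ) (Du τ))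
  have hI0 : 0 ≤ I * √D := mul_nonneg
    (intervalIntegral.integral_nonneg hs0 fun _ _ => Real.sqrt_nonneg _) (Real.sqrt_nonneg _)
  have hy19 : 1 ≤ y ^ 19 := one_le_pow₀ hy
  set Z := y⁻¹ + y ^ 19 * D with hZ
  have hDZ : D ≤ y ^ 19 * D := le_mul_of_one_le_left hD0 hy19
  have hq : √√D ≤ Z := by
    refine (sqrt_sqrt_le hD0 hy).trans (add_le_add ?_ ?_)
    · exact pow_le_of_le_one hyi.le hyi1 (by norm_num)
    · exact mul_le_mul_of_nonneg_right (pow_le_pow_right₀ hy (by norm_num)) hD0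
  have hq' : y * (y ^ 3 * √√D) ≤ Z := by
    have h1 := mul_le_mul_of_nonneg_left (sqrt_sqrt_le hD0 hy) (pow_nonneg hy0.le 4)
    have h2 : y ^ 4 * (y⁻¹ ^ 5 + y ^ 15 * D) = Z := by
      rw [hZ]; field_simp
    linarith
  have hp : y⁻¹ * (∫ τ in (0 : ℝ)..y, rate τ) * (1 + √D) ≤ 2 * Z := by
    have h1 : ∫ τ in (0 : ℝ)..y, rate τ ≤ 1 :=
      (integral_rate_le le_rfl hy0.le).trans
        (div_le_one_of_le₀ (one_le_exp_one_add le_rfl) (exp_one_add_pos le_rfl).le)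
    have h2 : y⁻¹ * (∫ τ in (0 : ℝ)..y, rate τ) * (1 + √D) ≤ y⁻¹ * 1 * (1 + √D) := by
      gcongr
    have h3 : y⁻¹ * D ≤ D := mul_le_of_le_one_left hD0 hyi1
    have h4 := mul_le_mul_of_nonneg_left (sqrt_le_one_add hD0) hyi.le
    linarith
  have hr : ∫ τ in y..s, rate τ ≤ Z := by
    have h1 : 1 / (Real.exp 1 + y) ≤ y⁻¹ := by
      rw [one_div]; exact inv_anti₀ hy0 (by linarith [Real.exp_pos 1])
    have := integral_rate_le hy0.le hys
    have : 0 ≤ y ^ 19 * D := by positivity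
    linarith
  have a1 := mul_le_mul_of_nonneg_left hq hQ0
  have a2 := mul_le_mul_of_nonneg_left (add_le_add hp hq') hC₂
  have a3 := mul_le_mul_of_nonneg_left hr hC₃0
  have a4 := hQ _ _ hV (ap.bound s hs0)
  have hZ0 : 0 ≤ Z := by positivity
  have a5 : 0 ≤ C * Z := by positivity
  have a6 : 0 ≤ (Q + 3 * C₂ + C₃) * (I * √D) := by positivity
  linarith

/-- If `η` is bounded away from zero then the dissipation dominates the energy. -/
lemma innerB_self_le_dissip (h : Coefficients b η b_i b_s M) {η₀ : ℝ} (hη₀ : 0 < η₀)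
    (hη : ∀ x, η₀ ≤ η x) {v : Plane → Plane} {G : Fin 2 → Fin 2 → Plane → ℝ} (hv : InV b v G) :
    innerB b v v ≤ b_s / η₀ * dissip η v G := by
  have hv2 := fun i => (hv.isH1 i).memLp
  have hbs := h.b_s_pos.le
  rw [innerB_eq_sum h hv2 hv2, dissip_eq h, mul_add, Finset.mul_sum]
  have h0 : 0 ≤ b_s / η₀ * ∑ i, ∑ j, ∫ x, G i j x ^ 2 := mul_nonneg (by positivity)
    (Finset.sum_nonneg fun i _ => Finset.sum_nonneg fun j _ =>
      integral_nonneg fun x => sq_nonneg _)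
  refine le_add_of_le_of_nonneg (Finset.sum_le_sum fun i _ => ?_) h0
  rw [← integral_const_mul]
  have hi : Integrable (fun x => η x * v x i ^ 2) volume := by
    have := integrable_mul_L2 (h.memLp_η_mul (hv2 i)) (hv2 i)
    refine this.congr (Eventually.of_forall fun x => ?_)
    simp only; ring
  refine integral_mono (integrable_mul_L2 (h.memLp_b_mul (hv2 i)) (hv2 i)) (hi.const_mul _)
    fun x => ?_
  have h1 : b x * v x i * v x i ≤ b_s * v x i ^ 2 := by
    rw [mul_assoc, ← sq]
    exact mul_le_mul_of_nonneg_right (h.upper x) (sq_nonneg _)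
  refine h1.trans ?_
  rw [div_mul_eq_mul_div, le_div_iff₀ hη₀]
  have := mul_le_mul_of_nonneg_left (hη x) (mul_nonneg hbs (sq_nonneg (v x i)))
  simp only
  linarith

/-- The energy bound on `[y ^ 20, 2 y ^ 20]` is immediate if `η` is bounded away from zero. -/
lemma exists_energy_le_of_lower_bound (h : Coefficients b η b_i b_s M) {η₀ : ℝ} (hη₀ : 0 < η₀)
    (hη : ∀ x, η₀ ≤ η x) {c U C : ℝ} :
    ∃ K : ℝ, 0 ≤ K ∧ ∀ u Du, Apriori b η f u₀ u Du c U C → ∀ y : ℝ, 1 ≤ y →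
      ∀ᵐ s ∂(volume.restrict (Icc (y ^ 20) (2 * y ^ 20))), innerB b (u s) (u s) ≤
        K * (y⁻¹ + y ^ 19 * dissip η (u s) (Du s)) +
        K * ((∫ τ in (0 : ℝ)..s, √(dissip η (u τ) (Du τ))) * √(dissip η (u s) (Du s))) := by
  have hbs := h.b_s_pos
  refine ⟨b_s / η₀, by positivity, fun u Du ap y hy => ?_⟩
  have hy0 : 0 < y := by linarith
  have hsub : Icc (y ^ 20) (2 * y ^ 20) ⊆ Ici 0 := fun s hs => (pow_nonneg hy0.le 20).trans hs.1
  filter_upwards [ae_restrict_of_ae_restrict_of_subset hsub ap.inV,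
    ae_restrict_mem measurableSet_Icc] with s hV hs
  have hD0 : 0 ≤ dissip η (u s) (Du s) := dissip_nonneg
  have h1 : 0 ≤ ∫ τ in (0 : ℝ)..s, √(dissip η (u τ) (Du τ)) :=
    intervalIntegral.integral_nonneg (hsub hs) fun _ _ => Real.sqrt_nonneg _
  refine (innerB_self_le_dissip h hη₀ hη hV).trans (le_add_of_le_of_nonneg
    (mul_le_mul_of_nonneg_left ?_ (by positivity)) (by positivity))
  have h2 := le_mul_of_one_le_left hD0 (one_le_pow₀ hy (n := 19))
  have h3 : 0 < y⁻¹ := inv_pos.2 hy0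
  linarith

/-- Logarithmic decay of the energy, from its bound on the intervals `[y ^ 20, 2 y ^ 20]`. -/
lemma exists_energy_log_decay (h : Coefficients b η b_i b_s M) {c U C K : ℝ} (hc : 0 < c)
    (hU : 0 ≤ U) (hC : 0 ≤ C) (hK : 0 ≤ K) :
    ∃ A : ℝ, 0 ≤ A ∧ ∀ u Du, Apriori b η f u₀ u Du c U C →
      (∀ y : ℝ, 1 ≤ y → ∀ᵐ s ∂(volume.restrict (Icc (y ^ 20) (2 * y ^ 20))), innerB b (u s) (u s) ≤
        K * (y⁻¹ + y ^ 19 * dissip η (u s) (Du s)) +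
        K * ((∫ τ in (0 : ℝ)..s, √(dissip η (u τ) (Du τ))) * √(dissip η (u s) (Du s)))) →
      ∀ t, 0 ≤ t → innerB b (u t) (u t) * Real.log (Real.exp 1 + t) ≤ A := by
  have hbs := h.b_s_pos
  set Φ₀ := b_s * (2 * (U * U)) + C with hΦ₀
  have hΦ₀0 : 0 ≤ Φ₀ := by positivity
  obtain ⟨A, hA⟩ := exists_log_decay (2 * K / c) (C + K * (1 + Φ₀ / c)) Φ₀ (by positivity)
    (by positivity)
  refine ⟨max A 0, le_max_right _ _, fun u Du ap hbd t ht => ?_⟩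
  have hE0 : ∀ t, 0 ≤ t → 0 ≤ innerB b (u t) (u t) := fun t ht =>
    (mul_nonneg h.pos.le (sq_nonneg _)).trans (le_innerB_self h (ap.memLp t ht) 0)
  have hE : ∀ t, 0 ≤ t → innerB b (u t) (u t) ≤ b_s * (2 * (U * U)) := fun t ht => by
    refine (le_abs_self _).trans ((abs_innerB_le h (ap.memLp t ht) (ap.memLp t ht)).trans
      (mul_le_mul_of_nonneg_left ((Finset.sum_le_sum fun i _ => mul_le_mul (ap.bound t ht i)
        (ap.bound t ht i) (l2_nonneg _) hU).trans (le_of_eq (by simp))) hbs.le))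
  have hCt : ∀ t, 0 ≤ t → 0 ≤ C / (Real.exp 1 + t) := fun t ht =>
    div_nonneg hC (exp_one_add_pos ht).le
  have hΦ0 : ∀ t, 0 ≤ t → 0 ≤ innerB b (u t) (u t) + C / (Real.exp 1 + t) := fun t ht =>
    add_nonneg (hE0 t ht) (hCt t ht)
  have hΦ : ∀ t, 0 ≤ t → innerB b (u t) (u t) + C / (Real.exp 1 + t) ≤ Φ₀ := fun t ht =>
    add_le_add (hE t ht) (div_le_self hC (one_le_exp_one_add ht))
  have key := hA (fun t => innerB b (u t) (u t) + C / (Real.exp 1 + t)) hΦ0 hΦ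
    (fun y σ hy hσ hσy => recursion_step (D := fun τ => dissip η (u τ) (Du τ)) hc hC hK
      (fun _ => dissip_nonneg) hΦ0 hΦ ap.integrable
      (fun s t hs ht => intervalIntegrable_sqrt_dissip (ap.integrable s t hs ht))
      ap.energy hy hσ hσy ((hbd y hy).mono fun s hs => by linarith)) t ht
  have hlog : 0 ≤ Real.log (Real.exp 1 + t) := Real.log_nonneg (one_le_exp_one_add ht)
  refine (mul_le_mul_of_nonneg_right ?_ hlog).trans (key.trans (le_max_left _ _))
  exact le_add_of_nonneg_right (hCt t ht)

/-- The norm of a field is controlled by the weighted energy. -/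
lemma eLpNorm_le_of_energy_log (h : Coefficients b η b_i b_s M) {v : Plane → Plane}
    (hv : ∀ i, MemLp (fun x => v x i) 2 volume) {A l : ℝ} (hA : 0 ≤ A) (hl : 0 < l)
    (hvA : innerB b v v * l ≤ A) :
    eLpNorm v 2 volume ≤ ENNReal.ofReal (2 * √(A / b_i) * l ^ (-(1 / 2) : ℝ)) := by
  have hbi := h.pos
  have h2 : l ^ (-(1 / 2) : ℝ) = (√l)⁻¹ := by
    rw [Real.rpow_neg hl.le, Real.sqrt_eq_rpow]
  have h1 : ∀ i, l2 (fun x => v x i) ≤ √(A / b_i) * l ^ (-(1 / 2) : ℝ) := by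
    intro i
    rw [h2, ← div_eq_mul_inv, ← Real.sqrt_div (by positivity)]
    refine Real.le_sqrt_of_sq_le ?_
    rw [le_div_iff₀ hl, le_div_iff₀ hbi]
    have := mul_le_mul_of_nonneg_right (le_innerB_self h hv i) hl.le
    linarith
  have h3 : eLpNorm v 2 volume ≤
      eLpNorm (fun x => v x 0) 2 volume + eLpNorm (fun x => v x 1) 2 volume := by
    rw [← eLpNorm_norm (fun x => v x 0), ← eLpNorm_norm (fun x => v x 1)]
    refine (eLpNorm_mono_real fun x => ?_).trans
      (eLpNorm_add_le (hv 0).1.norm (hv 1).1.norm (by norm_num))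
    rw [EuclideanSpace.norm_eq, Fin.sum_univ_two]
    simp only [Pi.add_apply]
    refine Real.sqrt_le_iff.2 ⟨by positivity, ?_⟩
    nlinarith [norm_nonneg (v x 0), norm_nonneg (v x 1)]
  have h4 : ∀ i, eLpNorm (fun x => v x i) 2 volume ≤
      ENNReal.ofReal (√(A / b_i) * l ^ (-(1 / 2) : ℝ)) := fun i =>
    (ENNReal.le_ofReal_iff_toReal_le (hv i).2.ne ((l2_nonneg _).trans (h1 i))).2 (h1 i)
  refine h3.trans ((add_le_add (h4 0) (h4 1)).trans (le_of_eq ?_))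
  rw [← ENNReal.ofReal_add (by positivity) (by positivity)]
  congr 1; ring

end Conclusion

end ShallowWater

theorem theorem4
    (ν : ℝ) (hν : 0 < ν)
    (b η : ShallowWater.Plane → ℝ)
    (b_i b_s : ℝ) (hb_i : 0 < b_i)
    (hb : ContDiff ℝ ∞ b) (hb_bounds : ∀ x, b_i ≤ b x ∧ b x ≤ b_s)
    (hη : ContDiff ℝ ∞ η) (hη_pos : ∀ x, 0 < η x) (hη_bdd : ∃ M : ℝ, ∀ x, η x ≤ M)
    (hbη : (∃ K : ℝ, ∀ x, ‖fderiv ℝ b x‖ ≤ K) ∨ (∃ η₀ : ℝ, 0 < η₀ ∧ ∀ x, η₀ ≤ η x))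
    (u₀ : ShallowWater.Plane → ShallowWater.Plane)
    (hu₀_one : MemLp u₀ 1 volume) (hu₀_two : MemLp u₀ 2 volume)
    (f : ℝ → ShallowWater.Plane → ShallowWater.Plane)
    (hf_meas : AEStronglyMeasurable (fun p : ℝ × ShallowWater.Plane => f p.1 p.2)
      ((volume.restrict (Ici (0 : ℝ))).prod volume))
    (g : Fin 2 → ℝ → ShallowWater.Plane → ShallowWater.Plane)
    (hg_meas : ∀ j, AEStronglyMeasurable (fun p : ℝ × ShallowWater.Plane => g j p.1 p.2)
      ((volume.restrict (Ici (0 : ℝ))).prod volume))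
    (hg : ∃ M : ℝ, ∀ j, ∀ᵐ t ∂(volume.restrict (Ici (0 : ℝ))),
      eLpNorm (g j t) 1 volume ≤ ENNReal.ofReal M)
    (hfg : ∀ᵐ t ∂(volume.restrict (Ici (0 : ℝ))),
      ShallowWater.IsFirstDerivOf (f t) (fun j => g j t))
    (κ : ℝ)
    (hf : ∀ᵐ t ∂(volume.restrict (Ici (0 : ℝ))),
      eLpNorm (f t) 2 volume ≤ ENNReal.ofReal (κ * (Real.exp 1 + t) ^ (-2 : ℤ))) :
    ∃ C : ℝ, ∀ u : ℝ → ShallowWater.Plane → ShallowWater.Plane,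
      ShallowWater.IsWeakSolution ν b η f u₀ u →
        ∀ t : ℝ, 0 ≤ t →
          eLpNorm (u t) 2 volume ≤
            ENNReal.ofReal (C * (Real.log (Real.exp 1 + t)) ^ (-(1 / 2) : ℝ)) := by
  obtain ⟨M, hM⟩ := hη_bdd
  obtain ⟨m, hm⟩ := hg
  have h : ShallowWater.Coefficients b η b_i b_s M :=
    ⟨hb_i, hb, fun x => (hb_bounds x).1, fun x => (hb_bounds x).2, hη, hη_pos, hM⟩
  have hF : ShallowWater.IsDecayingForce f |κ| := by
    refine ⟨abs_nonneg κ, hf_meas, ?_⟩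
    filter_upwards [hf, hf_meas.prodMk_left] with t h1 h2
    have h3 := h1.trans (ENNReal.ofReal_le_ofReal
      (mul_le_mul_of_nonneg_right (le_abs_self κ) (ShallowWater.rate_nonneg t)))
    exact ⟨⟨h2, h3.trans_lt ENNReal.ofReal_lt_top⟩, h3⟩
  have hu₁ := ShallowWater.memLp_apply hu₀_one
  have hu₂ := ShallowWater.memLp_apply hu₀_two
  obtain ⟨c, U, C, hc, hU, hC, hap⟩ := ShallowWater.exists_apriori hν h hu₂ hF
  obtain ⟨K, hK, hbd⟩ : ∃ K : ℝ, 0 ≤ K ∧ ∀ u Du, ShallowWater.Apriori b η f u₀ u Du c U C →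
      ∀ y : ℝ, 1 ≤ y → ∀ᵐ s ∂(volume.restrict (Icc (y ^ 20) (2 * y ^ 20))),
        ShallowWater.innerB b (u s) (u s) ≤
          K * (y⁻¹ + y ^ 19 * ShallowWater.dissip η (u s) (Du s)) +
          K * ((∫ τ in (0 : ℝ)..s, √(ShallowWater.dissip η (u τ) (Du τ))) *
            √(ShallowWater.dissip η (u s) (Du s))) := by
    rcases hbη with ⟨B, hB⟩ | ⟨η₀, hη₀, hη₁⟩
    · exact ShallowWater.exists_energy_le_of_bounded_grad h hB hF hu₁ hu₂ (abs_nonneg m)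
        (fun j => (hm j).mono fun t ht => ht.trans (ENNReal.ofReal_le_ofReal (le_abs_self m)))
        hfg hU hC
    · exact ShallowWater.exists_energy_le_of_lower_bound h hη₀ hη₁
  obtain ⟨A, hA, hdecay⟩ := ShallowWater.exists_energy_log_decay (f := f) (u₀ := u₀) h hc hU hC hK
  refine ⟨2 * √(A / b_i), fun u ⟨Du, hu⟩ t ht => ?_⟩
  have ap := hap u Du hu
  refine ShallowWater.eLpNorm_le_of_energy_log h (ap.memLp t ht) hA
    (Real.log_pos ?_) (hdecay u Du ap (hbd u Du ap) t ht)
  have := Real.one_lt_exp_iff.2 one_pos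
  linarith
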